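/- **Notation.** For a number field $k$ let $S_k$ be its set of archimedean places, $k_\sigma$ the completion at $\sigma\in S_k$, $n_\sigma=[k_\sigma:\mathbb R]$, $k_\infty=k\otimes_{\mathbb Q}\mathbb R=\prod_\sigma k_\sigma$, and $w_k$ the number of roots of unity in $k$; $|\cdot|$ is the usual absolute value of $\mathbb C$ (restricted to $k_\sigma\subset\mathbb C$) and $\|\cdot\|$ the usual Hermitian norm on $k_\sigma^n$. Let $T_k=\prod_{\sigma\in S_k}\mathbb R_{>0}$ with the measure $d^\times t_k=\prod_\sigma n_\sigma\,dt_\sigma/t_\sigma$. For an extension $k'/k$ let $T_{k'/k}$ be the kernel of the norm $T_{k'}\to T_k$, $(t_\tau)_\tau\mapsto\bigl(\prod_{\tau\mid\sigma}t_\tau^{[k'_\tau:k_\sigma]}\bigr)_\sigma$, with the Haar measure $d^\times t_{k'/k}$ normalized so that the quotient measure on $T_{k'}/T_{k'/k}\simeq T_k$ is $d^\times t_k$. Let $U_k\subset T_{k/\mathbb Q}$ be the image of $\mathcal O_k^\times$, and $U_{k'/k}\subset T_{k'/k}$ the image of $\{u\in\mathcal O_{k'}^\times : N_{k'/k}(u)=1\}$,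 under $u\mapsto(|\tau(u)|)_\tau$; let $R_k=\mathrm{vol}(T_{k/\mathbb Q}/U_k)$, $R_{k'/k}=\mathrm{vol}(T_{k'/k}/U_{k'/k})$, and $$\Gamma_{k'/k}(s)=\int_{T_{k'/k}}\prod_{\sigma\in S_k}\Bigl(\sum_{\tau\mid\sigma}t_\tau^2\Bigr)^{-[k':k]\,n_\sigma s/2}d^\times t_{k'/k}\qquad(\mathrm{Re}\,s>1).$$ **Setting.** Let $E/F$ be an extension of number fields of degree $n$, let $w=(w_1,\dots,w_n)$ be a basis of $E$ over $F$, and $\mathfrak A\subset E$ a nonzero fractional $\mathcal O_E$-ideal. Let $\mathfrak h_F^n=\prod_{\sigma\in S_F}GL_n(F_\sigma)/F_\sigma^\times K_\sigma$, where $K_\sigma=O(n)$ for $\sigma$ real and $K_\sigma=U(n)$ for $\sigma$ complex. Fix embeddings $F_\sigma\subset E_\tau\subset\mathbb C$ ($\tau\mid\sigma$). Identify $E_\tau$ with $F_\sigma$ if $[E_\tau:F_\sigma]=1$, and with $F_\sigma^2=\mathbb R^2$ by $x+iy\mapsto(y,x)$ if $[E_\tau:F_\sigma]=2$; this gives an isomorphism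 $\iota:E_\infty\simeq F_\infty^n$ after ordering the coordinates. Let $W=(W_\sigma)_\sigma\in GL_n(F_\infty)$ be the matrix with $xW=\iota(x\cdot w)$ for row vectors $x$, let $I(t)\in GL_n(F_\infty)$ (for $t\in T_{E/F}$) be the matrix of componentwise multiplication by $t$ on $E_\infty\simeq F_\infty^n$, and put $\varpi(t)=[WI(t)]\in\mathfrak h_F^n$. Let $L=\{x\in F^n : x\cdot w\in\mathfrak A\}$ and $\Gamma=\{\gamma\in SL_n(F):L\gamma=L\}$. The map $\varpi$ induces $\overline\varpi:T_{E/F}/U_{E/F}\to\Gamma\backslash\mathfrak h_F^n$. A fractional $\mathcal O_F$-ideal $\mathfrak a$ is called anti-integral if $1\in\mathfrak a$; for such $\mathfrak a$ let $L_{\mathfrak a}=\{x\in L\setminus\{0\}: Fx\cap L=\mathfrak a x\}$. For $\mathrm{Re}\,s>1$ define the $\Gamma$-invariant function $$E_L([g],s)=\sum_{\mathscr A\in Cl_F}\ \sum_{\substack{\mathfrak a\in\mathscr A\\ \text{anti-integral}}}\ \sum_{x\in\mathcal O_F^\times\backslash L_{\mathfrak a}}\Bigl(\prod_{\sigma\in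 S_F}\frac{|\det g_\sigma|^{n_\sigma}}{\|xg_\sigma\|^{n n_\sigma}}\Bigr)^{s}.$$ Let $|\Delta_w|=|N_{F_\infty/\mathbb R}((\det W)^2)|=\prod_{\sigma\in S_F}|\det W_\sigma|^{2n_\sigma}$, let $\zeta_E(\mathfrak A^{-1},s)=\sum_{\mathfrak b}N\mathfrak b^{-s}$ be the sum over the nonzero ideals $\mathfrak b\subset\mathcal O_E$ in the ideal class of $\mathfrak A^{-1}$, and let $$c_{E/F}(s)=R_{E/F}\,\frac{w_E R_E^{-1}\,\Gamma_{E/\mathbb Q}(s)}{w_F R_F^{-1}\,\Gamma_{F/\mathbb Q}(ns)}.$$ **Theorem.** Let $\mathrm{Re}\,s>1$. The series defining $E_L(\varpi(t),s)$ (for every $t\in T_{E/F}$) and $\zeta_E(\mathfrak A^{-1},s)$ converge absolutely, $t\mapsto E_L(\overline\varpi(t),s)$ is integrable on $T_{E/F}/U_{E/F}$, and $$\int_{T_{E/F}/U_{E/F}}E_L(\overline\varpi(t),s)\,d^\times t_{E/F}=|\Delta_w|^{s/2}\,c_{E/F}(s)\,N(\mathfrak A)^{-s}\,\zeta_E(\mathfrak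 A^{-1},s).$$ This holds for every extension $E/F$ of number fields; the cases $F=\mathbb Q$ and $[E:F]=2$ are included (Hecke's and Yamamoto's formulas). -/

import Mathlib

set_option linter.unusedSectionVars false

open NumberField NumberField.InfinitePlace MeasureTheory
open scoped nonZeroDivisors Matrix ENNReal

namespace HeckeIntegral

noncomputable section

section Tori

/-- `T_k = ∏_{σ ∈ S_k} ℝ_{>0}`, a group under componentwise multiplication. -/
abbrev Torus (k : Type*) [Field k] : Type _ := InfinitePlace k → {x : ℝ // 0 < x}

/-- The measure `dt / t` on `ℝ_{>0}`. -/
def posHaar : Measure {x : ℝ // 0 < x} :=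
  (Measure.comap Subtype.val (volume : Measure ℝ)).withDensity
    (fun t => ENNReal.ofReal (t : ℝ)⁻¹)

/-- The measure `d^× t_k` on `T_k`: the product over the archimedean places of `dt / t` at the real
places and of `dt² / t² = 2 dt / t` at the complex ones. -/
def torusHaar (k : Type*) [Field k] [NumberField k] : Measure (Torus k) :=
  Measure.pi (fun σ : InfinitePlace k => (σ.mult : ℝ≥0∞) • posHaar)

/-- The multiplicative regulator map `𝓞_k^× → T_k`, `u ↦ (|σ(u)|)_σ`. -/
def regMap (k : Type*) [Field k] : (𝓞 k)ˣ →* Torus k where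
  toFun u := fun σ => ⟨σ (u : k), pos_iff.mpr (by simp)⟩
  map_one' := by
    funext σ; ext; simp
  map_mul' u v := by
    funext σ; ext; simp

variable (k k' : Type*) [Field k] [NumberField k] [Field k'] [NumberField k'] [Algebra k k']

/-- The norm map `T_{k'} → T_k`, `(t_τ) ↦ (∏_{τ ∣ σ} t_τ ^ [k'_τ : k_σ])_σ`. Here
`σ.inertiaDeg τ` is `[k'_τ : k_σ]` if `τ ∣ σ`, and `0` otherwise. -/
def torusNorm : Torus k' →* Torus k where
  toFun t := fun σ => ∏ τ : InfinitePlace k', t τ ^ σ.inertiaDeg τ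
  map_one' := by
    funext σ; simp
  map_mul' t u := by
    funext σ; simp [mul_pow, Finset.prod_mul_distrib]

/-- `T_{k'/k}`, the kernel of the norm map `T_{k'} → T_k`. -/
def relTorus : Subgroup (Torus k') := (torusNorm k k').ker

/-- The section `(u_σ)_σ ↦ (u_{τ|_k} ^ (1/[k':k]))_τ` of the norm map `T_{k'} → T_k`. -/
def torusSection (u : Torus k) : Torus k' := fun τ =>
  ⟨(u (τ.comap (algebraMap k k')) : ℝ) ^ ((Module.finrank k k' : ℝ)⁻¹),
    Real.rpow_pos_of_pos (u _).2 _⟩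

lemma comap_eq_of_inertiaDeg_ne_zero (k k' : Type*) [Field k] [Field k'] [Algebra k k']
    {σ : InfinitePlace k} {τ : InfinitePlace k'}
    (h : σ.inertiaDeg τ ≠ 0) : τ.comap (algebraMap k k') = σ := by
  unfold InfinitePlace.inertiaDeg at h
  split_ifs at h with h1
  · exact LiesOver.comap_eq τ σ
  · exact absurd rfl h

lemma sum_inertiaDeg (σ : InfinitePlace k) :
    ∑ τ : InfinitePlace k', σ.inertiaDeg τ = Module.finrank k k' := by
  classical
  rw [← sum_inertiaDeg_eq_finrank k k' σ]
  symm
  apply Finset.sum_subset (Finset.subset_univ _)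
  intro τ _ hτ
  unfold InfinitePlace.inertiaDeg
  rw [dif_neg]
  intro h
  exact hτ (Set.mem_toFinset.2 h)

lemma torusNorm_torusSection (u : Torus k) : torusNorm k k' (torusSection k k' u) = u := by
  funext σ
  have hn : (Module.finrank k k' : ℝ) ≠ 0 := by
    have : Module.finrank k k' ≠ 0 := Module.finrank_pos.ne'
    exact_mod_cast this
  have key : ∀ τ : InfinitePlace k', torusSection k k' u τ ^ σ.inertiaDeg τ =
      (⟨(u σ : ℝ) ^ ((Module.finrank k k' : ℝ)⁻¹),
        Real.rpow_pos_of_pos (u _).2 _⟩ : {x : ℝ // 0 < x}) ^ σ.inertiaDeg τ := by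
    intro τ
    by_cases h : σ.inertiaDeg τ = 0
    · simp [h]
    · have := comap_eq_of_inertiaDeg_ne_zero k k' h
      subst this
      rfl
  change ∏ τ : InfinitePlace k', torusSection k k' u τ ^ σ.inertiaDeg τ = u σ
  rw [Finset.prod_congr rfl (fun τ _ => key τ), Finset.prod_pow_eq_pow_sum, sum_inertiaDeg]
  ext
  rw [Positive.val_pow]
  exact Real.rpow_inv_natCast_pow (u σ).2.le (by exact_mod_cast hn)

/-- The projection `T_{k'} → T_{k'/k}` along the section of the norm map. -/
def torusProj (t : Torus k') : relTorus k k' :=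
  ⟨t * (torusSection k k' (torusNorm k k' t))⁻¹, by
    rw [relTorus, MonoidHom.mem_ker, map_mul, map_inv, torusNorm_torusSection, mul_inv_cancel]⟩

/-- The Haar measure `d^× t_{k'/k}` on `T_{k'/k}`, normalized so that `d^× t_{k'}` is the product
of `d^× t_{k'/k}` and of the measure `d^× t_k` on `T_k = T_{k'} / T_{k'/k}`. In the decomposition
`T_{k'} = T_{k'/k} × T_k` given by the section of the norm map, the measure of `A ⊆ T_{k'/k}` is the
`d^× t_{k'}`-measure of `A × [1, e]^{S_k}` divided by the `d^× t_k`-measure `∏_σ n_σ` of the box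
`[1, e]^{S_k}`. -/
def relHaar : Measure (relTorus k k') :=
  (∏ σ : InfinitePlace k, (σ.mult : ℝ≥0∞))⁻¹ •
    ((torusHaar k').restrict
      {t | ∀ σ, (torusNorm k k' t σ : ℝ) ∈ Set.Icc 1 (Real.exp 1)}).map (torusProj k k')

/-- The relative unit group `𝓞_{k'/k}^×`, the kernel of the norm `𝓞_{k'}^× → 𝓞_k^×`. -/
def relUnits : Subgroup (𝓞 k')ˣ := (Units.map (RingOfIntegers.norm k : 𝓞 k' →* 𝓞 k)).ker

/-- `U_{k'/k} ⊆ T_{k'/k}`, the image of the relative unit group under the regulator map. -/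
def relUnitLattice : Subgroup (relTorus k k') :=
  ((relUnits k k').map (regMap k')).subgroupOf (relTorus k k')

/-- `U_k ⊆ T_{k/ℚ}`, the image of the whole unit group under the regulator map. -/
def unitLattice : Subgroup (relTorus ℚ k) := (regMap k).range.subgroupOf (relTorus ℚ k)

end Tori

open Classical in
/-- The measure induced on `G ⧸ U` by an invariant measure `ν` on the commutative group `G`, for a
countable discrete subgroup `U`: the image of the restriction of `ν` to a fundamental domain
(it does not depend on the fundamental domain). -/
def quotientMeasure {G : Type*} [CommGroup G] [MeasurableSpace G] (ν : Measure G)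
    (U : Subgroup G) : Measure (G ⧸ U) :=
  if h : ∃ D : Set G, IsFundamentalDomain U.op D ν then
    (ν.restrict h.choose).map (QuotientGroup.mk : G → G ⧸ U)
  else 0

section Constants

variable (k k' : Type*) [Field k] [NumberField k] [Field k'] [NumberField k'] [Algebra k k']

/-- The regulator `R_k`, the volume of `T_{k/ℚ} / U_k`. -/
def regulator : ℝ := (quotientMeasure (relHaar ℚ k) (unitLattice k)).real Set.univ

/-- The relative regulator `R_{k'/k}`, the volume of `T_{k'/k} / U_{k'/k}`. -/
def relRegulator : ℝ := (quotientMeasure (relHaar k k') (relUnitLattice k k')).real Set.univ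

open Classical in
/-- The relative gamma factor `Γ_{k'/k}(s)`. -/
def relGamma (s : ℂ) : ℂ :=
  ∫ t : relTorus k k', ∏ σ : InfinitePlace k,
    1 / ((∑ τ : InfinitePlace k' with τ.LiesOver σ, ((t : Torus k') τ : ℝ) ^ 2 : ℝ) : ℂ) ^
      ((Module.finrank k k' : ℂ) * σ.mult * s / 2) ∂(relHaar k k')

/-- The constant `c_{k'/k}(s)`. -/
def cFactor (s : ℂ) : ℂ :=
  relRegulator k k' *
    ((Units.torsionOrder k' * (regulator k' : ℂ)⁻¹ * relGamma ℚ k' s) /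
      (Units.torsionOrder k * (regulator k : ℂ)⁻¹ *
        relGamma ℚ k ((Module.finrank k k' : ℂ) * s)))

end Constants

section UpperHalfSpace

variable (F : Type*) [Field F] [NumberField F] (n : ℕ)

/-- `G(ℝ) = ∏_{σ ∈ S_F} GL_n(F_σ)`. -/
abbrev GLInf : Type _ := ∀ σ : InfinitePlace F, GL (Fin n) σ.Completion

variable {F}

/-- The scalar matrices `F_σ^× ⊆ GL_n(F_σ)`. -/
def scalars (σ : InfinitePlace F) : Subgroup (GL (Fin n) σ.Completion) :=
  (Units.map (Matrix.scalar (Fin n) :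
    σ.Completion →+* Matrix (Fin n) (Fin n) σ.Completion).toMonoidHom).range

/-- The maximal compact subgroup `K_σ ⊆ GL_n(F_σ)`: the matrices that are unitary in `GL_n(ℂ)`,
that is `O(n)` if `σ` is real and `U(n)` if `σ` is complex. -/
def maxCompact (σ : InfinitePlace F) : Subgroup (GL (Fin n) σ.Completion) where
  carrier := {k | (k : Matrix (Fin n) (Fin n) σ.Completion).map (Completion.extensionEmbedding σ) ∈
    Matrix.unitaryGroup (Fin n) ℂ}
  one_mem' := by
    simp only [Set.mem_ofPred_eq, Units.val_one]
    rw [Matrix.map_one _ (map_zero _) (map_one _)]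
    exact one_mem _
  mul_mem' := by
    intro a b ha hb
    simp only [Set.mem_ofPred_eq, Units.val_mul, Matrix.map_mul] at ha hb ⊢
    exact mul_mem ha hb
  inv_mem' := by
    intro a ha
    simp only [Set.mem_ofPred_eq] at ha ⊢
    have h1 : (a : Matrix (Fin n) (Fin n) σ.Completion).map (Completion.extensionEmbedding σ) *
        ((a⁻¹ : GL (Fin n) σ.Completion) : Matrix (Fin n) (Fin n) σ.Completion).map
          (Completion.extensionEmbedding σ) = 1 := by
      rw [← Matrix.map_mul, ← Units.val_mul, mul_inv_cancel, Units.val_one,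
        Matrix.map_one _ (map_zero _) (map_one _)]
    have h2 := Matrix.mem_unitaryGroup_iff'.1 ha
    have h3 := left_inv_eq_right_inv h2 h1
    rw [← h3]
    exact Unitary.star_mem ha

variable (F)

/-- The subgroup `F_∞^× K` of `G(ℝ)`. -/
def scalarCompact : Subgroup (GLInf F n) :=
  Subgroup.pi Set.univ (fun σ => scalars n σ ⊔ maxCompact n σ)

/-- The generalized upper half space `𝔥_F^n = G(ℝ) / F_∞^× K`. -/
abbrev UpperHalf : Type _ := GLInf F n ⧸ scalarCompact F n

variable {F n}

/-- The `σ`-component `σ(x) g_σ ∈ F_σ^n` of the row vector `x g`. -/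
def rowMul (x : Fin n → F) (g : GLInf F n) (σ : InfinitePlace F) : Fin n → σ.Completion :=
  (fun i => algebraMap F σ.Completion (x i)) ᵥ* (g σ : Matrix (Fin n) (Fin n) σ.Completion)

/-- The Euclidean (Hermitian) norm on `F_σ^n`. -/
def vecNorm {σ : InfinitePlace F} (v : Fin n → σ.Completion) : ℝ :=
  Real.sqrt (∑ j, ‖v j‖ ^ 2)

/-- `∏_σ |det g_σ|^{n_σ} / ‖x g_σ‖^{n n_σ}`. -/
def detTerm (x : Fin n → F) (g : GLInf F n) : ℝ :=
  ∏ σ : InfinitePlace F, ‖(g σ : Matrix (Fin n) (Fin n) σ.Completion).det‖ ^ σ.mult /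
    vecNorm (rowMul x g σ) ^ (n * σ.mult)

lemma vecNorm_smul {σ : InfinitePlace F} (a : σ.Completion) (v : Fin n → σ.Completion) :
    vecNorm (a • v) = ‖a‖ * vecNorm v := by
  unfold vecNorm
  simp only [Pi.smul_apply, smul_eq_mul, norm_mul, mul_pow, ← Finset.mul_sum]
  rw [Real.sqrt_mul (sq_nonneg _), Real.sqrt_sq (norm_nonneg _)]

lemma norm_extensionEmbedding {σ : InfinitePlace F} (a : σ.Completion) :
    ‖Completion.extensionEmbedding σ a‖ = ‖a‖ :=
  (Completion.isometry_extensionEmbedding σ).norm_map_of_map_zero (map_zero _) a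

lemma vecNorm_unitary {σ : InfinitePlace F} {k : GL (Fin n) σ.Completion}
    (hk : k ∈ maxCompact n σ) (v : Fin n → σ.Completion) :
    vecNorm (v ᵥ* (k : Matrix (Fin n) (Fin n) σ.Completion)) = vecNorm v := by
  unfold vecNorm
  congr 1
  have hk' : (k : Matrix (Fin n) (Fin n) σ.Completion).map (Completion.extensionEmbedding σ) ∈
    Matrix.unitaryGroup (Fin n) ℂ := hk
  rw [Matrix.mem_unitaryGroup_iff] at hk'
  have key : ∀ u : Fin n → σ.Completion, ((∑ j, ‖u j‖ ^ 2 : ℝ) : ℂ) =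
      (Completion.extensionEmbedding σ ∘ u) ⬝ᵥ star (Completion.extensionEmbedding σ ∘ u) := by
    intro u
    simp only [dotProduct, Function.comp, Pi.star_apply, Complex.ofReal_sum]
    refine Finset.sum_congr rfl fun j _ => ?_
    rw [← norm_extensionEmbedding]
    exact (Complex.mul_conj' _).symm ▸ by simp
  have hv : Completion.extensionEmbedding σ ∘ (v ᵥ* (k : Matrix (Fin n) (Fin n) σ.Completion)) =
      (Completion.extensionEmbedding σ ∘ v) ᵥ*
        (k : Matrix (Fin n) (Fin n) σ.Completion).map (Completion.extensionEmbedding σ) := by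
    funext j
    exact RingHom.map_vecMul _ _ _ _
  apply Complex.ofReal_injective
  rw [key, key, hv, Matrix.star_vecMul, ← Matrix.dotProduct_mulVec, Matrix.mulVec_mulVec]
  rw [Matrix.star_eq_conjTranspose] at hk'
  rw [hk', Matrix.one_mulVec]

lemma norm_det_unitary {σ : InfinitePlace F} {k : GL (Fin n) σ.Completion}
    (hk : k ∈ maxCompact n σ) : ‖(k : Matrix (Fin n) (Fin n) σ.Completion).det‖ = 1 := by
  have h := Matrix.det_of_mem_unitary (show
    (k : Matrix (Fin n) (Fin n) σ.Completion).map (Completion.extensionEmbedding σ) ∈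
      Matrix.unitaryGroup (Fin n) ℂ from hk)
  rw [← norm_extensionEmbedding, RingHom.map_det]
  exact CStarRing.norm_of_mem_unitary h

lemma detTerm_mul (x : Fin n → F) (g h : GLInf F n) (hh : h ∈ scalarCompact F n) :
    detTerm x (g * h) = detTerm x g := by
  unfold detTerm
  refine Finset.prod_congr rfl fun σ _ => ?_
  have hσ : h σ ∈ scalars n σ ⊔ maxCompact n σ := hh σ (Set.mem_univ σ)
  have hnorm : (scalars n σ).Normal := by
    constructor
    rintro _ ⟨a, rfl⟩ b
    refine ⟨a, ?_⟩
    ext1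
    simp only [Units.coe_map, Units.val_mul]
    have := (Matrix.scalar_commute (n := Fin n) (a : σ.Completion) (fun _ => Commute.all _ _)
      (b : Matrix (Fin n) (Fin n) σ.Completion))
    change Matrix.scalar (Fin n) (a : σ.Completion) = (b : Matrix (Fin n) (Fin n) σ.Completion) *
      Matrix.scalar (Fin n) (a : σ.Completion) * ((b⁻¹ : GL (Fin n) σ.Completion) : Matrix _ _ _)
    rw [← this.eq, mul_assoc, ← Units.val_mul, mul_inv_cancel, Units.val_one, mul_one]
  rw [Subgroup.mem_sup_of_normal_left] at hσ
  obtain ⟨_, ⟨a, rfl⟩, k, hk, hak⟩ := hσ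
  have hval : ((g * h) σ : Matrix (Fin n) (Fin n) σ.Completion) =
      (a : σ.Completion) • ((g σ : Matrix (Fin n) (Fin n) σ.Completion) *
        (k : Matrix (Fin n) (Fin n) σ.Completion)) := by
    rw [Pi.mul_apply, ← hak, Units.val_mul, Units.val_mul]
    change _ * (Matrix.scalar (Fin n) (a : σ.Completion) * _) = _
    rw [← mul_assoc, ← (Matrix.scalar_commute (n := Fin n) (a : σ.Completion)
      (fun _ => Commute.all _ _) (g σ : Matrix (Fin n) (Fin n) σ.Completion)).eq,
      Matrix.scalar_apply, mul_assoc, ← Matrix.smul_eq_diagonal_mul]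
  have ha : ‖(a : σ.Completion)‖ ≠ 0 := norm_ne_zero_iff.2 a.ne_zero
  unfold rowMul
  rw [hval, Matrix.det_smul, Matrix.det_mul, norm_mul, norm_mul, norm_det_unitary hk,
    Matrix.vecMul_smul, vecNorm_smul, ← Matrix.vecMul_vecMul, vecNorm_unitary hk, norm_pow,
    Fintype.card_fin, mul_one, mul_pow, mul_pow, ← pow_mul,
    mul_div_mul_left _ _ (pow_ne_zero _ ha)]

lemma detTerm_units (u : (𝓞 F)ˣ) (x : Fin n → F) (g : GLInf F n) :
    detTerm (u • x) g = detTerm x g := by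
  have h1 : ∀ σ : InfinitePlace F, vecNorm (rowMul (u • x) g σ) =
      σ (u : F) * vecNorm (rowMul x g σ) := by
    intro σ
    have : rowMul (u • x) g σ = (algebraMap F σ.Completion (u : F)) • rowMul x g σ := by
      unfold rowMul
      rw [← Matrix.smul_vecMul]
      congr 1
      funext i
      simp only [Pi.smul_apply, smul_eq_mul, ← map_mul]
      rfl
    rw [this, vecNorm_smul]
    congr 1
    exact Completion.norm_coe σ (WithAbs.toAbs _ (u : F))
  have hu : ∏ σ : InfinitePlace F, σ (u : F) ^ σ.mult = 1 := by
    rw [prod_eq_abs_norm]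
    have := NumberField.isUnit_iff_norm.1 u.isUnit
    rw [RingOfIntegers.coe_norm] at this
    exact_mod_cast this
  unfold detTerm
  simp only [h1, mul_pow]
  rw [Finset.prod_div_distrib, Finset.prod_div_distrib, Finset.prod_mul_distrib]
  have : ∏ σ : InfinitePlace F, σ (u : F) ^ (n * σ.mult) = 1 := by
    simp only [mul_comm n, pow_mul]
    rw [Finset.prod_pow, hu, one_pow]
  rw [this, one_mul]

/-- The function `z = [g] ↦ ∏_σ |det g_σ|^{n_σ} / ‖x g_σ‖^{n n_σ}` on `𝔥_F^n`. -/
def detFn (x : Fin n → F) (z : UpperHalf F n) : ℝ :=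
  Quotient.liftOn' z (detTerm x) (fun g h hgh => by
    rw [QuotientGroup.leftRel_apply] at hgh
    rw [← detTerm_mul x g _ hgh, mul_inv_cancel_left])

variable (F n) in
/-- The orbits of `𝓞_F^×` in `F^n`. -/
abbrev UnitOrbits : Type _ := MulAction.orbitRel.Quotient (𝓞 F)ˣ (Fin n → F)

/-- `detFn` as a function of the orbit `𝓞_F^× x`. -/
def detOrbit (o : UnitOrbits F n) (z : UpperHalf F n) : ℝ :=
  Quotient.liftOn' o (fun x => detFn x z) (fun x y hxy => by
    obtain ⟨u, rfl⟩ := MulAction.orbitRel_apply.1 hxy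
    induction z using Quotient.inductionOn' with
    | h g => exact detTerm_units u y g)

end UpperHalfSpace

section Eisenstein

variable {F : Type*} [Field F] [NumberField F] {n : ℕ}

/-- `L_𝔞 = {x ∈ L ∖ {0} ∣ F x ∩ L = 𝔞 x}`. -/
def primitiveVectors (L : Submodule (𝓞 F) (Fin n → F)) (𝔞 : FractionalIdeal (𝓞 F)⁰ F) :
    Set (Fin n → F) :=
  {x | x ∈ L ∧ x ≠ 0 ∧ {y | (∃ c : F, y = c • x) ∧ y ∈ L} = {y | ∃ c ∈ 𝔞, y = c • x}}

/-- The quotient `𝓞_F^× ∖ L_𝔞`, as a set of orbits of `𝓞_F^×`. -/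
def primitiveOrbits (L : Submodule (𝓞 F) (Fin n → F)) (𝔞 : FractionalIdeal (𝓞 F)⁰ F) :
    Set (UnitOrbits F n) :=
  (Quotient.mk'' : (Fin n → F) → UnitOrbits F n) '' primitiveVectors L 𝔞

variable (F) in
/-- The anti-integral ideals of `F`: the fractional ideals that contain `1`. -/
abbrev AntiIntegral : Type _ :=
  {𝔞 : (FractionalIdeal (𝓞 F)⁰ F)ˣ // (1 : F) ∈ (𝔞 : FractionalIdeal (𝓞 F)⁰ F)}

/-- `Σ_{x ∈ 𝓞_F^× ∖ L_𝔞} ∏_σ |det g_σ|^{n_σ s} / ‖x g_σ‖^{n n_σ s}` at `z = [g]`. -/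
def eisensteinIdeal (L : Submodule (𝓞 F) (Fin n → F)) (𝔞 : FractionalIdeal (𝓞 F)⁰ F) (s : ℂ)
    (z : UpperHalf F n) : ℂ :=
  ∑' o : primitiveOrbits L 𝔞, (detOrbit (o : UnitOrbits F n) z : ℂ) ^ s

/-- `E_{L,𝒜}(z, s)`, the sum over the anti-integral ideals in the class `𝒜`. -/
def eisensteinClass (L : Submodule (𝓞 F) (Fin n → F)) (𝒜 : ClassGroup (𝓞 F)) (s : ℂ)
    (z : UpperHalf F n) : ℂ :=
  ∑' 𝔞 : {𝔞 : AntiIntegral F // ClassGroup.mk F 𝔞.1 = 𝒜}, eisensteinIdeal L 𝔞.1.1 s z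

/-- `E_L(z, s)`. -/
def eisenstein (L : Submodule (𝓞 F) (Fin n → F)) (s : ℂ) (z : UpperHalf F n) : ℂ :=
  ∑ 𝒜 : ClassGroup (𝓞 F), eisensteinClass L 𝒜 s z

/-- `Γ_L`, the stabilizer of `L` in `SL_n(F)` acting on row vectors from the right. -/
def arithSubgroup (L : Submodule (𝓞 F) (Fin n → F)) :
    Subgroup (Matrix.SpecialLinearGroup (Fin n) F) where
  carrier := {γ | (fun x => x ᵥ* (γ : Matrix (Fin n) (Fin n) F)) '' (L : Set (Fin n → F)) = L}
  one_mem' := by simp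
  mul_mem' := by
    intro a b ha hb
    simp only [Set.mem_ofPred_eq] at ha hb ⊢
    nth_rewrite 2 [← hb]
    nth_rewrite 2 [← ha]
    rw [Set.image_image]
    simp [Matrix.vecMul_vecMul]
  inv_mem' := by
    intro a ha
    simp only [Set.mem_ofPred_eq] at ha ⊢
    nth_rewrite 1 [← ha]
    rw [Set.image_image]
    simp only [Matrix.vecMul_vecMul, ← Matrix.SpecialLinearGroup.coe_mul, mul_inv_cancel,
      Matrix.SpecialLinearGroup.coe_one, Matrix.vecMul_one, Set.image_id']

variable (F n) in
/-- The embedding `SL_n(F) → G(ℝ)`. -/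
def slEmbed : Matrix.SpecialLinearGroup (Fin n) F →* GLInf F n :=
  MonoidHom.pi fun σ => (Matrix.SpecialLinearGroup.toGL).comp
    (Matrix.SpecialLinearGroup.map (algebraMap F σ.Completion))

/-- `Γ_L ∖ 𝔥_F^n`, where `Γ_L` acts by left multiplication. -/
abbrev ArithQuotient (L : Submodule (𝓞 F) (Fin n → F)) : Type _ :=
  MulAction.orbitRel.Quotient ((arithSubgroup L).map (slEmbed F n)) (UpperHalf F n)

/-- The right action of `SL_n(F)` on the orbits of `𝓞_F^×` in `F^n`. -/
def orbitMul (γ : Matrix.SpecialLinearGroup (Fin n) F) (o : UnitOrbits F n) : UnitOrbits F n :=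
  Quotient.map' (fun x => x ᵥ* (γ : Matrix (Fin n) (Fin n) F)) (fun x y hxy => by
    obtain ⟨u, rfl⟩ := MulAction.orbitRel_apply.1 hxy
    exact MulAction.orbitRel_apply.2 ⟨u, (Matrix.smul_vecMul u y _).symm⟩) o

lemma orbitMul_mul (γ δ : Matrix.SpecialLinearGroup (Fin n) F) (o : UnitOrbits F n) :
    orbitMul δ (orbitMul γ o) = orbitMul (γ * δ) o := by
  induction o using Quotient.inductionOn' with
  | h x =>
    change (Quotient.mk'' _ : UnitOrbits F n) = Quotient.mk'' _
    simp [Matrix.vecMul_vecMul]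

lemma orbitMul_one (o : UnitOrbits F n) : orbitMul 1 o = o := by
  induction o using Quotient.inductionOn' with
  | h x =>
    change (Quotient.mk'' _ : UnitOrbits F n) = Quotient.mk'' _
    simp

lemma orbitMul_mem {L : Submodule (𝓞 F) (Fin n → F)} {𝔞 : FractionalIdeal (𝓞 F)⁰ F}
    {γ : Matrix.SpecialLinearGroup (Fin n) F} (hγ : γ ∈ arithSubgroup L) {o : UnitOrbits F n}
    (ho : o ∈ primitiveOrbits L 𝔞) : orbitMul γ o ∈ primitiveOrbits L 𝔞 := by
  have mem : ∀ {δ : Matrix.SpecialLinearGroup (Fin n) F}, δ ∈ arithSubgroup L →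
      ∀ {y : Fin n → F}, y ∈ L → y ᵥ* (δ : Matrix (Fin n) (Fin n) F) ∈ L := by
    intro δ hδ y hy
    have : (fun x => x ᵥ* (δ : Matrix (Fin n) (Fin n) F)) '' (L : Set (Fin n → F)) = L := hδ
    have h2 : y ᵥ* (δ : Matrix (Fin n) (Fin n) F) ∈ (L : Set (Fin n → F)) := by
      rw [← this]; exact ⟨y, hy, rfl⟩
    exact h2
  have cancel : ∀ y : Fin n → F, (y ᵥ* (γ : Matrix (Fin n) (Fin n) F)) ᵥ*
      ((γ⁻¹ : Matrix.SpecialLinearGroup (Fin n) F) : Matrix (Fin n) (Fin n) F) = y := by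
    intro y
    rw [Matrix.vecMul_vecMul, ← Matrix.SpecialLinearGroup.coe_mul, mul_inv_cancel,
      Matrix.SpecialLinearGroup.coe_one, Matrix.vecMul_one]
  obtain ⟨x, ⟨hxL, hx0, hx⟩, rfl⟩ := ho
  refine ⟨x ᵥ* (γ : Matrix (Fin n) (Fin n) F), ⟨mem hγ hxL, ?_, ?_⟩, rfl⟩
  · intro h0
    apply hx0
    rw [← cancel x, h0, Matrix.zero_vecMul]
  · have hc : ∀ c : F, c • x ∈ L ↔ c ∈ 𝔞 := by
      intro c
      constructor
      · intro hcL
        have : c • x ∈ {y | ∃ c ∈ 𝔞, y = c • x} := by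
          rw [← hx]; exact ⟨⟨c, rfl⟩, hcL⟩
        obtain ⟨c', hc', hcc⟩ := this
        rwa [smul_left_injective F hx0 hcc]
      · intro hc
        have : c • x ∈ {y | (∃ c : F, y = c • x) ∧ y ∈ L} := by
          rw [hx]; exact ⟨c, hc, rfl⟩
        exact this.2
    have hc' : ∀ c : F, c • (x ᵥ* (γ : Matrix (Fin n) (Fin n) F)) ∈ L ↔ c ∈ 𝔞 := by
      intro c
      rw [← hc, ← Matrix.smul_vecMul]
      refine ⟨fun h => ?_, mem hγ⟩
      rw [← cancel (c • x)]
      exact mem (inv_mem hγ) h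
    ext y
    constructor
    · rintro ⟨⟨c, rfl⟩, hy⟩
      exact ⟨c, (hc' c).1 hy, rfl⟩
    · rintro ⟨c, hc, rfl⟩
      exact ⟨⟨c, rfl⟩, (hc' c).2 hc⟩

lemma detOrbit_slEmbed (γ : Matrix.SpecialLinearGroup (Fin n) F) (o : UnitOrbits F n)
    (z : UpperHalf F n) : detOrbit o (slEmbed F n γ • z) = detOrbit (orbitMul γ o) z := by
  induction o using Quotient.inductionOn' with
  | h x =>
  induction z using Quotient.inductionOn' with
  | h g =>
    change detTerm x (slEmbed F n γ * g) = detTerm (x ᵥ* (γ : Matrix (Fin n) (Fin n) F)) g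
    unfold detTerm
    refine Finset.prod_congr rfl fun σ _ => ?_
    have h1 : ((slEmbed F n γ * g) σ : Matrix (Fin n) (Fin n) σ.Completion) =
        (γ : Matrix (Fin n) (Fin n) F).map (algebraMap F σ.Completion) *
          (g σ : Matrix (Fin n) (Fin n) σ.Completion) := rfl
    have h2 : ((γ : Matrix (Fin n) (Fin n) F).map (algebraMap F σ.Completion)).det = 1 := by
      rw [← RingHom.mapMatrix_apply, ← RingHom.map_det, γ.2, map_one]
    unfold rowMul
    rw [h1, Matrix.det_mul, h2, one_mul, ← Matrix.vecMul_vecMul]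
    congr 4
    funext j
    exact (RingHom.map_vecMul (algebraMap F σ.Completion) _ x j).symm

lemma eisensteinIdeal_smul (L : Submodule (𝓞 F) (Fin n → F)) (𝔞 : FractionalIdeal (𝓞 F)⁰ F) (s : ℂ)
    {γ : Matrix.SpecialLinearGroup (Fin n) F} (hγ : γ ∈ arithSubgroup L) (z : UpperHalf F n) :
    eisensteinIdeal L 𝔞 s (slEmbed F n γ • z) = eisensteinIdeal L 𝔞 s z := by
  unfold eisensteinIdeal
  let e : primitiveOrbits L 𝔞 ≃ primitiveOrbits L 𝔞 :=
    { toFun := fun o => ⟨orbitMul γ o, orbitMul_mem hγ o.2⟩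
      invFun := fun o => ⟨orbitMul γ⁻¹ o, orbitMul_mem (inv_mem hγ) o.2⟩
      left_inv := fun o => Subtype.ext (by simp [orbitMul_mul, orbitMul_one])
      right_inv := fun o => Subtype.ext (by simp [orbitMul_mul, orbitMul_one]) }
  rw [← e.tsum_eq (fun o => (detOrbit (o : UnitOrbits F n) z : ℂ) ^ s)]
  refine tsum_congr fun o => ?_
  rw [detOrbit_slEmbed]
  rfl

/-- `E_L(·, s)` as a function on `Γ_L ∖ 𝔥_F^n`. -/
def eisensteinQuotient (L : Submodule (𝓞 F) (Fin n → F)) (s : ℂ) (z : ArithQuotient L) : ℂ :=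
  Quotient.liftOn' z (eisenstein L s) (fun x y hxy => by
    obtain ⟨⟨_, γ, hγ, rfl⟩, rfl⟩ := MulAction.orbitRel_apply.1 hxy
    change eisenstein L s (slEmbed F n γ • y) = _
    simp only [eisenstein, eisensteinClass, eisensteinIdeal_smul L _ s hγ])

end Eisenstein

section HeegnerObject

variable (F E : Type*) [Field F] [NumberField F] [Field E] [NumberField E] [Algebra F E] (n : ℕ)

/-- The auxiliary choices in the identification `E_∞ ≃ F_∞^n`: for every archimedean place `τ` of
`E`, above `σ` say, an embedding of `E_τ` into `ℂ` that extends the fixed embedding `F_σ ⊆ ℂ`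
(given by its restriction to `E`), and for every `σ` an ordering of the coordinates of
`∏_{τ ∣ σ} F_σ ^ [E_τ : F_σ]`. -/
structure LocalChoice where
  emb : InfinitePlace E → (E →+* ℂ)
  mk_emb : ∀ τ, InfinitePlace.mk (emb τ) = τ
  emb_comp : ∀ τ, (emb τ).comp (algebraMap F E) = (τ.comap (algebraMap F E)).embedding
  ord : ∀ σ : InfinitePlace F, (Σ τ : InfinitePlace E, Fin (σ.inertiaDeg τ)) ≃ Fin n

/-- Such choices exist if `n = [E : F]`. -/
lemma nonempty_localChoice (hn : Module.finrank F E = n) : Nonempty (LocalChoice F E n) := by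
  classical
  have h1 : ∀ τ : InfinitePlace E, ∃ φ : E →+* ℂ, InfinitePlace.mk φ = τ ∧
      φ.comp (algebraMap F E) = (τ.comap (algebraMap F E)).embedding := by
    intro τ
    have : τ.LiesOver (τ.comap (algebraMap F E)) := ⟨rfl⟩
    rcases LiesOver.embedding_comp_eq_or_conjugate_embedding_comp_eq τ
      (τ.comap (algebraMap F E)) with h | h
    · exact ⟨_, mk_embedding τ, h⟩
    · exact ⟨_, by rw [mk_conjugate_eq, mk_embedding], h⟩
  choose φ hφ hφ' using h1
  have h2 : ∀ σ : InfinitePlace F,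
      Fintype.card (Σ τ : InfinitePlace E, Fin (σ.inertiaDeg τ)) = Fintype.card (Fin n) := by
    intro σ
    simp [Fintype.card_sigma, sum_inertiaDeg F E σ, hn]
  exact ⟨⟨φ, hφ, hφ', fun σ => Fintype.equivOfCardEq (h2 σ)⟩⟩

variable {F E n}

open Classical in
/-- The element of `F_σ` that corresponds to `c ∈ ℂ` (to its real part if `σ` is real) under the
embedding `F_σ ⊆ ℂ`. -/
def ofComplex (σ : InfinitePlace F) (c : ℂ) : σ.Completion :=
  if h : σ.IsReal then (Completion.ringEquivRealOfIsReal h).symm c.re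
  else (Completion.ringEquivComplexOfIsComplex (not_isReal_iff_isComplex.1 h)).symm c

/-- The coordinates in `F_σ^m` of `c = x + i y ∈ E_τ ⊆ ℂ`, where `m = [E_τ : F_σ]`:
just `c` if `m = 1`, and `(y, x)` if `m = 2`. -/
def localCoord (σ : InfinitePlace F) (m : ℕ) (c : ℂ) (j : Fin m) : σ.Completion :=
  ofComplex σ (if m = 2 ∧ (j : ℕ) = 0 then (c.im : ℂ) else c)

/-- The rows `ι(w_1)_σ, …, ι(w_n)_σ` before the ordering of the coordinates. -/
def localRows (w : Module.Basis (Fin n) F E) (D : LocalChoice F E n) (σ : InfinitePlace F) :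
    Matrix (Fin n) (Σ τ : InfinitePlace E, Fin (σ.inertiaDeg τ)) σ.Completion :=
  fun i c => localCoord σ (σ.inertiaDeg c.1) (D.emb c.1 (w i)) c.2

/-- The `σ`-component of the matrix `W` of `F_∞^n ≃ E_∞ ≃ F_∞^n`, acting on row vectors from the
right: its `i`-th row is `ι(w_i)_σ`. -/
def basisMatrix (w : Module.Basis (Fin n) F E) (D : LocalChoice F E n) (σ : InfinitePlace F) :
    Matrix (Fin n) (Fin n) σ.Completion :=
  (localRows w D σ).submatrix id (D.ord σ).symm

lemma ext_ofComplex_of_real {σ : InfinitePlace F} (h : σ.IsReal) (c : ℂ) :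
    Completion.extensionEmbedding σ (ofComplex σ c) = c.re := by
  rw [ofComplex, dif_pos h, ← Completion.extensionEmbeddingOfIsReal_apply h,
    ← Completion.ringEquivRealOfIsReal_apply, RingEquiv.apply_symm_apply]

lemma ext_ofComplex_of_not_real {σ : InfinitePlace F} (h : ¬ σ.IsReal) (c : ℂ) :
    Completion.extensionEmbedding σ (ofComplex σ c) = c := by
  rw [ofComplex, dif_neg h,
    ← Completion.ringEquivComplexOfIsComplex_apply (not_isReal_iff_isComplex.1 h),
    RingEquiv.apply_symm_apply]

lemma ext_ofComplex_ofReal (σ : InfinitePlace F) (c : ℝ) :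
    Completion.extensionEmbedding σ (ofComplex σ c) = c := by
  by_cases h : σ.IsReal
  · rw [ext_ofComplex_of_real h, Complex.ofReal_re]
  · rw [ext_ofComplex_of_not_real h]

lemma liesOver_of_inertiaDeg_ne_zero {σ : InfinitePlace F} {τ : InfinitePlace E}
    (h : σ.inertiaDeg τ ≠ 0) : τ.LiesOver σ := by
  by_contra h1
  exact h (by unfold InfinitePlace.inertiaDeg; rw [dif_neg h1])

lemma mult_mul_inertiaDeg {σ : InfinitePlace F} {τ : InfinitePlace E}
    (h : σ.inertiaDeg τ ≠ 0) : σ.mult * σ.inertiaDeg τ = τ.mult := by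
  have := liesOver_of_inertiaDeg_ne_zero h
  rw [inertiaDeg_eq_finrank]
  exact mult_mul_finrank σ τ

lemma emb_isReal_iff (D : LocalChoice F E n) (τ : InfinitePlace E) :
    ComplexEmbedding.IsReal (D.emb τ) ↔ τ.IsReal := by
  rw [← isReal_mk_iff, D.mk_emb]

/-- The three possible local situations. -/
lemma local_cases (D : LocalChoice F E n) (σ : InfinitePlace F) (τ : InfinitePlace E) :
    σ.inertiaDeg τ = 0 ∨
    (σ.inertiaDeg τ = 2 ∧ σ.IsReal ∧ ¬ ComplexEmbedding.IsReal (D.emb τ)) ∨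
    (σ.inertiaDeg τ = 1 ∧ σ.IsReal ∧ ∀ z, (D.emb τ z).im = 0) ∨
    (σ.inertiaDeg τ = 1 ∧ ¬ σ.IsReal ∧ ¬ ComplexEmbedding.IsReal (D.emb τ)) := by
  by_cases h0 : σ.inertiaDeg τ = 0
  · exact Or.inl h0
  have h := mult_mul_inertiaDeg h0
  rw [emb_isReal_iff]
  by_cases hσ : σ.IsReal <;> by_cases hτ : τ.IsReal <;> simp [mult, hσ, hτ] at h
  · refine Or.inr (Or.inr (Or.inl ⟨h, hσ, fun z => ?_⟩))
    have := (emb_isReal_iff D τ).2 hτ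
    have h2 := RingHom.congr_fun (ComplexEmbedding.isReal_iff.1 this) z
    exact Complex.conj_eq_iff_im.1 h2
  · exact Or.inr (Or.inl ⟨h, hσ, hτ⟩)
  · exact Or.inr (Or.inr (Or.inr ⟨h, hσ, hτ⟩))

/-- The coordinates as complex numbers. -/
def coordC (σ : InfinitePlace F) (m : ℕ) (c : ℂ) (j : Fin m) : ℂ :=
  Completion.extensionEmbedding σ (localCoord σ m c j)

/-- The matrix of the multiplication by `c` in local coordinates. -/
def mulBlock (m : ℕ) (c : ℂ) : Matrix (Fin m) (Fin m) ℂ := fun j l =>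
  if m = 2 then (if j = l then (c.re : ℂ) else if (j : ℕ) = 0 then -(c.im : ℂ) else (c.im : ℂ))
  else if j = l then c else 0

lemma coordC_mul (D : LocalChoice F E n) (σ : InfinitePlace F) (τ : InfinitePlace E) (a z : E)
    (l : Fin (σ.inertiaDeg τ)) :
    coordC σ _ (D.emb τ (a * z)) l =
      ∑ j, coordC σ _ (D.emb τ z) j * mulBlock _ (D.emb τ a) j l := by
  rcases local_cases D σ τ with h | ⟨h, h1, h2⟩ | ⟨h, h1, h2⟩ | ⟨h, h1, h2⟩ <;>
    revert l <;> rw [h] <;> intro l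
  · exact l.elim0
  · rw [Fin.sum_univ_two]
    fin_cases l <;>
      simp [coordC, localCoord, mulBlock, ext_ofComplex_of_real h1] <;> ring
  · rw [Fin.sum_univ_one]
    fin_cases l
    simp only [coordC, localCoord, mulBlock, ext_ofComplex_of_real h1, map_mul]
    have : D.emb τ a = ((D.emb τ a).re : ℂ) := by
      apply Complex.ext <;> simp [h2]
    simp [h2]
    rw [this]; simp; ring
  · rw [Fin.sum_univ_one]
    fin_cases l
    simp [coordC, localCoord, mulBlock, ext_ofComplex_of_not_real h1]
    ring

lemma mulBlock_mul_conjTranspose (σ : InfinitePlace F) (τ : InfinitePlace E)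
    (D : LocalChoice F E n) (c : ℂ) :
    mulBlock (σ.inertiaDeg τ) c * (mulBlock (σ.inertiaDeg τ) c)ᴴ =
      ((‖c‖ ^ 2 : ℝ) : ℂ) • (1 : Matrix _ _ ℂ) := by
  have hc : ((‖c‖ ^ 2 : ℝ) : ℂ) = (c.re : ℂ) * c.re + c.im * c.im := by
    rw [← Complex.normSq_eq_norm_sq, Complex.normSq_apply]; push_cast; ring
  have hc1 : c * (starRingEnd ℂ) c = ((‖c‖ ^ 2 : ℝ) : ℂ) := by
    rw [Complex.mul_conj, Complex.normSq_eq_norm_sq]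
  rcases local_cases D σ τ with h | ⟨h, -⟩ | ⟨h, -⟩ | ⟨h, -⟩ <;> rw [h]
  · ext l; exact l.elim0
  · rw [hc]
    ext j l
    fin_cases j <;> fin_cases l <;>
      simp [Matrix.mul_apply, mulBlock, Matrix.conjTranspose_apply] <;> ring
  · ext j l
    fin_cases j; fin_cases l
    simpa [Matrix.mul_apply, mulBlock, Matrix.conjTranspose_apply] using hc1
  · ext j l
    fin_cases j; fin_cases l
    simpa [Matrix.mul_apply, mulBlock, Matrix.conjTranspose_apply] using hc1

lemma coordC_add (D : LocalChoice F E n) (σ : InfinitePlace F) (τ : InfinitePlace E) (y z : E)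
    (l : Fin (σ.inertiaDeg τ)) :
    coordC σ _ (D.emb τ (y + z)) l = coordC σ _ (D.emb τ y) l + coordC σ _ (D.emb τ z) l := by
  unfold coordC localCoord
  by_cases h : σ.IsReal
  · simp only [ext_ofComplex_of_real h]
    split_ifs <;> simp
  · simp only [ext_ofComplex_of_not_real h]
    split_ifs <;> simp

lemma coordC_algebraMap_mul (D : LocalChoice F E n) (σ : InfinitePlace F) (τ : InfinitePlace E)
    (a : F) (z : E) (l : Fin (σ.inertiaDeg τ)) :
    coordC σ _ (D.emb τ (algebraMap F E a * z)) l =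
      σ.embedding a * coordC σ _ (D.emb τ z) l := by
  have h0 : σ.inertiaDeg τ ≠ 0 := fun h => (Fin.cast h l).elim0
  have h1 : D.emb τ (algebraMap F E a) = σ.embedding a := by
    have := RingHom.congr_fun (D.emb_comp τ) a
    rw [comap_eq_of_inertiaDeg_ne_zero F E h0] at this
    exact this
  unfold coordC localCoord
  rw [map_mul, h1]
  by_cases h : σ.IsReal
  · have h2 : σ.embedding a = ((σ.embedding a).re : ℂ) := by
      have := RingHom.congr_fun (ComplexEmbedding.isReal_iff.1 (isReal_iff.1 h)) a
      exact (Complex.conj_eq_iff_re.1 this).symm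
    simp only [ext_ofComplex_of_real h]
    rw [h2]
    split_ifs <;> simp
  · simp only [ext_ofComplex_of_not_real h]
    split_ifs with h3
    · exfalso
      rcases local_cases D σ τ with h4 | ⟨h4, h5, -⟩ | ⟨h4, -⟩ | ⟨h4, -⟩
      · exact h0 h4
      · exact h h5
      · omega
      · omega
    · rfl

/-- A combination of the local coordinates is a combination of an embedding and its conjugate. -/
lemma exists_coeff (D : LocalChoice F E n) (σ : InfinitePlace F) (τ : InfinitePlace E)
    (v : Fin (σ.inertiaDeg τ) → ℂ) : ∃ a b : ℂ,
      (∀ z, ∑ j, coordC σ _ (D.emb τ z) j * v j =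
        a * D.emb τ z + b * ComplexEmbedding.conjugate (D.emb τ) z) ∧
      (ComplexEmbedding.IsReal (D.emb τ) → b = 0) ∧ (a = 0 → b = 0 → v = 0) := by
  rcases local_cases D σ τ with h | ⟨h, h1, h2⟩ | ⟨h, h1, h2⟩ | ⟨h, h1, h2⟩ <;>
    revert v <;> rw [h] <;> intro v
  · exact ⟨0, 0, by simp, by simp, fun _ _ => by ext j; exact j.elim0⟩
  · refine ⟨-(Complex.I / 2) * v 0 + v 1 / 2, (Complex.I / 2) * v 0 + v 1 / 2, fun z => ?_,
      fun h3 => absurd h3 h2, fun ha hb => ?_⟩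
    · rw [Fin.sum_univ_two]
      simp only [coordC, localCoord, ext_ofComplex_of_real h1, ComplexEmbedding.conjugate_coe_eq]
      have e1 : (starRingEnd ℂ) (D.emb τ z) =
          ((D.emb τ z).re : ℂ) - (D.emb τ z).im * Complex.I := by
        apply Complex.ext <;> simp
      rw [e1]
      have e2 := (Complex.re_add_im (D.emb τ z)).symm
      simp
      linear_combination ((D.emb τ z).im : ℂ) * v 0 * Complex.I_mul_I -
        (-(Complex.I / 2) * v 0 + v 1 / 2) * e2
    · have h3 : v 1 = 0 := by linear_combination ha + hb
      have h4 : Complex.I * v 0 = 0 := by linear_combination hb - ha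
      have h5 : v 0 = 0 := (mul_eq_zero.1 h4).resolve_left Complex.I_ne_zero
      ext j; fin_cases j
      · exact h5
      · exact h3
  · refine ⟨v 0, 0, fun z => ?_, fun _ => rfl, fun ha _ => ?_⟩
    · have : D.emb τ z = ((D.emb τ z).re : ℂ) := by
        apply Complex.ext <;> simp [h2]
      rw [Fin.sum_univ_one]
      simp only [coordC, localCoord, ext_ofComplex_of_real h1]
      rw [this]; simp; ring
    · ext j; fin_cases j; exact ha
  · refine ⟨v 0, 0, fun z => ?_, fun _ => rfl, fun ha _ => ?_⟩
    · rw [Fin.sum_univ_one]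
      simp [coordC, localCoord, ext_ofComplex_of_not_real h1]
      ring
    · ext j; fin_cases j; exact ha

lemma linearIndependent_ringHom (K : Type*) [Field K] :
    LinearIndependent ℂ (fun φ : K →+* ℂ => (φ : K → ℂ)) :=
  (linearIndependent_monoidHom K ℂ).comp (fun φ : K →+* ℂ => (φ : K →* ℂ))
    RingHom.coe_monoidHom_injective

lemma basisMatrix_det_ne_zero (w : Module.Basis (Fin n) F E) (D : LocalChoice F E n)
    (σ : InfinitePlace F) : (basisMatrix w D σ).det ≠ 0 := by
  classical
  intro hdet
  have hdet' : ((basisMatrix w D σ).map (Completion.extensionEmbedding σ)).det = 0 := by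
    rw [← RingHom.mapMatrix_apply, ← RingHom.map_det, hdet, map_zero]
  obtain ⟨v, hv0, hv⟩ := Matrix.exists_mulVec_eq_zero_iff.2 hdet'
  apply hv0
  have hsum : ∀ z : E, ∑ τ : InfinitePlace E, ∑ j : Fin (σ.inertiaDeg τ),
      coordC σ _ (D.emb τ z) j * v (D.ord σ ⟨τ, j⟩) = 0 := by
    intro z
    induction w.mem_span z using Submodule.span_induction with
    | zero =>
      refine Finset.sum_eq_zero fun τ _ => Finset.sum_eq_zero fun j _ => ?_
      have := coordC_algebraMap_mul D σ τ 0 0 j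
      rw [map_zero, zero_mul, map_zero σ.embedding, zero_mul] at this
      rw [this, zero_mul]
    | mem z hz =>
      obtain ⟨i, rfl⟩ := hz
      have h := congrFun hv i
      rw [Matrix.mulVec, dotProduct, Pi.zero_apply, ← (D.ord σ).sum_comp,
        Fintype.sum_sigma] at h
      rw [← h]
      refine Finset.sum_congr rfl fun τ _ => Finset.sum_congr rfl fun j _ => ?_
      rw [Matrix.map_apply, basisMatrix, Matrix.submatrix_apply, Equiv.symm_apply_apply]
      rfl
    | add y z _ _ hy hz =>
      simp only [coordC_add, add_mul, Finset.sum_add_distrib, hy, hz, add_zero]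
    | smul a z _ hz =>
      simp only [Algebra.smul_def, coordC_algebraMap_mul, mul_assoc, ← Finset.mul_sum, hz,
        mul_zero]
  choose a b hab hb h0 using fun τ : InfinitePlace E =>
    exists_coeff D σ τ (fun j => v (D.ord σ ⟨τ, j⟩))
  simp only [hab] at hsum
  let c : (E →+* ℂ) → ℂ := fun φ => ∑ τ : InfinitePlace E,
    ((if D.emb τ = φ then a τ else 0) +
      (if ComplexEmbedding.conjugate (D.emb τ) = φ then b τ else 0))
  have hc : ∀ φ, c φ = 0 := by
    refine Fintype.linearIndependent_iff.1 (linearIndependent_ringHom E) c ?_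
    funext z
    simp only [c, Finset.sum_apply, Pi.smul_apply, smul_eq_mul, Finset.sum_mul, Pi.zero_apply]
    rw [Finset.sum_comm]
    refine Eq.trans ?_ (hsum z)
    refine Finset.sum_congr rfl fun τ _ => ?_
    simp only [add_mul, Finset.sum_add_distrib, ite_mul, zero_mul, Finset.sum_ite_eq,
      Finset.mem_univ, if_true]
  have hinj : ∀ {τ τ' : InfinitePlace E}, D.emb τ' = D.emb τ → τ' = τ := by
    intro τ τ' h
    rw [← D.mk_emb τ', ← D.mk_emb τ, h]
  have hinj1 : ∀ {τ τ' : InfinitePlace E},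
      ComplexEmbedding.conjugate (D.emb τ') = D.emb τ → τ' = τ := by
    intro τ τ' h
    rw [← D.mk_emb τ', ← D.mk_emb τ, ← h, mk_conjugate_eq]
  have hb0 : ∀ τ, b τ = 0 := by
    intro τ
    by_cases hr : ComplexEmbedding.IsReal (D.emb τ)
    · exact hb τ hr
    · have h := hc (ComplexEmbedding.conjugate (D.emb τ))
      simp only [c] at h
      rw [Finset.sum_eq_single τ] at h
      · have hne : D.emb τ ≠ ComplexEmbedding.conjugate (D.emb τ) := fun h1 =>
          hr (ComplexEmbedding.isReal_iff.2 h1.symm)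
        simpa [hne] using h
      · intro τ' _ hne
        rw [if_neg, if_neg, add_zero]
        · intro h1
          exact hne (hinj (star_injective h1))
        · intro h1
          exact hne (hinj1 (by rw [h1]; exact star_star _))
      · simp
  have ha0 : ∀ τ, a τ = 0 := by
    intro τ
    have h := hc (D.emb τ)
    simp only [c, hb0, ite_self, add_zero] at h
    rw [Finset.sum_eq_single τ] at h
    · simpa using h
    · intro τ' _ hne
      rw [if_neg]
      exact fun h1 => hne (hinj h1)
    · simp
  funext i
  obtain ⟨⟨τ, j⟩, rfl⟩ := (D.ord σ).surjective i
  exact congrFun (h0 τ (ha0 τ) (hb0 τ)) j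

/-- The element `W` of `G(ℝ)`. -/
def basisGL (w : Module.Basis (Fin n) F E) (D : LocalChoice F E n) : GLInf F n := fun σ =>
  Matrix.GeneralLinearGroup.mkOfDetNeZero (basisMatrix w D σ) (basisMatrix_det_ne_zero w D σ)

lemma ofComplex_ne_zero (σ : InfinitePlace F) (c : {x : ℝ // 0 < x}) :
    ofComplex σ ((c : ℝ) : ℂ) ≠ 0 := by
  intro h
  have := ext_ofComplex_ofReal σ c
  rw [h, map_zero] at this
  exact c.2.ne (Complex.ofReal_injective this)

/-- The matrix `I(t) ∈ G(ℝ)` of the componentwise multiplication by `t` on `E_∞ ≃ F_∞^n`. -/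
def torusGL (D : LocalChoice F E n) (t : Torus E) : GLInf F n := fun σ =>
  Matrix.GeneralLinearGroup.mkOfDetNeZero
    (Matrix.diagonal fun i => ofComplex σ ((t ((D.ord σ).symm i).1 : ℝ) : ℂ)) (by
      rw [Matrix.det_diagonal]
      exact Finset.prod_ne_zero_iff.2 fun i _ => ofComplex_ne_zero σ _)

/-- The Heegner object `ϖ : T_{E/F} → 𝔥_F^n`, `t ↦ [W I(t)]`. -/
def heegner (w : Module.Basis (Fin n) F E) (D : LocalChoice F E n) (t : relTorus F E) :
    UpperHalf F n :=
  ((basisGL w D * torusGL D (t : Torus E) : GLInf F n) : UpperHalf F n)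

/-- The lattice `L ⊆ F^n` that corresponds to the fractional ideal `𝔄` of `E` under the isomorphism
`F^n ≃ E`, `x ↦ x · w`. -/
def idealLattice (w : Module.Basis (Fin n) F E) (𝔄 : FractionalIdeal (𝓞 E)⁰ E) :
    Submodule (𝓞 F) (Fin n → F) :=
  ((𝔄 : Submodule (𝓞 E) E).restrictScalars (𝓞 F)).comap
    (w.equivFun.symm.toLinearMap.restrictScalars (𝓞 F))

end HeegnerObject

section Periodicity

variable {F E : Type*} [Field F] [NumberField F] [Field E] [NumberField E] [Algebra F E] {n : ℕ}

lemma coordC_sum (D : LocalChoice F E n) (σ : InfinitePlace F) (τ : InfinitePlace E)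
    (z : Fin n → E) (l : Fin (σ.inertiaDeg τ)) :
    coordC σ _ (D.emb τ (∑ i, z i)) l = ∑ i, coordC σ _ (D.emb τ (z i)) l :=
  map_sum (AddMonoidHom.mk' (fun y => coordC σ _ (D.emb τ y) l)
    (fun y z => coordC_add D σ τ y z l)) z Finset.univ

/-- The regular representation of a relative unit, as an element of `SL_n(F)`. -/
def relUnitSL (w : Module.Basis (Fin n) F E) (u : relUnits F E) :
    Matrix.SpecialLinearGroup (Fin n) F :=
  ⟨(Algebra.leftMulMatrix w ((u : (𝓞 E)ˣ) : E))ᵀ, by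
    have h : Units.map (RingOfIntegers.norm F : 𝓞 E →* 𝓞 F) u = 1 := u.2
    have h2 := congrArg (fun x : (𝓞 F)ˣ => ((x : 𝓞 F) : F)) h
    rw [Matrix.det_transpose, ← Algebra.norm_eq_matrix_det]
    simpa using h2⟩

lemma relUnitSL_sum (w : Module.Basis (Fin n) F E) (u : relUnits F E) (i : Fin n) :
    ∑ k, (relUnitSL w u : Matrix (Fin n) (Fin n) F) i k • w k = ((u : (𝓞 E)ˣ) : E) * w i := by
  conv_rhs => rw [← w.sum_repr (((u : (𝓞 E)ˣ) : E) * w i)]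
  refine Finset.sum_congr rfl fun k _ => ?_
  congr 1
  change (Algebra.leftMulMatrix w ((u : (𝓞 E)ˣ) : E)) k i = _
  rw [Algebra.leftMulMatrix_eq_repr_mul]

lemma equivFun_symm_vecMul (w : Module.Basis (Fin n) F E) (u : relUnits F E) (x : Fin n → F) :
    w.equivFun.symm (x ᵥ* (relUnitSL w u : Matrix (Fin n) (Fin n) F)) =
      ((u : (𝓞 E)ˣ) : E) * w.equivFun.symm x := by
  simp only [Module.Basis.equivFun_symm_apply, Matrix.vecMul, dotProduct, Finset.sum_smul,
    Finset.mul_sum]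
  rw [Finset.sum_comm]
  refine Finset.sum_congr rfl fun i _ => ?_
  rw [mul_smul_comm, ← relUnitSL_sum, Finset.smul_sum]
  exact Finset.sum_congr rfl fun k _ => (mul_smul _ _ _)

lemma relUnitSL_mem (w : Module.Basis (Fin n) F E) (𝔄 : FractionalIdeal (𝓞 E)⁰ E)
    (u : relUnits F E) : relUnitSL w u ∈ arithSubgroup (idealLattice w 𝔄) := by
  have mem : ∀ x : Fin n → F, x ∈ idealLattice w 𝔄 ↔
      w.equivFun.symm x ∈ (𝔄 : Submodule (𝓞 E) E) := fun x => Iff.rfl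
  change (fun x => x ᵥ* (relUnitSL w u : Matrix (Fin n) (Fin n) F)) ''
    (idealLattice w 𝔄 : Set (Fin n → F)) = idealLattice w 𝔄
  ext y
  constructor
  · rintro ⟨x, hx, rfl⟩
    change _ ∈ idealLattice w 𝔄
    rw [mem, equivFun_symm_vecMul]
    exact Submodule.smul_mem _ ((u : (𝓞 E)ˣ) : 𝓞 E) ((mem x).1 hx)
  · intro hy
    refine ⟨w.equivFun ((((u : (𝓞 E)ˣ)⁻¹ : (𝓞 E)ˣ) : 𝓞 E) • w.equivFun.symm y), ?_, ?_⟩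
    · change _ ∈ idealLattice w 𝔄
      rw [mem, LinearEquiv.symm_apply_apply]
      exact Submodule.smul_mem _ _ ((mem y).1 hy)
    · apply w.equivFun.symm.injective
      rw [equivFun_symm_vecMul, LinearEquiv.symm_apply_apply]
      change ((u : (𝓞 E)ˣ) : 𝓞 E) • ((((u : (𝓞 E)ˣ)⁻¹ : (𝓞 E)ˣ) : 𝓞 E) • w.equivFun.symm y) = _
      rw [smul_smul, Units.mul_inv, one_smul]

lemma heegner_periodic_aux (w : Module.Basis (Fin n) F E) (D : LocalChoice F E n)
    (u : relUnits F E) (t : Torus E) :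
    (basisGL w D * torusGL D (regMap E u * t))⁻¹ *
      (slEmbed F n (relUnitSL w u) * (basisGL w D * torusGL D t)) ∈ scalarCompact F n := by
  classical
  intro σ _
  refine Subgroup.mem_sup_right ?_
  change Matrix.map (Units.val _) (Completion.extensionEmbedding σ) ∈ Matrix.unitaryGroup (Fin n) ℂ
  let f : GL (Fin n) σ.Completion →* GL (Fin n) ℂ :=
    Matrix.GeneralLinearGroup.map (Completion.extensionEmbedding σ)
  let e := D.ord σ
  let B : ∀ τ : InfinitePlace E, Matrix (Fin (σ.inertiaDeg τ)) (Fin (σ.inertiaDeg τ)) ℂ :=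
    fun τ => mulBlock _ (D.emb τ ((u : (𝓞 E)ˣ) : E))
  let r : InfinitePlace E → ℂ := fun τ => ((τ ((u : (𝓞 E)ˣ) : E) : ℝ) : ℂ)
  have hr : ∀ τ, r τ ≠ 0 := fun τ => by
    have : (τ ((u : (𝓞 E)ˣ) : E)) ≠ 0 := by simp
    exact Complex.ofReal_ne_zero.2 this
  let R : Matrix (Fin n) (Fin n) ℂ :=
    (Matrix.blockDiagonal' fun τ => (r τ)⁻¹ • B τ).submatrix e.symm e.symm
  let M : Matrix (Fin n) (Fin n) ℂ := (Matrix.blockDiagonal' B).submatrix e.symm e.symm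
  have hI : ∀ s : Torus E, (f (torusGL D s σ) : Matrix (Fin n) (Fin n) ℂ) =
      Matrix.diagonal fun i => ((s (e.symm i).1 : ℝ) : ℂ) := by
    intro s
    change Matrix.map (Matrix.diagonal _) (Completion.extensionEmbedding σ) = _
    rw [Matrix.diagonal_map (map_zero _)]
    congr 1
    funext i
    exact ext_ofComplex_ofReal σ _
  have hW : ∀ i τ l, (f (basisGL w D σ) : Matrix (Fin n) (Fin n) ℂ) i (e ⟨τ, l⟩) =
      coordC σ _ (D.emb τ (w i)) l := by
    intro i τ l
    change Completion.extensionEmbedding σ (basisMatrix w D σ i (e ⟨τ, l⟩)) = _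
    rw [basisMatrix, Matrix.submatrix_apply, Equiv.symm_apply_apply]
    rfl
  have hγ : (f (slEmbed F n (relUnitSL w u) σ) : Matrix (Fin n) (Fin n) ℂ) =
      (relUnitSL w u : Matrix (Fin n) (Fin n) F).map σ.embedding := by
    ext i k
    exact Completion.extensionEmbedding_coe σ (WithAbs.toAbs _ _)
  have h1 : (f (slEmbed F n (relUnitSL w u) σ) : Matrix (Fin n) (Fin n) ℂ) *
      (f (basisGL w D σ) : Matrix (Fin n) (Fin n) ℂ) =
      (f (basisGL w D σ) : Matrix (Fin n) (Fin n) ℂ) * M := by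
    ext i c
    obtain ⟨⟨τ, l⟩, rfl⟩ := e.surjective c
    rw [Matrix.mul_apply, Matrix.mul_apply, hγ]
    simp only [hW, Matrix.map_apply, ← coordC_algebraMap_mul]
    rw [← coordC_sum]
    simp only [← Algebra.smul_def]
    rw [relUnitSL_sum, coordC_mul, ← e.sum_comp, Fintype.sum_sigma]
    rw [Finset.sum_eq_single τ]
    · refine Finset.sum_congr rfl fun j _ => ?_
      rw [hW]
      simp [M, B]
    · intro τ' _ hne
      refine Finset.sum_eq_zero fun j _ => ?_
      simp [M, Matrix.blockDiagonal'_apply_ne _ _ _ hne]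
    · simp
  have h2 : (f (torusGL D (regMap E u * t) σ) : Matrix (Fin n) (Fin n) ℂ) * R =
      M * (f (torusGL D t σ) : Matrix (Fin n) (Fin n) ℂ) := by
    rw [hI, hI]
    ext i c
    obtain ⟨⟨τ, j⟩, rfl⟩ := e.surjective i
    obtain ⟨⟨τ', l⟩, rfl⟩ := e.surjective c
    rw [Matrix.diagonal_mul, Matrix.mul_diagonal]
    simp only [M, R, Matrix.submatrix_apply, Equiv.symm_apply_apply]
    by_cases h : τ = τ'
    · subst h
      rw [Matrix.blockDiagonal'_apply_eq, Matrix.blockDiagonal'_apply_eq, Matrix.smul_apply,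
        smul_eq_mul]
      have h3 : (((regMap E u * t) τ : ℝ) : ℂ) = r τ * ((t τ : ℝ) : ℂ) := by
        rw [← Complex.ofReal_mul]; rfl
      rw [h3]
      field_simp [hr τ]
    · rw [Matrix.blockDiagonal'_apply_ne _ _ _ h, Matrix.blockDiagonal'_apply_ne _ _ _ h, mul_zero,
        zero_mul]
  have hR : R ∈ Matrix.unitaryGroup (Fin n) ℂ := by
    rw [Matrix.mem_unitaryGroup_iff, Matrix.star_eq_conjTranspose, Matrix.conjTranspose_submatrix,
      Matrix.submatrix_mul_equiv, Matrix.blockDiagonal'_conjTranspose,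
      ← Matrix.blockDiagonal'_mul]
    have h4 : ∀ τ, ((r τ)⁻¹ • B τ) * ((r τ)⁻¹ • B τ)ᴴ = 1 := by
      intro τ
      have h5 : ‖D.emb τ ((u : (𝓞 E)ˣ) : E)‖ = τ ((u : (𝓞 E)ˣ) : E) := by
        conv_rhs => rw [← D.mk_emb τ]
        rfl
      rw [Matrix.conjTranspose_smul, Matrix.smul_mul, Matrix.mul_smul,
        mulBlock_mul_conjTranspose σ τ D, h5, smul_smul, smul_smul]
      have h6 : star (r τ)⁻¹ = (r τ)⁻¹ := by
        simp [r]
      rw [h6]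
      have h7 : (r τ)⁻¹ * ((r τ)⁻¹ * ((τ ((u : (𝓞 E)ˣ) : E) ^ 2 : ℝ) : ℂ)) = 1 := by
        rw [Complex.ofReal_pow]
        change (r τ)⁻¹ * ((r τ)⁻¹ * (r τ) ^ 2) = 1
        field_simp [hr τ]
      rw [mul_assoc, h7, one_smul]
    simp only [h4]
    rw [show (fun τ : InfinitePlace E => (1 : Matrix (Fin (σ.inertiaDeg τ)) (Fin (σ.inertiaDeg τ)) ℂ))
      = 1 from rfl, Matrix.blockDiagonal'_one, Matrix.submatrix_one_equiv]
  let X : GL (Fin n) σ.Completion := ((basisGL w D * torusGL D (regMap E u * t))⁻¹ *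
      (slEmbed F n (relUnitSL w u) * (basisGL w D * torusGL D t))) σ
  have hX : f (basisGL w D σ) * (f (torusGL D (regMap E u * t) σ) * f X) =
      f (slEmbed F n (relUnitSL w u) σ) * f (basisGL w D σ) * f (torusGL D t σ) := by
    rw [← map_mul, ← map_mul, ← map_mul, ← map_mul]
    congr 1
    simp only [X, Pi.mul_apply, Pi.inv_apply]
    group
  have hX2 := congrArg (Units.val) hX
  simp only [Units.val_mul] at hX2
  rw [h1, Matrix.mul_assoc, ← h2] at hX2
  have hX3 : (f X : Matrix (Fin n) (Fin n) ℂ) = R :=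
    (Units.mul_right_inj _).1 ((Units.mul_right_inj _).1 hX2)
  change (f X : Matrix (Fin n) (Fin n) ℂ) ∈ _
  rw [hX3]
  exact hR

/-- The map `ϖ̄ : T_{E/F} / U_{E/F} → Γ ∖ 𝔥_F^n` induced by the Heegner object, where `Γ = Γ_L` for
the lattice `L` of `𝔄`. -/
def heegnerQuotient (w : Module.Basis (Fin n) F E) (D : LocalChoice F E n)
    (𝔄 : FractionalIdeal (𝓞 E)⁰ E) (t : relTorus F E ⧸ relUnitLattice F E) :
    ArithQuotient (idealLattice w 𝔄) :=
  Quotient.liftOn' t (fun t => (Quotient.mk'' (heegner w D t) : ArithQuotient (idealLattice w 𝔄)))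
    (fun a b hab => by
      rw [QuotientGroup.leftRel_apply] at hab
      obtain ⟨u, hu, hu'⟩ := Subgroup.mem_subgroupOf.1 hab
      symm
      refine Quotient.sound' (MulAction.orbitRel_apply.2
        ⟨⟨slEmbed F n (relUnitSL w ⟨u, hu⟩), _, relUnitSL_mem w 𝔄 _, rfl⟩, ?_⟩)
      have hb : (b : Torus E) = regMap E u * (a : Torus E) := by
        rw [hu']
        simp
      change ((slEmbed F n (relUnitSL w ⟨u, hu⟩) * (basisGL w D * torusGL D (a : Torus E)) :
        GLInf F n) : UpperHalf F n) = ((basisGL w D * torusGL D (b : Torus E) : GLInf F n) :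
          UpperHalf F n)
      rw [hb]
      exact (QuotientGroup.eq.2 (heegner_periodic_aux w D ⟨u, hu⟩ (a : Torus E))).symm)

end Periodicity

section Statement

variable {F E : Type*} [Field F] [NumberField F] [Field E] [NumberField E] [Algebra F E] {n : ℕ}

/-- `|Δ_w| = |N((det W)²)| = ∏_σ |(det W_σ)²|^{n_σ}`, where `N : F_∞ → ℝ` is the norm map. -/
def absDelta (w : Module.Basis (Fin n) F E) (D : LocalChoice F E n) : ℝ :=
  ∏ σ : InfinitePlace F, ‖(basisMatrix w D σ).det ^ 2‖ ^ σ.mult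

variable (E) in
/-- The nonzero integral ideals of `E` in the ideal class `C`. -/
abbrev IdealsInClass (C : ClassGroup (𝓞 E)) : Type _ :=
  {𝔟 : (Ideal (𝓞 E))⁰ // ClassGroup.mk0 𝔟 = C}

variable (E) in
/-- The partial zeta function `ζ_E(C, s)` of the ideal class `C`. -/
def partialZeta (C : ClassGroup (𝓞 E)) (s : ℂ) : ℂ :=
  ∑' 𝔟 : IdealsInClass E C, 1 / (Ideal.absNorm (𝔟.1 : Ideal (𝓞 E)) : ℂ) ^ s

end Statement

end

end HeckeIntegral

open HeckeIntegral

namespace HeckeIntegral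

noncomputable section

/-! ### Haar measure on the multiplicative group of positive reals. -/

section PositiveReals

/-! The proof is Hecke's unfolding. A nonzero vector of `L` lies in `L_𝔞` for exactly one `𝔞`, its
coefficient ideal, which contains `1` because the vector itself lies in `L`. So the sum over
classes, ideals and orbits is a sum over the nonzero elements `α` of `𝔄` modulo `𝓞_F^×`. Up to
`𝓞_E^×`, such an `α` is the same as the integral ideal `𝔟 = α 𝔄⁻¹` in the class of `𝔄⁻¹`. The index
set thus becomes the set of pairs of an ideal `𝔟` and a class in `𝓞_E^× / 𝓞_F^×`
(`exists_orbit_equiv`).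

On the torus the term of `α` is the `s`-th power of `|Δ_w|^(1/2) κ(|α| t)`, where `κ(t) = ∏_σ (∑_{τ
∣ σ} t_τ²)^(-n n_σ / 2)` is `relKernel` (`detOrbit_heegner`). Since `κ` is homogeneous under `T_F`,
`κ(|α| t) = |N α|⁻¹ κ(α₁ t)` with `α₁` the projection of `|α|` to `T_{E/F}`, and `|N α| = N𝔟 · N𝔄`.
The first factor produces the partial zeta function. The sum over `𝓞_E^× / 𝓞_F^×`, integrated over a
fundamental domain of `U_{E/F}`, unfolds to `C Γ_{E/F}(s)`, where `C` counts the classes that move a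
given point into the domain (`integral_tsum_torusTerm`).

It remains to see that `C Γ_{E/F}(s) = c_{E/F}(s)`. Under `T_{E/ℚ} = T_{E/F} × T_{F/ℚ}` the measures
agree up to the factor `n^(r-1)`, with `r` the number of archimedean places of `F`
(`relHaar_rat_eq_map`). Counting units in these coordinates gives `C w_F R_E = w_E n^(r-1) R_{E/F}
R_F` (`exists_unit_index`), and Gaussian integrals give `Γ_{E/ℚ}(s) = n^(r-1) Γ_{E/F}(s)
Γ_{F/ℚ}(ns)` (`relGamma_tower`). The power of `n` cancels in `exists_cFactor_eq`.

Absolute convergence for every `t` is obtained from the same unfolding applied to absolute values: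
it gives convergence for almost all `t` in the domain, and a comparison of two translates of the
kernel carries it to all `t` (`summable_torusTerm`). -/

instance : IsTopologicalGroup {x : ℝ // 0 < x} where
  continuous_mul := by
    refine Continuous.subtype_mk (f := fun p : {x : ℝ // 0 < x} × {x : ℝ // 0 < x} =>
      (p.1 : ℝ) * (p.2 : ℝ)) (by fun_prop) _
  continuous_inv := by
    refine Continuous.subtype_mk (f := fun p : {x : ℝ // 0 < x} => (p : ℝ)⁻¹) ?_ _
    exact continuous_subtype_val.inv₀ fun x => x.2.ne'

instance : LocallyCompactSpace {x : ℝ // 0 < x} :=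
  isOpen_Ioi.isOpenEmbedding_subtypeVal.locallyCompactSpace

/-- The exponential as a homeomorphism from `ℝ` to the positive reals. -/
def expHomeo : ℝ ≃ₜ {x : ℝ // 0 < x} where
  toFun x := ⟨Real.exp x, Real.exp_pos x⟩
  invFun x := Real.log x
  left_inv x := Real.log_exp x
  right_inv x := Subtype.ext (Real.exp_log x.2)
  continuous_toFun := by fun_prop
  continuous_invFun := continuous_subtype_val.log fun x => x.2.ne'

lemma measurableEmbedding_posVal :
    MeasurableEmbedding (Subtype.val : {x : ℝ // 0 < x} → ℝ) :=
  MeasurableEmbedding.subtype_coe measurableSet_Ioi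

lemma coe_expHomeo (x : ℝ) : (expHomeo x : ℝ) = Real.exp x := rfl

lemma expHomeo_symm_apply (x : {x : ℝ // 0 < x}) : expHomeo.symm x = Real.log x := rfl

/-- The Jacobian `exp x` cancels the density `1 / t`. All properties of `dt / t` (invariance,
finiteness on compact sets, volumes of boxes) are then read off from Lebesgue measure. -/
lemma map_expHomeo_volume : (volume : Measure ℝ).map expHomeo = posHaar := by
  ext A hA
  rw [Measure.map_apply expHomeo.measurable hA, posHaar, withDensity_apply _ hA]
  have hA' : MeasurableSet (expHomeo ⁻¹' A) := expHomeo.measurable hA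
  have h1 : (Subtype.val '' A : Set ℝ) = Real.exp '' (expHomeo ⁻¹' A) := by
    ext x
    constructor
    · rintro ⟨y, hy, rfl⟩
      exact ⟨Real.log y, by
        simpa [← expHomeo_symm_apply] using hy, Real.exp_log y.2⟩
    · rintro ⟨y, hy, rfl⟩
      exact ⟨_, hy, rfl⟩
  have h2 : ∫⁻ t in A, ENNReal.ofReal (t : ℝ)⁻¹
      ∂(Measure.comap Subtype.val (volume : Measure ℝ)) =
      ∫⁻ t in (Subtype.val '' A : Set ℝ), ENNReal.ofReal t⁻¹ := by
    rw [measurableEmbedding_posVal.restrict_comap,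
      ← measurableEmbedding_posVal.lintegral_map (fun t : ℝ => ENNReal.ofReal t⁻¹),
      measurableEmbedding_posVal.map_comap, Measure.restrict_restrict₀, Set.inter_eq_right.2]
    · exact Set.image_subset_range _ _
    · exact (measurableEmbedding_posVal.measurableSet_range).nullMeasurableSet
  rw [h2, h1, lintegral_image_eq_lintegral_abs_deriv_mul hA'
    (fun x _ => (Real.hasDerivAt_exp x).hasDerivWithinAt) Real.exp_injective.injOn]
  simp only [abs_of_pos (Real.exp_pos _)]
  have : ∀ x : ℝ, ENNReal.ofReal (Real.exp x) * ENNReal.ofReal (Real.exp x)⁻¹ = 1 := by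
    intro x
    rw [← ENNReal.ofReal_mul (Real.exp_pos x).le, mul_inv_cancel₀ (Real.exp_pos x).ne',
      ENNReal.ofReal_one]
  simp [this]

instance : posHaar.IsHaarMeasure where
  lt_top_of_isCompact := by
    intro K hK
    rw [← map_expHomeo_volume, Measure.map_apply expHomeo.measurable hK.measurableSet]
    exact (expHomeo.isCompact_preimage.2 hK).measure_lt_top
  open_pos := by
    intro U hU hne
    rw [← map_expHomeo_volume, Measure.map_apply expHomeo.measurable hU.measurableSet]
    exact ((expHomeo.isOpen_preimage.2 hU).measure_pos _
      (hne.preimage expHomeo.surjective)).ne'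
  map_mul_left_eq_self := by
    intro c
    rw [← map_expHomeo_volume, Measure.map_map (by fun_prop) expHomeo.measurable]
    have : (fun x => c * x) ∘ expHomeo = expHomeo ∘ (fun x => Real.log c + x) := by
      funext x
      ext
      simp [coe_expHomeo, Real.exp_add, Real.exp_log c.2]
    rw [this, ← Measure.map_map expHomeo.measurable (by fun_prop), map_add_left_eq_self]

lemma posHaar_Icc_exp {a : ℝ} :
    posHaar {x | (x : ℝ) ∈ Set.Icc 1 (Real.exp a)} = ENNReal.ofReal a := by
  have hm : MeasurableSet {x : {x : ℝ // 0 < x} | (x : ℝ) ∈ Set.Icc 1 (Real.exp a)} :=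
    measurable_subtype_coe measurableSet_Icc
  rw [← map_expHomeo_volume, Measure.map_apply expHomeo.measurable hm]
  have : expHomeo ⁻¹' {x | (x : ℝ) ∈ Set.Icc 1 (Real.exp a)} = Set.Icc 0 a := by
    ext x
    simp [coe_expHomeo]
  rw [this, Real.volume_Icc, sub_zero]

end PositiveReals

/-! ### Topology of the tori. -/

section TorusTopology

variable (k k' : Type*) [Field k] [NumberField k] [Field k'] [NumberField k'] [Algebra k k']

instance : (torusHaar k).IsHaarMeasure := by
  unfold torusHaar
  have h : ∀ σ : InfinitePlace k, ((σ.mult : ℝ≥0∞) • posHaar).IsHaarMeasure := fun σ =>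
    Measure.IsHaarMeasure.smul _ (by exact_mod_cast mult_pos.ne') (ENNReal.natCast_ne_top _)
  infer_instance

lemma continuous_torusNorm : Continuous (torusNorm k k') := by
  refine continuous_pi fun σ => ?_
  change Continuous fun t : Torus k' => ∏ τ : InfinitePlace k', t τ ^ σ.inertiaDeg τ
  exact continuous_finsetProd _ fun τ _ => (continuous_apply τ).pow _

instance : LocallyCompactSpace (relTorus k k') := by
  refine IsClosed.locallyCompactSpace (X := Torus k') (s := relTorus k k') ?_
  exact isClosed_singleton.preimage (continuous_torusNorm k k')


end TorusTopology

/-! ### The splitting of `T_{k'}` into `T_{k'/k}` and `T_k`, and its measure. -/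

section Decomposition

variable (k k' : Type*) [Field k] [NumberField k] [Field k'] [NumberField k'] [Algebra k k']

/-- The inclusion `T_k → T_{k'}` of the elements that are constant on the fibres of
`S_{k'} → S_k`. -/
def fiberIncl : Torus k →* Torus k' where
  toFun y := fun τ => y (τ.comap (algebraMap k k'))
  map_one' := rfl
  map_mul' _ _ := rfl

@[simp] lemma fiberIncl_apply (y : Torus k) (τ : InfinitePlace k') :
    fiberIncl k k' y τ = y (τ.comap (algebraMap k k')) := rfl

/-- The componentwise `m`-th root. -/
def torusRoot {k : Type*} [Field k] (m : ℕ) : Torus k →* Torus k where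
  toFun u := fun σ => ⟨(u σ : ℝ) ^ ((m : ℝ)⁻¹), Real.rpow_pos_of_pos (u σ).2 _⟩
  map_one' := by
    funext σ; ext; simp
  map_mul' u v := by
    funext σ; ext
    simp [Real.mul_rpow (u σ).2.le (v σ).2.le]

lemma torusRoot_apply {k : Type*} [Field k] (m : ℕ) (u : Torus k) (σ : InfinitePlace k) :
    (torusRoot m u σ : ℝ) = (u σ : ℝ) ^ ((m : ℝ)⁻¹) := rfl

lemma torusRoot_pow {k : Type*} [Field k] {m : ℕ} (hm : m ≠ 0) (u : Torus k) :
    torusRoot m (u ^ m) = u := by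
  funext σ; ext
  rw [torusRoot_apply]
  simp only [Pi.pow_apply, Positive.val_pow]
  exact Real.pow_rpow_inv_natCast (u σ).2.le hm

lemma pow_torusRoot {k : Type*} [Field k] {m : ℕ} (hm : m ≠ 0) (u : Torus k) :
    torusRoot m u ^ m = u := by
  rw [← map_pow, torusRoot_pow hm]

lemma torusSection_eq (u : Torus k) :
    torusSection k k' u = fiberIncl k k' (torusRoot (Module.finrank k k') u) := rfl

lemma torusNorm_fiberIncl (y : Torus k) :
    torusNorm k k' (fiberIncl k k' y) = y ^ Module.finrank k k' := by
  have h := torusNorm_torusSection k k' (y ^ Module.finrank k k')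
  rwa [torusSection_eq, torusRoot_pow Module.finrank_pos.ne'] at h

lemma coe_torusProj (t : Torus k') : (torusProj k k' t : Torus k') =
    t * (fiberIncl k k' (torusRoot (Module.finrank k k') (torusNorm k k' t)))⁻¹ := rfl

/-- `torusProj` as a group homomorphism. -/
def torusProjHom : Torus k' →* relTorus k k' where
  toFun := torusProj k k'
  map_one' := by
    ext1
    simp [coe_torusProj]
  map_mul' t u := by
    ext1
    simp only [coe_torusProj, map_mul, Subgroup.coe_mul, mul_inv]
    exact mul_mul_mul_comm _ _ _ _

@[simp] lemma torusProjHom_apply (t : Torus k') : torusProjHom k k' t = torusProj k k' t := rfl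

lemma torusNorm_coe (t : relTorus k k') : torusNorm k k' (t : Torus k') = 1 := t.2

@[simp] lemma torusProj_coe (t : relTorus k k') : torusProj k k' (t : Torus k') = t := by
  ext1
  rw [coe_torusProj, torusNorm_coe, map_one, map_one, inv_one, mul_one]

@[simp] lemma torusProj_fiberIncl (y : Torus k) : torusProj k k' (fiberIncl k k' y) = 1 := by
  ext1
  rw [coe_torusProj, torusNorm_fiberIncl, torusRoot_pow Module.finrank_pos.ne', mul_inv_cancel]
  rfl

/-- The decomposition `T_{k'} = T_{k'/k} × T_k` given by the inclusion of `T_k` in `T_{k'}`. -/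
def torusDecomp : relTorus k k' × Torus k ≃* Torus k' where
  toFun p := p.1 * fiberIncl k k' p.2
  invFun t := (torusProj k k' t, torusRoot (Module.finrank k k') (torusNorm k k' t))
  left_inv p := by
    refine Prod.ext ?_ ?_
    · change torusProjHom k k' _ = p.1
      rw [map_mul]
      simp
    · simp only [map_mul, torusNorm_coe, torusNorm_fiberIncl, one_mul,
        torusRoot_pow Module.finrank_pos.ne']
  right_inv t := by
    simp [coe_torusProj]
  map_mul' p q := by
    simp only [Prod.fst_mul, Prod.snd_mul, map_mul, Subgroup.coe_mul]
    exact mul_mul_mul_comm _ _ _ _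

lemma torusDecomp_apply (p : relTorus k k' × Torus k) :
    torusDecomp k k' p = p.1 * fiberIncl k k' p.2 := rfl

lemma torusDecomp_symm_apply (t : Torus k') : (torusDecomp k k').symm t =
    (torusProj k k' t, torusRoot (Module.finrank k k') (torusNorm k k' t)) := rfl

lemma continuous_fiberIncl : Continuous (fiberIncl k k') :=
  continuous_pi fun _ => continuous_apply _

lemma continuous_torusRoot {k : Type*} [Field k] (m : ℕ) : Continuous (torusRoot (k := k) m) := by
  refine continuous_pi fun σ => Continuous.subtype_mk ?_ _
  refine Continuous.rpow_const (by fun_prop) fun u => Or.inl (u σ).2.ne'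

lemma continuous_torusProj : Continuous (torusProj k k') := by
  refine Continuous.subtype_mk ?_ _
  exact continuous_id.mul (((continuous_fiberIncl k k').comp ((continuous_torusRoot _).comp
    (continuous_torusNorm k k'))).inv)

lemma continuous_torusDecomp : Continuous (torusDecomp k k') :=
  (continuous_subtype_val.comp continuous_fst).mul
    ((continuous_fiberIncl k k').comp continuous_snd)

lemma continuous_torusDecomp_symm : Continuous (torusDecomp k k').symm :=
  (continuous_torusProj k k').prodMk
    ((continuous_torusRoot _).comp (continuous_torusNorm k k'))

/-- The elements whose norm lies in the box `[1, e]^{S_k}`. -/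
def normBox : Set (Torus k') := {t | ∀ σ, (torusNorm k k' t σ : ℝ) ∈ Set.Icc 1 (Real.exp 1)}

lemma isClosed_normBox : IsClosed (normBox k k') := by
  have : normBox k k' = ⋂ σ, {t | (torusNorm k k' t σ : ℝ) ∈ Set.Icc 1 (Real.exp 1)} := by
    ext; simp [normBox]
  rw [this]
  refine isClosed_iInter fun σ => IsClosed.preimage ?_ isClosed_Icc
  exact continuous_subtype_val.comp ((continuous_apply σ).comp (continuous_torusNorm k k'))

lemma prod_mult_ne_zero : (∏ σ : InfinitePlace k, (σ.mult : ℝ≥0∞)) ≠ 0 :=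
  Finset.prod_ne_zero_iff.2 fun σ _ => by exact_mod_cast mult_pos.ne'

lemma prod_mult_ne_top : (∏ σ : InfinitePlace k, (σ.mult : ℝ≥0∞)) ≠ ⊤ :=
  ENNReal.prod_ne_top fun _ _ => ENNReal.natCast_ne_top _

lemma relHaar_apply {A : Set (relTorus k k')} (hA : MeasurableSet A) :
    relHaar k k' A = (∏ σ : InfinitePlace k, (σ.mult : ℝ≥0∞))⁻¹ *
      torusHaar k' (torusProj k k' ⁻¹' A ∩ normBox k k') := by
  have hp := (continuous_torusProj k k').measurable
  rw [relHaar, Measure.smul_apply, Measure.map_apply hp hA, smul_eq_mul,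
    Measure.restrict_apply (hp hA)]
  rfl

lemma torusHaar_normBox {A : Set (relTorus k k')} (hA : MeasurableSet A) :
    torusHaar k' (torusProj k k' ⁻¹' A ∩ normBox k k') =
      (∏ σ : InfinitePlace k, (σ.mult : ℝ≥0∞)) * relHaar k k' A := by
  rw [relHaar_apply k k' hA, ← mul_assoc, ENNReal.mul_inv_cancel (prod_mult_ne_zero k)
    (prod_mult_ne_top k), one_mul]

/-- The elements of `T_k` whose `m`-th power lies in the box `[1, e]^{S_k}`. -/
def rootBox (k : Type*) [Field k] (m : ℕ) : Set (Torus k) :=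
  Set.univ.pi fun _ => {x | (x : ℝ) ∈ Set.Icc 1 (Real.exp (m : ℝ)⁻¹)}

lemma mem_rootBox_iff {k : Type*} [Field k] {m : ℕ} (hm : m ≠ 0) (y : Torus k) :
    y ∈ rootBox k m ↔ ∀ σ, ((y ^ m) σ : ℝ) ∈ Set.Icc 1 (Real.exp 1) := by
  simp only [rootBox, Set.mem_univ_pi, Set.mem_ofPred_eq, Set.mem_Icc, Pi.pow_apply,
    Positive.val_pow]
  refine forall_congr' fun σ => and_congr ?_ ?_
  · exact (one_le_pow_iff_of_nonneg (y σ).2.le hm).symm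
  · have : Real.exp 1 = Real.exp (m : ℝ)⁻¹ ^ m := by
      rw [← Real.exp_nat_mul, mul_inv_cancel₀ (by exact_mod_cast hm)]
    rw [this]
    exact (pow_le_pow_iff_left₀ (y σ).2.le (Real.exp_pos _).le hm).symm

lemma isCompact_rootBox {k : Type*} [Field k] (m : ℕ) : IsCompact (rootBox k m) := by
  refine isCompact_univ_pi fun σ => ?_
  have : {x : {x : ℝ // 0 < x} | (x : ℝ) ∈ Set.Icc 1 (Real.exp (m : ℝ)⁻¹)} =
      expHomeo '' Set.Icc 0 (m : ℝ)⁻¹ := by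
    rw [Homeomorph.image_eq_preimage_symm]
    ext x
    simp [expHomeo_symm_apply, Real.log_nonneg_iff x.2, Real.log_le_iff_le_exp x.2]
  rw [this]
  exact isCompact_Icc.image expHomeo.continuous

/-- Taking `m`-th roots shrinks each side of the box from `1` to `1/m` in logarithmic scale. This is
the origin of the powers of the degree in all comparisons of measures below. -/
lemma torusHaar_rootBox (m : ℕ) : torusHaar k (rootBox k m) =
    (∏ σ : InfinitePlace k, (σ.mult : ℝ≥0∞)) *
      ENNReal.ofReal (m : ℝ)⁻¹ ^ Fintype.card (InfinitePlace k) := by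
  have (σ : InfinitePlace k) : SigmaFinite ((σ.mult : ℝ≥0∞) • posHaar) := by
    have : ((σ.mult : ℝ≥0∞) • posHaar).IsHaarMeasure :=
      Measure.IsHaarMeasure.smul _ (by exact_mod_cast mult_pos.ne') (ENNReal.natCast_ne_top _)
    infer_instance
  rw [torusHaar, rootBox, Measure.pi_pi]
  simp only [Measure.smul_apply, posHaar_Icc_exp, smul_eq_mul, Finset.prod_mul_distrib,
    Finset.prod_const, Finset.card_univ]

/-- The set that defines `relHaar` is a rectangle in the product coordinates, because the norm
ignores the first factor and is the `[k':k]`-th power on the second. -/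
lemma preimage_torusDecomp (A : Set (relTorus k k')) :
    torusDecomp k k' ⁻¹' (torusProj k k' ⁻¹' A ∩ normBox k k') =
      A ×ˢ rootBox k (Module.finrank k k') := by
  ext ⟨t, y⟩
  have h1 : torusProj k k' (t * fiberIncl k k' y) = t := by
    change torusProjHom k k' _ = _
    rw [map_mul]; simp
  have h2 : torusNorm k k' (t * fiberIncl k k' y) = y ^ Module.finrank k k' := by
    rw [map_mul, torusNorm_coe, one_mul, torusNorm_fiberIncl]
  simp only [Set.mem_preimage, Set.mem_inter_iff, torusDecomp_apply, h1, Set.mem_prod,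
    mem_rootBox_iff Module.finrank_pos.ne', normBox, Set.mem_ofPred_eq, h2]

lemma image_torusDecomp (A : Set (relTorus k k')) :
    torusDecomp k k' '' (A ×ˢ rootBox k (Module.finrank k k')) =
      torusProj k k' ⁻¹' A ∩ normBox k k' := by
  rw [← preimage_torusDecomp, Set.image_preimage_eq _ (torusDecomp k k').surjective]

instance : (relHaar k k').IsHaarMeasure where
  lt_top_of_isCompact := by
    intro K hK
    rw [relHaar_apply k k' hK.measurableSet, ← image_torusDecomp]
    refine ENNReal.mul_lt_top (ENNReal.inv_lt_top.2 (pos_iff_ne_zero.2 (prod_mult_ne_zero k))) ?_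
    exact ((hK.prod (isCompact_rootBox _)).image (continuous_torusDecomp k k')).measure_lt_top
  open_pos := by
    intro U hU hne
    rw [relHaar_apply k k' hU.measurableSet]
    refine mul_ne_zero (ENNReal.inv_ne_zero.2 (prod_mult_ne_top k)) ?_
    let V : Set (Torus k') := torusProj k k' ⁻¹' U ∩
      ⋂ σ, {t | (torusNorm k k' t σ : ℝ) ∈ Set.Ioo 1 (Real.exp 1)}
    have hV : IsOpen V := by
      refine (hU.preimage (continuous_torusProj k k')).inter (isOpen_iInter_of_finite fun σ => ?_)
      exact isOpen_Ioo.preimage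
        (continuous_subtype_val.comp ((continuous_apply σ).comp (continuous_torusNorm k k')))
    -- The section point over the constant `exp (1/2)` has norm `exp (1/2)` at every place, strictly
    -- inside the box, and projects to `1`.
    have hVne : V.Nonempty := by
      obtain ⟨x, hx⟩ := hne
      let y : Torus k := fun _ => ⟨Real.exp (1 / 2), Real.exp_pos _⟩
      refine ⟨x * torusSection k k' y, ?_, Set.mem_iInter.2 fun σ => ?_⟩
      · change torusProjHom k k' _ ∈ U
        rw [map_mul, torusSection_eq]
        simpa using hx
      · rw [Set.mem_ofPred_eq, map_mul, torusNorm_coe, one_mul, torusNorm_torusSection]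
        exact ⟨Real.one_lt_exp_iff.2 (by norm_num), Real.exp_lt_exp.2 (by norm_num)⟩
    refine ((hV.measure_pos _ hVne).trans_le (measure_mono ?_)).ne'
    refine Set.inter_subset_inter_right _ fun t ht σ => ?_
    exact Set.Ioo_subset_Icc_self (Set.mem_iInter.1 ht σ)
  map_mul_left_eq_self := by
    intro c
    ext A hA
    have hm : Measurable fun x : relTorus k k' => c * x := measurable_const_mul c
    rw [Measure.map_apply hm hA, relHaar_apply k k' hA, relHaar_apply k k' (hm hA)]
    congr 1
    -- Translation by an element of norm `1` preserves the norm box and commutes with the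
    -- projection, so invariance is inherited from `T_{k'}`.
    rw [← measure_preimage_mul (torusHaar k') (c : Torus k')
      (torusProj k k' ⁻¹' A ∩ normBox k k')]
    congr 1
    ext t
    have h1 : torusProj k k' (c * t) = c * torusProj k k' t := by
      change torusProjHom k k' _ = _
      rw [map_mul]; simp
    have h2 : torusNorm k k' (c * t) = torusNorm k k' t := by
      rw [map_mul, torusNorm_coe, one_mul]
    simp only [normBox, Set.mem_preimage, Set.mem_inter_iff, h1, Set.mem_ofPred_eq, h2]

instance : ((relHaar k k').prod (torusHaar k)).IsHaarMeasure :=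
  Measure.prod.instIsHaarMeasure _ _

instance : (Measure.map (torusDecomp k k') ((relHaar k k').prod (torusHaar k))).IsHaarMeasure :=
  MulEquiv.isHaarMeasure_map _ _ (continuous_torusDecomp k k') (continuous_torusDecomp_symm k k')

lemma exists_isCompact_measure {G : Type*} [TopologicalSpace G] [Group G] [IsTopologicalGroup G]
    [LocallyCompactSpace G] [MeasurableSpace G] (μ : Measure G) [μ.IsHaarMeasure] :
    ∃ K : Set G, IsCompact K ∧ μ K ≠ 0 ∧ μ K ≠ ⊤ := by
  obtain ⟨K, hK, hK1⟩ := exists_compact_mem_nhds (1 : G)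
  exact ⟨K, hK, (MeasureTheory.Measure.measure_pos_of_mem_nhds μ hK1).ne', hK.measure_ne_top⟩

/-- The measure `d^× t_{k'}` in the decomposition `T_{k'} = T_{k'/k} × T_k`. -/
theorem torusHaar_eq_map : torusHaar k' =
    ((Module.finrank k k' : ℝ≥0∞) ^ Fintype.card (InfinitePlace k)) •
      Measure.map (torusDecomp k k') ((relHaar k k').prod (torusHaar k)) := by
  set ν := Measure.map (torusDecomp k k') ((relHaar k k').prod (torusHaar k)) with hν
  obtain ⟨K, hK, h0, h1⟩ := exists_isCompact_measure (relHaar k k')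
  have hd : Module.finrank k k' ≠ 0 := Module.finrank_pos.ne'
  have key := Measure.isMulLeftInvariant_eq_smul (torusHaar k') ν
  set c := Measure.haarScalarFactor (torusHaar k') ν
  have h2 := torusHaar_normBox k k' hK.measurableSet
  have hS : MeasurableSet (torusProj k k' ⁻¹' K ∩ normBox k k') :=
    ((continuous_torusProj k k').measurable hK.measurableSet).inter
      (isClosed_normBox k k').measurableSet
  -- By uniqueness of Haar measure only the scalar `c` is unknown. It is found by measuring one test
  -- set, the rectangle over `K`, in both ways.
  have h3 : ν (torusProj k k' ⁻¹' K ∩ normBox k k') = relHaar k k' K *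
      ((∏ σ : InfinitePlace k, (σ.mult : ℝ≥0∞)) *
      ENNReal.ofReal (Module.finrank k k' : ℝ)⁻¹ ^ Fintype.card (InfinitePlace k)) := by
    rw [hν, Measure.map_apply (continuous_torusDecomp k k').measurable hS, preimage_torusDecomp,
      Measure.prod_prod, torusHaar_rootBox]
  rw [key, Measure.smul_apply, h3, ENNReal.ofReal_inv_of_pos (by positivity),
    ENNReal.ofReal_natCast, ENNReal.smul_def, smul_eq_mul] at h2
  have h4 : (c : ℝ≥0∞) * ((Module.finrank k k' : ℝ≥0∞)⁻¹ ^ Fintype.card (InfinitePlace k)) = 1 := by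
    have hP0 := prod_mult_ne_zero k
    have hP1 := prod_mult_ne_top k
    have h5 : ((∏ σ : InfinitePlace k, (σ.mult : ℝ≥0∞)) * relHaar k k' K) *
        ((c : ℝ≥0∞) * ((Module.finrank k k' : ℝ≥0∞)⁻¹ ^ Fintype.card (InfinitePlace k))) =
        ((∏ σ : InfinitePlace k, (σ.mult : ℝ≥0∞)) * relHaar k k' K) * 1 := by
      rw [mul_one]
      conv_rhs => rw [← h2]
      ring
    exact (ENNReal.mul_right_inj (mul_ne_zero hP0 h0) (ENNReal.mul_ne_top hP1 h1)).1 h5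
  rw [key]
  change (c : ℝ≥0∞) • ν = _
  congr 1
  rw [← ENNReal.inv_pow] at h4
  rw [← inv_inv ((Module.finrank k k' : ℝ≥0∞) ^ Fintype.card (InfinitePlace k))]
  exact ENNReal.eq_inv_of_mul_eq_one_left h4

end Decomposition

/-! ### The tower `E / F / ℚ` and the measure on `T_{E/ℚ}`. -/

section Tower

lemma lintegral_map_prod {α β γ : Type*} [MeasurableSpace α] [MeasurableSpace β]
    [MeasurableSpace γ] {μ : Measure α} {ν : Measure β} [SFinite ν] {f : γ → ℝ≥0∞}
    {e : α × β → γ} (hf : Measurable f) (he : Measurable e) :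
    ∫⁻ z, f z ∂(Measure.map e (μ.prod ν)) = ∫⁻ x, ∫⁻ y, f (e (x, y)) ∂ν ∂μ := by
  rw [lintegral_map hf he]
  exact lintegral_prod _ (hf.comp he).aemeasurable

lemma inertiaDeg_comap_ne_zero {F E : Type*} [Field F] [NumberField F] [Field E] [NumberField E]
    [Algebra F E] (τ : InfinitePlace E) : (τ.comap (algebraMap F E)).inertiaDeg τ ≠ 0 := by
  have : τ.LiesOver (τ.comap (algebraMap F E)) := ⟨rfl⟩
  have h := mult_mul_finrank (τ.comap (algebraMap F E)) τ
  rw [← inertiaDeg_eq_finrank] at h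
  intro h0
  rw [h0, mul_zero] at h
  exact mult_pos.ne h

lemma rat_mult (σ : InfinitePlace ℚ) : σ.mult = 1 := by
  have : σ = Rat.infinitePlace := Subsingleton.elim _ _
  subst this
  rw [mult, if_pos Rat.isReal_infinitePlace]

lemma inertiaDeg_rat {k : Type*} [Field k] [NumberField k] (σ : InfinitePlace ℚ)
    (τ : InfinitePlace k) : σ.inertiaDeg τ = τ.mult := by
  have h : τ.comap (algebraMap ℚ k) = σ := Subsingleton.elim _ _
  have h1 := mult_mul_inertiaDeg (inertiaDeg_comap_ne_zero (F := ℚ) τ)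
  rwa [h, rat_mult, one_mul] at h1

lemma torusNorm_rat_apply {k : Type*} [Field k] [NumberField k] (t : Torus k)
    (σ : InfinitePlace ℚ) : torusNorm ℚ k t σ = ∏ τ, t τ ^ τ.mult := by
  change ∏ τ : InfinitePlace k, t τ ^ σ.inertiaDeg τ = _
  simp only [inertiaDeg_rat]

lemma mem_relTorus_rat {k : Type*} [Field k] [NumberField k] {t : Torus k} :
    t ∈ relTorus ℚ k ↔ ∏ τ, t τ ^ τ.mult = 1 := by
  rw [relTorus, MonoidHom.mem_ker]
  constructor
  · intro h
    rw [← torusNorm_rat_apply t Rat.infinitePlace, h]; rfl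
  · intro h
    funext σ
    rw [torusNorm_rat_apply, h]; rfl

variable (F E : Type*) [Field F] [NumberField F] [Field E] [NumberField E] [Algebra F E]

lemma torusNorm_apply (t : Torus E) (σ : InfinitePlace F) :
    torusNorm F E t σ = ∏ τ : InfinitePlace E, t τ ^ σ.inertiaDeg τ := rfl

/-- Each `τ` lies above a single `σ`, and there `n_σ [E_τ : F_σ] = n_τ`; for the other `σ` the
exponent vanishes. This is the transitivity of the norm down to `ℚ`. -/
lemma prod_torusNorm_pow_mult (t : Torus E) :
    ∏ σ, torusNorm F E t σ ^ σ.mult = ∏ τ, t τ ^ τ.mult := by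
  simp only [torusNorm_apply, ← Finset.prod_pow, ← pow_mul]
  rw [Finset.prod_comm]
  refine Finset.prod_congr rfl fun τ _ => ?_
  rw [Finset.prod_eq_single (τ.comap (algebraMap F E)), mul_comm,
    mult_mul_inertiaDeg (inertiaDeg_comap_ne_zero τ)]
  · intro σ _ hne
    have : σ.inertiaDeg τ = 0 := by
      by_contra h
      exact hne (comap_eq_of_inertiaDeg_ne_zero F E h).symm
    simp [this]
  · simp

lemma torusNorm_torusNorm (t : Torus E) :
    torusNorm ℚ F (torusNorm F E t) = torusNorm ℚ E t := by
  funext σ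
  rw [torusNorm_rat_apply, torusNorm_rat_apply, prod_torusNorm_pow_mult]

lemma fiberIncl_fiberIncl (z : Torus ℚ) :
    fiberIncl F E (fiberIncl ℚ F z) = fiberIncl ℚ E z := by
  funext τ
  simp only [fiberIncl_apply]
  congr 1
  exact Subsingleton.elim _ _

lemma fiberIncl_mem_relTorus_rat {y : Torus F} (hy : y ∈ relTorus ℚ F) :
    fiberIncl F E y ∈ relTorus ℚ E := by
  rw [relTorus, MonoidHom.mem_ker] at hy ⊢
  rw [← torusNorm_torusNorm F E, torusNorm_fiberIncl, map_pow, hy, one_pow]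

lemma relTorus_le_relTorus_rat : relTorus F E ≤ relTorus ℚ E := by
  intro t ht
  rw [relTorus, MonoidHom.mem_ker] at ht ⊢
  rw [← torusNorm_torusNorm F E, ht, map_one]

lemma torusRoot_mem_relTorus_rat {k : Type*} [Field k] [NumberField k] {m : ℕ} (hm : m ≠ 0)
    {y : Torus k} (hy : y ∈ relTorus ℚ k) : torusRoot m y ∈ relTorus ℚ k := by
  rw [relTorus, MonoidHom.mem_ker] at hy ⊢
  have h : torusNorm ℚ k (torusRoot m y) ^ m = 1 := by
    rw [← map_pow, pow_torusRoot hm, hy]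
  rw [← torusRoot_pow hm (torusNorm ℚ k (torusRoot m y)), h, map_one]

lemma torusNorm_mem_relTorus_rat {t : Torus E} (ht : t ∈ relTorus ℚ E) :
    torusNorm F E t ∈ relTorus ℚ F := by
  rw [relTorus, MonoidHom.mem_ker] at ht ⊢
  rw [torusNorm_torusNorm, ht]

/-- The decomposition `T_{E/ℚ} = T_{E/F} × T_{F/ℚ}`. -/
def relTorusDecomp : relTorus F E × relTorus ℚ F ≃* relTorus ℚ E where
  toFun p := ⟨p.1 * fiberIncl F E p.2, mul_mem (relTorus_le_relTorus_rat F E p.1.2)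
    (fiberIncl_mem_relTorus_rat F E p.2.2)⟩
  invFun t := (torusProj F E t, ⟨torusRoot (Module.finrank F E) (torusNorm F E t),
    torusRoot_mem_relTorus_rat Module.finrank_pos.ne' (torusNorm_mem_relTorus_rat F E t.2)⟩)
  left_inv p := by
    have h := (torusDecomp F E).symm_apply_apply (p.1, (p.2 : Torus F))
    rw [torusDecomp_symm_apply, torusDecomp_apply, Prod.mk.injEq] at h
    exact Prod.ext h.1 (Subtype.ext h.2)
  right_inv t := Subtype.ext ((torusDecomp F E).apply_symm_apply t)
  map_mul' p q := Subtype.ext ((torusDecomp F E).map_mul (p.1, (p.2 : Torus F))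
    (q.1, (q.2 : Torus F)))

lemma coe_relTorusDecomp (p : relTorus F E × relTorus ℚ F) :
    (relTorusDecomp F E p : Torus E) = p.1 * fiberIncl F E p.2 := rfl

lemma relTorusDecomp_symm_fst (t : relTorus ℚ E) :
    ((relTorusDecomp F E).symm t).1 = torusProj F E t := rfl

lemma continuous_relTorusDecomp : Continuous (relTorusDecomp F E) :=
  ((continuous_torusDecomp F E).comp
    (continuous_fst.prodMk (continuous_subtype_val.comp continuous_snd))).subtype_mk _

lemma continuous_relTorusDecomp_symm : Continuous (relTorusDecomp F E).symm :=
  ((continuous_torusProj F E).comp continuous_subtype_val).prodMk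
    (((continuous_torusRoot _).comp ((continuous_torusNorm F E).comp
      continuous_subtype_val)).subtype_mk _)

instance : ((relHaar F E).prod (relHaar ℚ F)).IsHaarMeasure :=
  Measure.prod.instIsHaarMeasure _ _

instance :
    (Measure.map (relTorusDecomp F E) ((relHaar F E).prod (relHaar ℚ F))).IsHaarMeasure :=
  MulEquiv.isHaarMeasure_map _ _ (continuous_relTorusDecomp F E)
    (continuous_relTorusDecomp_symm F E)

lemma lintegral_torusHaar {f : Torus E → ℝ≥0∞} (hf : Measurable f) :
    ∫⁻ t, f t ∂(torusHaar E) = (Module.finrank F E : ℝ≥0∞) ^ Fintype.card (InfinitePlace F) *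
      ∫⁻ t, ∫⁻ y, f (t * fiberIncl F E y) ∂(torusHaar F) ∂(relHaar F E) := by
  have hc := (continuous_torusDecomp F E).measurable
  conv_lhs => rw [torusHaar_eq_map F E]
  rw [lintegral_smul_measure, lintegral_map_prod hf hc, smul_eq_mul]
  rfl

lemma card_infinitePlace_rat : Fintype.card (InfinitePlace ℚ) = 1 :=
  Fintype.card_eq_one_iff.2 ⟨Rat.infinitePlace, fun _ => Subsingleton.elim _ _⟩

/-- The measure `d^× t_{E/ℚ}` in the decomposition `T_{E/ℚ} = T_{E/F} × T_{F/ℚ}`. -/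
theorem relHaar_rat_eq_map : relHaar ℚ E =
    ((Module.finrank F E : ℝ≥0∞) ^ (Fintype.card (InfinitePlace F) - 1)) •
      Measure.map (relTorusDecomp F E) ((relHaar F E).prod (relHaar ℚ F)) := by
  set ν := Measure.map (relTorusDecomp F E) ((relHaar F E).prod (relHaar ℚ F)) with hν
  have key := Measure.isMulLeftInvariant_eq_smul (relHaar ℚ E) ν
  set c := Measure.haarScalarFactor (relHaar ℚ E) ν
  obtain ⟨K, hK, hK0, hK1⟩ := exists_isCompact_measure (torusHaar E)
  let f : Torus E → ℝ≥0∞ := K.indicator 1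
  have hf : Measurable f := measurable_one.indicator hK.measurableSet
  have hf1 : ∫⁻ t, f t ∂(torusHaar E) = torusHaar E K := by
    simp only [f, lintegral_indicator_one hK.measurableSet]
  -- The measure of `K ⊆ T_E` is computed along two splittings of `T_E` as `T_{E/F} × T_{F/ℚ} ×
  -- T_ℚ`. Passing through `T_{E/ℚ}` gives `[E:ℚ] c I`, passing through `T_F` gives `[E:F]^r [F:ℚ]
  -- I`, with `r` the number of places of `F`. Hence `c = [E:F]^(r-1)`.
  set I := ∫⁻ t, ∫⁻ y, ∫⁻ z, f (t * fiberIncl F E y * fiberIncl ℚ E z)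
    ∂(torusHaar ℚ) ∂(relHaar ℚ F) ∂(relHaar F E) with hI
  have hj := (continuous_fiberIncl ℚ E).measurable
  have hjF := (continuous_fiberIncl F E).measurable
  have h1 : ∫⁻ t, f t ∂(torusHaar E) = (Module.finrank ℚ E : ℝ≥0∞) * (c * I) := by
    have hg : Measurable fun x : relTorus ℚ E =>
        ∫⁻ z, f (x * fiberIncl ℚ E z) ∂(torusHaar ℚ) :=
      Measurable.lintegral_prod_right' (f := fun p : relTorus ℚ E × Torus ℚ =>
        f (p.1 * fiberIncl ℚ E p.2)) (by fun_prop)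
    have hc := (continuous_relTorusDecomp F E).measurable
    rw [lintegral_torusHaar ℚ E hf, card_infinitePlace_rat, pow_one, key]
    change _ * ∫⁻ x, _ ∂((c : ℝ≥0∞) • ν) = _
    rw [lintegral_smul_measure, hν, lintegral_map_prod hg hc]
    rfl
  have h2 : ∫⁻ t, f t ∂(torusHaar E) =
      (Module.finrank F E : ℝ≥0∞) ^ Fintype.card (InfinitePlace F) *
        ((Module.finrank ℚ F : ℝ≥0∞) * I) := by
    rw [lintegral_torusHaar F E hf, hI, ← lintegral_const_mul' _ _ (ENNReal.natCast_ne_top _)]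
    congr 1
    refine lintegral_congr fun t => ?_
    have ht : Measurable fun y : Torus F => f (t * fiberIncl F E y) := by fun_prop
    rw [lintegral_torusHaar ℚ F ht, card_infinitePlace_rat, pow_one]
    simp only [map_mul, fiberIncl_fiberIncl, mul_assoc]
  have hE : (Module.finrank ℚ E : ℝ≥0∞) = Module.finrank ℚ F * Module.finrank F E := by
    rw [← Nat.cast_mul, Module.finrank_mul_finrank ℚ F E]
  have hn0 : (Module.finrank F E : ℝ≥0∞) ≠ 0 := by exact_mod_cast Module.finrank_pos.ne'
  have hd0 : (Module.finrank ℚ F : ℝ≥0∞) ≠ 0 := by exact_mod_cast Module.finrank_pos.ne'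
  have hI0 : I ≠ 0 := fun h => hK0 (by rw [← hf1, h2, h, mul_zero, mul_zero])
  have hI1 : I ≠ ⊤ := fun h => hK1 (by
    rw [← hf1, h2, h, ENNReal.mul_top hd0, ENNReal.mul_top (pow_ne_zero _ hn0)])
  -- There is at least one archimedean place, so the truncated subtraction in the exponent is a true
  -- one.
  obtain ⟨r, hr⟩ : ∃ r, Fintype.card (InfinitePlace F) = r + 1 :=
    Nat.exists_eq_succ_of_ne_zero Fintype.card_ne_zero
  have h3 : (Module.finrank ℚ F * Module.finrank F E * I : ℝ≥0∞) * c =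
      (Module.finrank ℚ F * Module.finrank F E * I : ℝ≥0∞) * (Module.finrank F E : ℝ≥0∞) ^ r := by
    have h4 := h1.symm.trans h2
    rw [hE, hr, pow_succ] at h4
    calc _ = _ := by ring
      _ = _ := h4
      _ = _ := by ring
  have h5 : (c : ℝ≥0∞) = (Module.finrank F E : ℝ≥0∞) ^ r :=
    (ENNReal.mul_right_inj (mul_ne_zero (mul_ne_zero hd0 hn0) hI0)
      (ENNReal.mul_ne_top (ENNReal.mul_ne_top (ENNReal.natCast_ne_top _)
        (ENNReal.natCast_ne_top _)) hI1)).1 h3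
  rw [key, hr, Nat.add_sub_cancel, ← h5]
  rfl

lemma lintegral_relHaar_rat {f : relTorus ℚ E → ℝ≥0∞} (hf : Measurable f) :
    ∫⁻ t, f t ∂(relHaar ℚ E) =
      (Module.finrank F E : ℝ≥0∞) ^ (Fintype.card (InfinitePlace F) - 1) *
      ∫⁻ t, ∫⁻ y, f (relTorusDecomp F E (t, y)) ∂(relHaar ℚ F) ∂(relHaar F E) := by
  have hc := (continuous_relTorusDecomp F E).measurable
  rw [relHaar_rat_eq_map F E, lintegral_smul_measure, lintegral_map_prod hf hc, smul_eq_mul]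

end Tower

/-! ### Sums over groups, along fibres and along cosets. -/

section TsumHom

/-- All fibres are cosets of the kernel. With values in `ℝ≥0∞` and `ENat.card`, the kernel may be
infinite, so finiteness can be settled separately. -/
lemma tsum_comp_hom {A B : Type*} [Group A] [Group B] (φ : A →* B)
    (hφ : Function.Surjective φ) (g : B → ℝ≥0∞) :
    ∑' a, g (φ a) = (ENat.card φ.ker : ℝ≥0∞) * ∑' b, g b := by
  rw [← (Equiv.sigmaFiberEquiv φ).tsum_eq, ENNReal.tsum_sigma', ← ENNReal.tsum_mul_left]
  refine tsum_congr fun b => ?_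
  have h1 : ∀ a : {a // φ a = b}, g (φ (Equiv.sigmaFiberEquiv φ ⟨b, a⟩)) = g b := fun a => by
    rw [Equiv.sigmaFiberEquiv_apply, a.2]
  simp only [h1]
  rw [ENNReal.tsum_const]
  congr 2
  obtain ⟨a₀, rfl⟩ := hφ b
  refine (ENat.card_congr ?_)
  exact
    { toFun := fun a => ⟨a₀⁻¹ * a, by rw [MonoidHom.mem_ker, map_mul, a.2, map_inv, inv_mul_cancel]⟩
      invFun := fun x => ⟨a₀ * x, by rw [map_mul, MonoidHom.mem_ker.1 x.2, mul_one]⟩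
      left_inv := fun a => Subtype.ext (mul_inv_cancel_left _ _)
      right_inv := fun x => Subtype.ext (inv_mul_cancel_left _ _) }

lemma tsum_eq_tsum_quotient_tsum {Q : Type*} [Group Q] (H : Subgroup Q) (g : Q → ℝ≥0∞) :
    ∑' q, g q = ∑' c : Q ⧸ H, ∑' h : H, g (c.out * h) := by
  let e : (Q ⧸ H) × H ≃ Q :=
    { toFun := fun p => p.1.out * p.2
      invFun := fun q => (q, ⟨(q : Q ⧸ H).out⁻¹ * q,
        QuotientGroup.eq.1 (QuotientGroup.out_eq' (q : Q ⧸ H))⟩)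
      left_inv := fun p => by
        have h : ((p.1.out * (p.2 : Q) : Q) : Q ⧸ H) = p.1 := by
          rw [QuotientGroup.mk_mul_of_mem _ p.2.2, QuotientGroup.out_eq']
        refine Prod.ext h (Subtype.ext ?_)
        simp only [h, inv_mul_cancel_left]
      right_inv := fun q => mul_inv_cancel_left _ _ }
  rw [← e.tsum_eq]
  exact ENNReal.tsum_prod (f := fun (c : Q ⧸ H) (h : H) => g (c.out * h))

end TsumHom

/-! ### Fundamental domains and the unfolding of integrals. -/

section Domains

variable {G : Type*} [CommGroup G]

/-- A measurable set that contains exactly one point of each `U`-orbit. -/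
structure IsStrictDomain [MeasurableSpace G] (U : Subgroup G) (D : Set G) : Prop where
  measurableSet : MeasurableSet D
  existsUnique : ∀ x, ∃! u : U, (u : G) * x ∈ D

/-- A discrete subgroup of a second countable group has a fundamental domain. -/
theorem exists_isStrictDomain [TopologicalSpace G] [IsTopologicalGroup G]
    [SecondCountableTopology G] [MeasurableSpace G] [BorelSpace G] (U : Subgroup G)
    (hU : ∃ V ∈ nhds (1 : G), ∀ u ∈ U, u ∈ V → u = 1) : ∃ D, IsStrictDomain U D := by
  obtain ⟨V, hV, hVU⟩ := hU
  have hc : Filter.Tendsto (fun p : G × G => p.1⁻¹ * p.2) (nhds (1, 1)) (nhds 1) := by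
    have : Continuous fun p : G × G => p.1⁻¹ * p.2 := by fun_prop
    simpa using this.tendsto (1, 1)
  -- Since `W⁻¹ W ⊆ V`, two points of one `U`-orbit in the same translate of `W` differ by an
  -- element of `U ∩ V`, hence coincide. Countably many translates `B i` cover `G`.
  obtain ⟨W, hWo, hW1, hW⟩ : ∃ W : Set G, IsOpen W ∧ 1 ∈ W ∧ ∀ a ∈ W, ∀ b ∈ W, a⁻¹ * b ∈ V := by
    have h := hc hV
    rw [nhds_prod_eq, Filter.mem_map, Filter.mem_prod_self_iff] at h
    obtain ⟨t, ht, htV⟩ := h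
    obtain ⟨W, hWt, hWo, hW1⟩ := mem_nhds_iff.1 ht
    exact ⟨W, hWo, hW1, fun a ha b hb => htV (Set.mk_mem_prod (hWt ha) (hWt hb))⟩
  let g := TopologicalSpace.denseSeq G
  let B : ℕ → Set G := fun i => (fun x => (g i)⁻¹ * x) ⁻¹' W
  have hBo : ∀ i, IsOpen (B i) := fun i => hWo.preimage (by fun_prop)
  have hcov : ∀ x, ∃ i, x ∈ B i := by
    intro x
    have ho : IsOpen ((fun y : G => y⁻¹ * x) ⁻¹' W) := hWo.preimage (by fun_prop)
    obtain ⟨y, hy, i, rfl⟩ := (TopologicalSpace.denseRange_denseSeq G).inter_open_nonempty _ ho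
      ⟨x, by simpa using hW1⟩
    exact ⟨i, hy⟩
  -- The union of all orbits that meet `B i`.
  let A : ℕ → Set G := fun i => ⋃ u : U, (fun x => (u : G) * x) ⁻¹' B i
  have hAo : ∀ i, IsOpen (A i) := fun i => isOpen_iUnion fun u => (hBo i).preimage (by fun_prop)
  have hAU : ∀ i (u : U) x, (u : G) * x ∈ A i ↔ x ∈ A i := by
    intro i u x
    simp only [A, Set.mem_iUnion, Set.mem_preimage, ← mul_assoc]
    constructor
    · rintro ⟨v, hv⟩
      exact ⟨v * u, hv⟩
    · rintro ⟨v, hv⟩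
      exact ⟨v * u⁻¹, by simpa using hv⟩
  -- Each orbit is represented by its only point in the first `B i` that it meets.
  refine ⟨⋃ i, (B i \ ⋃ j ∈ Set.Iio i, A j), ?_, fun x => ?_⟩
  · refine MeasurableSet.iUnion fun i => (hBo i).measurableSet.diff ?_
    exact (isOpen_biUnion fun j _ => hAo j).measurableSet
  · have hex : ∃ i, x ∈ A i := by
      obtain ⟨i, hi⟩ := hcov x
      exact ⟨i, Set.mem_iUnion.2 ⟨1, by simpa using hi⟩⟩
    classical
    obtain ⟨u, hu⟩ := Set.mem_iUnion.1 (Nat.find_spec hex)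
    have hspec : ∀ v : U, ((v : G) * x ∈ ⋃ i, (B i \ ⋃ j ∈ Set.Iio i, A j)) →
        (v : G) * x ∈ B (Nat.find hex) := by
      intro v hv
      obtain ⟨i, hi, hi'⟩ := Set.mem_iUnion.1 hv
      have h1 : x ∈ A i := Set.mem_iUnion.2 ⟨v, hi⟩
      have h2 : ¬ Nat.find hex < i := fun hlt => hi' (Set.mem_biUnion hlt
        ((hAU _ v x).2 (Nat.find_spec hex)))
      have h3 := Nat.find_min' hex h1
      rwa [show Nat.find hex = i by omega]
    refine ⟨u, Set.mem_iUnion.2 ⟨Nat.find hex, hu, ?_⟩, fun v hv => ?_⟩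
    · intro h
      simp only [Set.mem_iUnion] at h
      obtain ⟨j, hj, hj'⟩ := h
      exact Nat.find_min hex hj ((hAU j u x).1 hj')
    · have h1 := hW _ hu _ (hspec v hv)
      have h2 := hVU (u⁻¹ * v : U) (SetLike.coe_mem _) (by
        convert h1 using 1
        simp only [Subgroup.coe_mul, Subgroup.coe_inv, mul_inv, inv_inv]
        have : (g (Nat.find hex) * ((u : G)⁻¹ * x⁻¹) * ((g (Nat.find hex))⁻¹ * ((v : G) * x))) =
            (u : G)⁻¹ * v * (x⁻¹ * x) * (g (Nat.find hex) * (g (Nat.find hex))⁻¹) := by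
          simp only [mul_assoc, mul_comm, mul_left_comm]
        rw [this, inv_mul_cancel, mul_inv_cancel, mul_one, mul_one])
      have h3 : u⁻¹ * v = 1 := Subtype.ext h2
      exact (inv_mul_eq_one.1 h3).symm

variable [MeasurableSpace G] {U : Subgroup G} {D : Set G}

open Classical in
lemma IsStrictDomain.tsum_indicator (hD : IsStrictDomain U D) (x : G) :
    ∑' u : U, D.indicator (1 : G → ℝ≥0∞) ((u : G) * x) = 1 := by
  obtain ⟨u, hu, huniq⟩ := hD.existsUnique x
  rw [tsum_eq_single u]
  · simp [hu]
  · intro v hv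
    exact Set.indicator_of_notMem (fun h => hv (huniq v h)) _

/-- A subgroup through which a larger group acts meets the domain a constant number of times. -/
lemma IsStrictDomain.tsum_indicator_hom (hD : IsStrictDomain U D) {Q : Type*} [Group Q]
    (ρ : Q →* G) (hρ : U ≤ ρ.range) : ∃ C : ℝ≥0∞,
      (Finite (Q ⧸ U.comap ρ) → Finite ρ.ker → C ≠ ⊤) ∧
      ∀ x, ∑' q, D.indicator (1 : G → ℝ≥0∞) (ρ q * x) = C := by
  let φ : U.comap ρ →* U := ρ.subgroupComap U
  have hφ : Function.Surjective φ := by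
    rintro ⟨u, hu⟩
    obtain ⟨q, rfl⟩ := hρ hu
    exact ⟨⟨q, hu⟩, rfl⟩
  -- Each coset of `ρ⁻¹(U)` contributes one complete `U`-orbit, with every element of `U` taken
  -- `#ker φ` times, and the domain meets that orbit once.
  refine ⟨ENat.card (Q ⧸ U.comap ρ) * (ENat.card φ.ker : ℝ≥0∞), fun h1 h2 => ?_, fun x => ?_⟩
  · have : Finite φ.ker := by
      refine Finite.of_injective (β := ρ.ker) (fun q => ⟨q.1.1, ?_⟩) fun a b h => ?_
      · exact congrArg Subtype.val (MonoidHom.mem_ker.1 q.2)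
      · exact Subtype.ext (Subtype.ext (congrArg (fun q : ρ.ker => (q : Q)) h))
    rw [ENat.card_eq_coe_natCard, ENat.card_eq_coe_natCard φ.ker]
    exact ENNReal.mul_ne_top (ENNReal.natCast_ne_top _) (ENNReal.natCast_ne_top _)
  · rw [tsum_eq_tsum_quotient_tsum (U.comap ρ)]
    have : ∀ c : Q ⧸ U.comap ρ, ∑' h : U.comap ρ,
        D.indicator (1 : G → ℝ≥0∞) (ρ (c.out * h) * x) = ENat.card φ.ker := by
      intro c
      have h1 := tsum_comp_hom φ hφ (fun u : U => D.indicator (1 : G → ℝ≥0∞)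
        ((u : G) * (ρ c.out * x)))
      rw [hD.tsum_indicator, mul_one] at h1
      rw [← h1]
      refine tsum_congr fun h => ?_
      rw [map_mul, mul_comm (ρ c.out), mul_assoc]
      rfl
    simp only [this, ENNReal.tsum_const]

variable {ν : Measure G}

lemma IsStrictDomain.isFundamentalDomain (hD : IsStrictDomain U D) :
    IsFundamentalDomain U.op D ν := by
  refine IsFundamentalDomain.mk' hD.measurableSet.nullMeasurableSet fun x => ?_
  obtain ⟨u, hu, huniq⟩ := hD.existsUnique x
  refine ⟨⟨MulOpposite.op u, u.2⟩, ?_, fun v hv => ?_⟩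
  · change x * u ∈ D
    rwa [mul_comm]
  · have hv' : (v.1.unop : G) * x ∈ D := by
      rw [mul_comm]; exact hv
    have := huniq ⟨v.1.unop, v.2⟩ hv'
    exact Subtype.ext (MulOpposite.unop_injective (congrArg (fun u : U => (u : G)) this))

variable [MeasurableMul G] [ν.IsMulLeftInvariant] [Countable U]

instance : SMulInvariantMeasure U.op G ν where
  measure_preimage_smul := fun c s _ => by
    have : (fun x : G => c • x) ⁻¹' s = (fun x => c.1.unop * x) ⁻¹' s := by
      ext x
      change x * c.1.unop ∈ s ↔ _
      rw [mul_comm]; rfl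
    rw [this, measure_preimage_mul]

instance : MeasurableConstSMul U.op G where
  measurable_const_smul := fun c => measurable_mul_const c.1.unop

instance : Countable U.op := Countable.of_equiv U (Subgroup.equivOp U)

/-- The definition picks an arbitrary fundamental domain. The choice is immaterial because preimages
of subsets of the quotient are `U`-invariant, and an invariant set has the same measure in any two
domains. -/
lemma quotientMeasure_eq (hD : IsStrictDomain U D) : quotientMeasure ν U =
    (ν.restrict D).map (QuotientGroup.mk : G → G ⧸ U) := by
  have h : ∃ D : Set G, IsFundamentalDomain U.op D ν := ⟨D, hD.isFundamentalDomain⟩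
  rw [quotientMeasure, dif_pos h]
  have hm : Measurable (QuotientGroup.mk : G → G ⧸ U) := QuotientGroup.measurable_coe
  ext A hA
  rw [Measure.map_apply hm hA, Measure.map_apply hm hA, Measure.restrict_apply (hm hA),
    Measure.restrict_apply (hm hA)]
  refine h.choose_spec.measure_set_eq hD.isFundamentalDomain (hm hA) fun g => ?_
  ext x
  have : (QuotientGroup.mk (g • x) : G ⧸ U) = QuotientGroup.mk x :=
    QuotientGroup.mk_mul_of_mem x g.2
  simp only [Set.mem_preimage, this]

lemma quotientMeasure_real_univ (hD : IsStrictDomain U D) :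
    (quotientMeasure ν U).real Set.univ = (ν D).toReal := by
  have hm : Measurable (QuotientGroup.mk : G → G ⧸ U) := QuotientGroup.measurable_coe
  rw [quotientMeasure_eq hD, Measure.real, Measure.map_apply hm MeasurableSet.univ,
    Set.preimage_univ, Measure.restrict_apply_univ]

lemma IsStrictDomain.lintegral_eq (hD : IsStrictDomain U D) {f : G → ℝ≥0∞} (hf : Measurable f) :
    ∫⁻ x, f x ∂ν = ∫⁻ x in D, ∑' u : U, f ((u : G) * x) ∂ν := by
  have hm : ∀ u : U, Measurable fun x => f ((u : G) * x) := fun u =>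
    hf.comp (measurable_const_mul _)
  rw [hD.isFundamentalDomain.lintegral_eq_tsum', lintegral_tsum fun u => (hm u).aemeasurable,
    ← ((Subgroup.equivOp U).trans (Equiv.inv U.op)).tsum_eq]
  refine tsum_congr fun u => lintegral_congr fun x => ?_
  simp only [Equiv.trans_apply, Equiv.inv_apply, inv_inv]
  rw [mul_comm]
  rfl

lemma IsStrictDomain.lintegral_eq_mul (hD : IsStrictDomain U D) {f : G → ℝ≥0∞}
    (hf : Measurable f) {c : ℝ≥0∞} (hc : ∀ x, ∑' u : U, f ((u : G) * x) = c) :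
    ∫⁻ x, f x ∂ν = c * ν D := by
  rw [hD.lintegral_eq hf]
  simp [hc]

/-- Unfolding the indicator of `K` counts, at each point of `D`, the points of its orbit in `K`,
which is at least `1`. It is used with `K` compact, to bound the regulator. -/
lemma IsStrictDomain.measure_le (hD : IsStrictDomain U D) {K : Set G} (hK : MeasurableSet K)
    (h : ∀ x, ∃ u : U, (u : G) * x ∈ K) : ν D ≤ ν K := by
  have h1 := hD.lintegral_eq (ν := ν) ((measurable_one (α := ℝ≥0∞)).indicator hK)
  rw [lintegral_indicator_one hK] at h1
  rw [h1, ← setLIntegral_one]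
  refine lintegral_mono fun x => ?_
  obtain ⟨u, hu⟩ := h x
  refine le_trans ?_ (ENNReal.le_tsum u)
  simp [hu]

lemma IsStrictDomain.measure_ne_zero (hD : IsStrictDomain U D) (hν : ν ≠ 0) : ν D ≠ 0 := by
  intro h
  have h1 := hD.lintegral_eq (ν := ν) (measurable_one (α := ℝ≥0∞))
  rw [setLIntegral_measure_zero _ _ h] at h1
  exact hν (by simpa using h1)

variable {Q : Type*} [Group Q] {ρ : Q →* G} {C : ℝ≥0∞}

lemma lintegral_translate_indicator (hD : MeasurableSet D) (g : G) (f : G → ℝ≥0∞) :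
    ∫⁻ x in D, f (g * x) ∂ν =
      ∫⁻ x, D.indicator (1 : G → ℝ≥0∞) (g⁻¹ * x) * f x ∂ν := by
  rw [← lintegral_mul_left_eq_self (μ := ν) _ g, ← lintegral_indicator hD]
  refine lintegral_congr fun x => ?_
  rw [inv_mul_cancel_left]
  by_cases h : x ∈ D <;> simp [h]

lemma integral_translate_indicator (hD : MeasurableSet D) (g : G) (f : G → ℂ) :
    ∫ x in D, f (g * x) ∂ν =
      ∫ x, (D.indicator (1 : G → ℝ≥0∞) (g⁻¹ * x)).toReal • f x ∂ν := by
  rw [← integral_mul_left_eq_self (μ := ν) (fun x =>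
    (D.indicator (1 : G → ℝ≥0∞) (g⁻¹ * x)).toReal • f x) g, ← integral_indicator hD]
  refine integral_congr_ae (Filter.Eventually.of_forall fun x => ?_)
  simp only [inv_mul_cancel_left]
  by_cases h : x ∈ D <;> simp [h]

variable [Countable Q]

/-- Each integral over `D` is moved to the whole group by translation, leaving the indicator of a
translate of `D` as a weight. The weights add up to the constant `C`. -/
lemma tsum_setLIntegral_translate (hD : MeasurableSet D)
    (hC : ∀ x, ∑' q, D.indicator (1 : G → ℝ≥0∞) (ρ q * x) = C) {f : G → ℝ≥0∞}
    (hf : Measurable f) :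
    ∑' q, ∫⁻ x in D, f (ρ q * x) ∂ν = C * ∫⁻ x, f x ∂ν := by
  have hind : ∀ g : G, Measurable fun x => D.indicator (1 : G → ℝ≥0∞) (g * x) := fun g =>
    (measurable_one.indicator hD).comp (measurable_const_mul g)
  have hm : ∀ g : G, Measurable fun x => D.indicator (1 : G → ℝ≥0∞) (g * x) * f x := fun g =>
    (hind g).mul hf
  simp only [lintegral_translate_indicator hD]
  rw [← lintegral_tsum (fun q => (hm _).aemeasurable), ← lintegral_const_mul _ hf]
  refine lintegral_congr fun x => ?_
  rw [ENNReal.tsum_mul_right, ← hC x, ← (Equiv.inv Q).tsum_eq]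
  simp

lemma indicator_one_ne_top (D : Set G) (x : G) : D.indicator (1 : G → ℝ≥0∞) x ≠ ⊤ := by
  by_cases h : x ∈ D <;> simp [h]

/-- The complex version of the unfolding. The exchange of sum and integral is justified by the
nonnegative version applied to the norm of `f`; this needs `C` finite. -/
lemma hasSum_setIntegral_translate (hD : MeasurableSet D)
    (hC : ∀ x, ∑' q, D.indicator (1 : G → ℝ≥0∞) (ρ q * x) = C) (hC1 : C ≠ ⊤) {f : G → ℂ}
    (hf : Integrable f ν) (hfm : Measurable f) :
    HasSum (fun q => ∫ x in D, f (ρ q * x) ∂ν) (C.toReal • ∫ x, f x ∂ν) := by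
  have hind : ∀ g : G, Measurable fun x => (D.indicator (1 : G → ℝ≥0∞) (g * x)).toReal := fun g =>
    ((measurable_one.indicator hD).comp (measurable_const_mul g)).ennreal_toReal
  have hC' : ∀ x, ∑' q, D.indicator (1 : G → ℝ≥0∞) ((ρ q)⁻¹ * x) = C := fun x => by
    rw [← hC x, ← (Equiv.inv Q).tsum_eq]
    simp
  have h1 : ∫ x, C.toReal • f x ∂ν =
      ∫ x, ∑' q, (D.indicator (1 : G → ℝ≥0∞) ((ρ q)⁻¹ * x)).toReal • f x ∂ν := by
    refine integral_congr_ae (Filter.Eventually.of_forall fun x => ?_)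
    have h3 : Summable fun q => (D.indicator (1 : G → ℝ≥0∞) ((ρ q)⁻¹ * x)).toReal :=
      ENNReal.summable_toReal (by rw [hC']; exact hC1)
    simp only
    rw [h3.tsum_smul_const, ← ENNReal.tsum_toReal_eq (fun q => indicator_one_ne_top D _), hC']
  rw [← integral_smul, h1]
  simp only [integral_translate_indicator hD]
  have hmeas : ∀ q, AEStronglyMeasurable
      (fun x => (D.indicator (1 : G → ℝ≥0∞) ((ρ q)⁻¹ * x)).toReal • f x) ν := fun q =>
    ((hind _).smul hfm).aestronglyMeasurable
  have hnorm : ∀ q, ∫⁻ x, ‖(D.indicator (1 : G → ℝ≥0∞) ((ρ q)⁻¹ * x)).toReal • f x‖ₑ ∂ν =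
      ∫⁻ x in D, ‖f (ρ q * x)‖ₑ ∂ν := by
    intro q
    rw [lintegral_translate_indicator hD (ρ q) (fun x => ‖f x‖ₑ)]
    refine lintegral_congr fun x => ?_
    rw [enorm_smul, Real.enorm_eq_ofReal ENNReal.toReal_nonneg,
      ENNReal.ofReal_toReal (indicator_one_ne_top D _)]
  have htot : ∑' q, ∫⁻ x, ‖(D.indicator (1 : G → ℝ≥0∞) ((ρ q)⁻¹ * x)).toReal • f x‖ₑ ∂ν ≠ ⊤ := by
    simp only [hnorm]
    rw [tsum_setLIntegral_translate hD hC (f := fun x => ‖f x‖ₑ) hfm.enorm]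
    exact ENNReal.mul_ne_top hC1 hf.2.ne
  refine hasSum_integral_of_summable_integral_norm (fun q => ⟨hmeas q, ?_⟩) ?_
  · exact (ENNReal.ne_top_of_tsum_ne_top htot q).lt_top
  · simp only [fun q => integral_norm_eq_lintegral_enorm (hmeas q)]
    exact ENNReal.summable_toReal htot

end Domains

/-! ### Relative norms at an archimedean place. -/

section PlaceNorm

variable {F E : Type*} [Field F] [NumberField F] [Field E] [NumberField E] [Algebra F E]

open Classical in
lemma norm_norm_embedding (ψ : F →+* ℂ) (x : E) : ‖ψ (Algebra.norm F x)‖ =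
    ∏ φ : E →+* ℂ with φ.comp (algebraMap F E) = ψ, ‖φ x‖ := by
  let _ : Algebra F ℂ := ψ.toAlgebra
  have h : ψ (Algebra.norm F x) = ∏ φ : E →ₐ[F] ℂ, φ x :=
    Algebra.norm_eq_prod_embeddings F ℂ x
  rw [h, norm_prod]
  refine Finset.prod_bij (fun φ _ => (φ : E →+* ℂ)) (fun φ _ => ?_) (fun φ _ φ' _ h => ?_)
    (fun φ hφ => ?_) (fun φ _ => rfl)
  · exact Finset.mem_filter.2 ⟨Finset.mem_univ _, φ.comp_algebraMap⟩
  · exact AlgHom.coe_ringHom_injective h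
  · exact ⟨⟨φ, fun r => RingHom.congr_fun (Finset.mem_filter.1 hφ).2 r⟩, Finset.mem_univ _, rfl⟩

/-- The norm at an archimedean place is the product of the local norms. -/
theorem place_norm (σ : InfinitePlace F) (x : E) :
    σ (Algebra.norm F x) = ∏ τ : InfinitePlace E, τ x ^ σ.inertiaDeg τ := by
  classical
  -- The same product over the embeddings of `E` above `σ` is grouped first by their restriction to
  -- `F`, and in `h2` by the place of `E` that they define.
  have h1 : ∏ φ : E →+* ℂ with mk (φ.comp (algebraMap F E)) = σ, ‖φ x‖ =
      σ (Algebra.norm F x) ^ σ.mult := by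
    rw [← Finset.prod_fiberwise_of_maps_to (t := {ψ : F →+* ℂ | mk ψ = σ})
      (g := fun φ : E →+* ℂ => φ.comp (algebraMap F E)) (by simp)]
    rw [← card_filter_mk_eq σ, ← Finset.prod_const]
    refine Finset.prod_congr rfl fun ψ hψ => ?_
    have h2 : σ (Algebra.norm F x) = ‖ψ (Algebra.norm F x)‖ := by
      rw [← (Finset.mem_filter.1 hψ).2]; rfl
    rw [h2, norm_norm_embedding, Finset.filter_filter]
    congr 1
    ext φ
    simp only [Finset.mem_filter, Finset.mem_univ, true_and, and_iff_right_iff_imp]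
    rintro rfl
    exact (Finset.mem_filter.1 hψ).2
  have h2 : ∏ φ : E →+* ℂ with mk (φ.comp (algebraMap F E)) = σ, ‖φ x‖ =
      ∏ τ : InfinitePlace E, (τ x ^ σ.inertiaDeg τ) ^ σ.mult := by
    rw [← Finset.prod_fiberwise _ (g := fun φ : E →+* ℂ => mk φ)]
    refine Finset.prod_congr rfl fun τ _ => ?_
    rw [Finset.filter_filter]
    by_cases h : τ.comap (algebraMap F E) = σ
    · subst h
      have h3 : ∀ φ : E →+* ℂ, (mk (φ.comp (algebraMap F E)) = τ.comap (algebraMap F E) ∧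
          mk φ = τ) ↔ mk φ = τ := fun φ => ⟨fun h => h.2, fun h => ⟨by rw [← h]; rfl, h⟩⟩
      simp only [h3]
      rw [Finset.prod_congr rfl (g := fun _ => τ x), Finset.prod_const, card_filter_mk_eq,
        ← pow_mul, mul_comm, mult_mul_inertiaDeg (inertiaDeg_comap_ne_zero τ)]
      intro φ hφ
      rw [← (Finset.mem_filter.1 hφ).2]; rfl
    · have h3 : σ.inertiaDeg τ = 0 := by
        by_contra h0
        exact h (comap_eq_of_inertiaDeg_ne_zero F E h0)
      rw [h3, pow_zero, one_pow]
      refine Finset.prod_eq_one fun φ hφ => ?_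
      obtain ⟨h4, h5⟩ := (Finset.mem_filter.1 hφ).2
      exact absurd (by rw [← h4, ← h5]; rfl) h
  -- Both groupings are `n_σ`-th powers of nonnegative reals, so the exponent can be dropped.
  rw [h1, Finset.prod_pow] at h2
  exact (pow_left_inj₀ (apply_nonneg _ _) (Finset.prod_nonneg fun τ _ =>
    pow_nonneg (apply_nonneg _ _) _) mult_ne_zero).1 h2

end PlaceNorm

/-! ### Discreteness and cocompactness of the unit lattice. -/

section UnitLattices

/-- The inclusion of the positive reals in `ℝ`. -/
def posVal : {x : ℝ // 0 < x} →* ℝ where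
  toFun := Subtype.val
  map_one' := rfl
  map_mul' _ _ := rfl

variable {k : Type*} [Field k] [NumberField k]

lemma coe_regMap (u : (𝓞 k)ˣ) (σ : InfinitePlace k) : (regMap k u σ : ℝ) = σ (u : k) := rfl

lemma regMap_mem_relTorus_rat (u : (𝓞 k)ˣ) : regMap k u ∈ relTorus ℚ k := by
  rw [mem_relTorus_rat]
  ext
  have h := NumberField.isUnit_iff_norm.1 u.isUnit
  rw [RingOfIntegers.coe_norm] at h
  have h1 : ∏ σ : InfinitePlace k, σ (u : k) ^ σ.mult = 1 := by
    rw [prod_eq_abs_norm]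
    exact_mod_cast h
  change (posVal (∏ τ, regMap k u τ ^ τ.mult) : ℝ) = 1
  rw [map_prod, ← h1]
  rfl

/-- The multiplicative regulator map with values in `T_{k/ℚ}`. -/
def relRegMap (k : Type*) [Field k] [NumberField k] : (𝓞 k)ˣ →* relTorus ℚ k :=
  (regMap k).codRestrict _ regMap_mem_relTorus_rat

@[simp] lemma coe_relRegMap (u : (𝓞 k)ˣ) : (relRegMap k u : Torus k) = regMap k u := rfl

lemma range_relRegMap : (relRegMap k).range = unitLattice k := by
  ext t
  rw [unitLattice, Subgroup.mem_subgroupOf, MonoidHom.mem_range, MonoidHom.mem_range]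
  simp only [Subtype.ext_iff, coe_relRegMap]

lemma ker_regMap : (regMap k).ker = Units.torsion k := by
  ext u
  rw [MonoidHom.mem_ker, Units.mem_torsion, funext_iff]
  simp only [Subtype.ext_iff, coe_regMap]
  rfl

lemma ker_relRegMap : (relRegMap k).ker = Units.torsion k := by
  rw [← ker_regMap]
  ext u
  rw [MonoidHom.mem_ker, MonoidHom.mem_ker, Subtype.ext_iff, coe_relRegMap]
  rfl

/-- The image of the unit group is discrete. -/
theorem exists_nhds_regMap : ∃ V ∈ nhds (1 : Torus k), ∀ u ∈ (regMap k).range, u ∈ V → u = 1 := by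
  let W : Set (Torus k) := {t | ∀ σ, (t σ : ℝ) < 2}
  have hW : IsOpen W := by
    have : W = ⋂ σ, {t | (t σ : ℝ) < 2} := by ext; simp [W]
    rw [this]
    exact isOpen_iInter_of_finite fun σ => isOpen_lt (by fun_prop) continuous_const
  -- Only finitely many algebraic integers of `k` have all conjugates of absolute value at most `2`;
  -- any bound above `1` would serve. Removing their finitely many nontrivial images from `W` leaves
  -- a neighbourhood of `1`.
  have hfin : ({u : (𝓞 k)ˣ | regMap k u ∈ W}).Finite := by
    refine Set.Finite.of_finite_image (f := fun u : (𝓞 k)ˣ => (u : k)) ?_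
      (Units.coe_injective k).injOn
    refine (Embeddings.finite_of_norm_le k ℂ 2).subset ?_
    rintro _ ⟨u, hu, rfl⟩
    exact ⟨RingOfIntegers.isIntegral_coe _, fun φ => (hu (mk φ)).le⟩
  have hS : (regMap k '' {u : (𝓞 k)ˣ | regMap k u ∈ W} \ {1}).Finite :=
    (hfin.image _).subset Set.sdiff_subset
  refine ⟨W ∩ (regMap k '' {u : (𝓞 k)ˣ | regMap k u ∈ W} \ {1})ᶜ,
    (hW.inter hS.isClosed.isOpen_compl).mem_nhds ⟨fun σ => ?_, fun h => h.2 rfl⟩, ?_⟩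
  · change (1 : ℝ) < 2
    norm_num
  · rintro _ ⟨u, rfl⟩ ⟨h1, h2⟩
    by_contra h
    exact h2 ⟨⟨u, h1, rfl⟩, h⟩

open Units Units.dirichletUnitTheorem in
/-- A compact set whose translates under the units cover `T_{k/ℚ}`. -/
theorem exists_isCompact_unitLattice : ∃ K : Set (relTorus ℚ k), IsCompact K ∧
    ∀ t, ∃ u : unitLattice k, (u : relTorus ℚ k) * t ∈ K := by
  classical
  obtain ⟨R, hR⟩ : ∃ R : ℝ, ∀ x : logSpace k, ∃ u : (𝓞 k)ˣ,
      ‖logEmbedding k (Additive.ofMul u) + x‖ ≤ R := by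
    -- By Dirichlet's theorem the fundamental units give a real basis of the logarithmic space. A
    -- unit removes the integer parts of the coordinates of `x`, and the remaining fractional parts
    -- bound the norm by the sum of the basis norms.
    let b := (basisUnitLattice k).ofZLatticeBasis ℝ (Units.unitLattice k)
    refine ⟨∑ i, ‖b i‖, fun x => ?_⟩
    have h1 : -(ZSpan.floor b x : logSpace k) ∈ Units.unitLattice k := by
      rw [← (basisUnitLattice k).ofZLatticeBasis_span ℝ (Units.unitLattice k)]
      exact neg_mem (SetLike.coe_mem _)
    obtain ⟨u, -, hu⟩ := h1
    refine ⟨u.toMul, ?_⟩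
    change ‖(logEmbedding k).toIntLinearMap u + x‖ ≤ _
    rw [hu, neg_add_eq_sub, ← ZSpan.fract_apply]
    exact ZSpan.norm_fract_le b x
  -- The inverse of the logarithm map on `T_{k/ℚ}`. The logarithmic space omits the place `w₀`,
  -- whose coordinate is recovered from the product formula; its coordinates `n_σ log t_σ` explain
  -- the division by `n_σ`.
  let lam : logSpace k → Torus k := fun x σ =>
    expHomeo (if h : σ ≠ w₀ then x ⟨σ, h⟩ / σ.mult else -(∑ σ', x σ') / σ.mult)
  have hlam : Continuous lam := by
    refine continuous_pi fun σ => expHomeo.continuous.comp ?_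
    by_cases h : σ ≠ w₀
    · simp only [dif_pos h]; fun_prop
    · simp only [dif_neg h]; fun_prop
  have hmem : ∀ x, lam x ∈ relTorus ℚ k := by
    intro x
    rw [mem_relTorus_rat]
    ext
    change (posVal (∏ τ, lam x τ ^ τ.mult) : ℝ) = 1
    rw [map_prod]
    have h1 : ∀ σ : InfinitePlace k, posVal (lam x σ ^ σ.mult) =
        Real.exp (if h : σ ≠ w₀ then x ⟨σ, h⟩ else -(∑ σ', x σ')) := by
      intro σ
      have hm : (σ.mult : ℝ) ≠ 0 := mult_coe_ne_zero
      change Real.exp _ ^ σ.mult = _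
      rw [← Real.exp_nat_mul]
      congr 1
      split_ifs <;> field_simp
    simp only [h1]
    rw [← Real.exp_sum, Real.exp_eq_one_iff, ← Fintype.sum_subtype_add_sum_subtype (· ≠ w₀)]
    have h2 : ∀ σ : {σ : InfinitePlace k // σ ≠ w₀},
        (if h : σ.1 ≠ w₀ then x ⟨σ.1, h⟩ else -(∑ σ', x σ')) = x σ := fun σ => dif_pos σ.2
    have h3 : ∀ σ : {σ : InfinitePlace k // ¬ σ ≠ w₀},
        (if h : σ.1 ≠ w₀ then x ⟨σ.1, h⟩ else -(∑ σ', x σ')) = -(∑ σ', x σ') :=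
      fun σ => dif_neg σ.2
    have h4 : Fintype.card {σ : InfinitePlace k // ¬ σ ≠ w₀} = 1 := by
      simp only [not_not, Fintype.card_subtype_eq]
    simp only [h2, h3, Finset.sum_const, Finset.card_univ, h4, one_smul, add_neg_cancel]
  let L : relTorus ℚ k → logSpace k := fun t σ => σ.1.mult * Real.log (t.1 σ.1)
  have hL : ∀ t : relTorus ℚ k, lam (L t) = t := by
    intro t
    funext σ
    have hm : (σ.mult : ℝ) ≠ 0 := mult_coe_ne_zero
    ext
    change Real.exp _ = _
    by_cases h : σ ≠ w₀
    · rw [dif_pos h]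
      simp only [L]
      rw [mul_div_cancel_left₀ _ hm, Real.exp_log (t.1 σ).2]
    · rw [dif_neg h]
      have h1 : ∑ σ, (σ.mult : ℝ) * Real.log (t.1 σ) = 0 := by
        have h2 : Real.log (posVal (∏ τ, t.1 τ ^ τ.mult)) = Real.log 1 := by
          rw [mem_relTorus_rat.1 t.2, map_one]
        rw [map_prod, Real.log_one] at h2
        refine Eq.trans ?_ h2
        rw [Real.log_prod]
        · refine Finset.sum_congr rfl fun σ _ => ?_
          exact (Real.log_pow _ _).symm
        · exact fun σ _ => (t.1 σ ^ σ.mult).2.ne'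
      rw [not_not] at h
      rw [← Fintype.sum_subtype_add_sum_subtype (· ≠ w₀)] at h1
      have h4 : ∑ σ' : {σ : InfinitePlace k // ¬ σ ≠ w₀}, (σ'.1.mult : ℝ) * Real.log (t.1 σ'.1) =
          σ.mult * Real.log (t.1 σ) := by
        rw [Fintype.sum_eq_single ⟨σ, by simpa using h⟩]
        rintro ⟨σ', h'⟩ hne
        rw [not_not] at h'
        exact absurd (Subtype.ext (h'.trans h.symm)) hne
      rw [h4] at h1
      have h5 : -(∑ σ', L t σ') = σ.mult * Real.log (t.1 σ) := by
        change -(∑ σ' : {σ : InfinitePlace k // σ ≠ w₀}, (σ'.1.mult : ℝ) * Real.log (t.1 σ'.1)) = _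
        linarith
      rw [h5, mul_div_cancel_left₀ _ hm, Real.exp_log (t.1 σ).2]
  refine ⟨(fun x => ⟨lam x, hmem x⟩) '' Metric.closedBall 0 R,
    (isCompact_closedBall _ _).image (hlam.subtype_mk _), fun t => ?_⟩
  obtain ⟨u, hu⟩ := hR (L t)
  refine ⟨⟨relRegMap k u, by rw [← range_relRegMap]; exact ⟨u, rfl⟩⟩, L (relRegMap k u * t), ?_,
    Subtype.ext (hL _)⟩
  rw [mem_closedBall_zero_iff]
  have hLu : L (relRegMap k u * t) = logEmbedding k (Additive.ofMul u) + L t := by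
    funext σ
    change _ * Real.log ((σ.1 (u : k)) * (t.1 σ.1 : ℝ)) = _ * Real.log (σ.1 (u : k)) + _ * _
    rw [Real.log_mul (by simp) (t.1 σ.1).2.ne', mul_add]
  rw [hLu]
  exact hu

end UnitLattices

/-! ### The group `𝓞_E^× / 𝓞_F^×`, relative units and the unit index. -/

section UnitQuotient

lemma finite_subgroup_of_isOfFinOrder {Q : Type*} [CommGroup Q] [Group.FG Q] (K : Subgroup Q)
    (h : ∀ q ∈ K, IsOfFinOrder q) : Finite K := by
  have : Module.Finite ℤ (Additive Q) := Module.Finite.iff_addGroup_fg.mpr inferInstance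
  let S : Submodule ℤ (Additive Q) := K.toAddSubgroup.toIntSubmodule
  have : Finite S := by
    refine Module.finite_of_fg_torsion S fun x => ?_
    obtain ⟨m, hm, hx⟩ := (h x.1.toMul x.2).exists_pow_eq_one
    refine ⟨⟨(m : ℤ), by simpa using hm.ne'⟩, Subtype.ext ?_⟩
    change (m : ℤ) • x.1 = 0
    rw [natCast_zsmul]
    exact congrArg Additive.ofMul hx
  exact this

lemma finite_quotient_of_pow_mem {Q : Type*} [CommGroup Q] [Group.FG Q] (H : Subgroup Q) {m : ℕ}
    (hm : m ≠ 0) (h : ∀ q : Q, q ^ m ∈ H) : Finite (Q ⧸ H) := by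
  have : Group.FG (Q ⧸ H) := QuotientGroup.fg _
  refine CommGroup.finite_of_fg_isMulTorsion _ fun q => ?_
  obtain ⟨q, rfl⟩ := QuotientGroup.mk_surjective q
  exact isOfFinOrder_iff_pow_eq_one.2 ⟨m, Nat.pos_of_ne_zero hm,
    (QuotientGroup.eq_one_iff _).2 (h q)⟩

lemma discrete_subgroupOf {G : Type*} [CommGroup G] [TopologicalSpace G] {T U : Subgroup G}
    (h : ∃ V ∈ nhds (1 : G), ∀ u ∈ U, u ∈ V → u = 1) :
    ∃ V ∈ nhds (1 : T), ∀ u ∈ U.subgroupOf T, u ∈ V → u = 1 := by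
  obtain ⟨V, hV, hVU⟩ := h
  exact ⟨Subtype.val ⁻¹' V, continuous_subtype_val.tendsto (1 : T) hV, fun u hu huV =>
    Subtype.ext (hVU u (Subgroup.mem_subgroupOf.1 hu) huV)⟩

theorem exists_isStrictDomain_unitLattice (k : Type*) [Field k] [NumberField k] :
    ∃ D, IsStrictDomain (unitLattice k) D :=
  exists_isStrictDomain _ (discrete_subgroupOf exists_nhds_regMap)

variable (F E : Type*) [Field F] [NumberField F] [Field E] [NumberField E] [Algebra F E]

theorem exists_isStrictDomain_relUnitLattice : ∃ D, IsStrictDomain (relUnitLattice F E) D := by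
  refine exists_isStrictDomain _ (discrete_subgroupOf ?_)
  obtain ⟨V, hV, hVU⟩ := exists_nhds_regMap (k := E)
  exact ⟨V, hV, fun u hu => hVU u (Subgroup.map_le_range _ _ hu)⟩

instance (k : Type*) [Field k] [NumberField k] : Countable k :=
  (Module.finBasis ℚ k).equivFun.injective.countable

instance (k : Type*) [Field k] [NumberField k] : Countable (𝓞 k)ˣ :=
  (Units.coe_injective k).countable

instance (k : Type*) [Field k] [NumberField k] : Countable (unitLattice k) := by
  rw [← range_relRegMap]
  exact Set.countable_range (relRegMap k)

instance : Countable (relUnitLattice F E) := by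
  have h : Countable ((relUnits F E).map (regMap E)) :=
    (Set.countable_range (regMap E)).mono (Subgroup.map_le_range _ _)
  exact (Subtype.val_injective.comp Subtype.val_injective |>.codRestrict
    (s := ((relUnits F E).map (regMap E) : Set (Torus E)))
    (fun u : relUnitLattice F E => Subgroup.mem_subgroupOf.1 u.2)).countable

/-- The inclusion `𝓞_F^× → 𝓞_E^×`. -/
def unitIncl : (𝓞 F)ˣ →* (𝓞 E)ˣ := Units.map (algebraMap (𝓞 F) (𝓞 E)).toMonoidHom

/-- The norm `𝓞_E^× → 𝓞_F^×`. -/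
def unitNorm : (𝓞 E)ˣ →* (𝓞 F)ˣ := Units.map (RingOfIntegers.norm F : 𝓞 E →* 𝓞 F)

lemma regMap_unitIncl (v : (𝓞 F)ˣ) : regMap E (unitIncl F E v) = fiberIncl F E (regMap F v) := rfl

lemma unitIncl_injective : Function.Injective (unitIncl F E) :=
  Units.map_injective (RingOfIntegers.algebraMap.injective F E)

lemma torusNorm_regMap (u : (𝓞 E)ˣ) : torusNorm F E (regMap E u) = regMap F (unitNorm F E u) := by
  funext σ
  ext
  rw [coe_regMap]
  change posVal (∏ τ, regMap E u τ ^ σ.inertiaDeg τ) = σ (algebraMap _ F (RingOfIntegers.norm F _))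
  rw [map_prod]
  exact (place_norm σ (u : E)).symm

lemma unitNorm_unitIncl (v : (𝓞 F)ˣ) :
    unitNorm F E (unitIncl F E v) = v ^ Module.finrank F E := by
  ext
  exact congrArg (algebraMap (𝓞 F) F) (RingOfIntegers.norm_algebraMap F (L := E) (v : 𝓞 F))

/-- The quotient `𝓞_E^× / 𝓞_F^×`. -/
abbrev UnitQuot : Type _ := (𝓞 E)ˣ ⧸ (unitIncl F E).range

/-- The map `𝓞_E^× / 𝓞_F^× → T_{E/F}` induced by the regulator map. -/
def unitProj : UnitQuot F E →* relTorus F E :=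
  QuotientGroup.lift _ ((torusProjHom F E).comp (regMap E)) (by
    rintro _ ⟨v, rfl⟩
    exact torusProj_fiberIncl F E (regMap F v))

/-- The relative unit `u ^ n / N(u)`. -/
def relUnitOf (u : (𝓞 E)ˣ) : (𝓞 E)ˣ :=
  u ^ Module.finrank F E * (unitIncl F E (unitNorm F E u))⁻¹

lemma relUnitOf_mem (u : (𝓞 E)ˣ) : relUnitOf F E u ∈ relUnits F E := by
  change unitNorm F E _ = 1
  rw [relUnitOf, map_mul, map_pow, map_inv, unitNorm_unitIncl, mul_inv_cancel]

/-- Dividing by the norm, a unit of `F`, does not change the class. So every `n`-th power in `𝓞_E^×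
/ 𝓞_F^×` comes from a relative unit, which makes both the index and the kernel below finite. -/
lemma mk_relUnitOf (u : (𝓞 E)ˣ) :
    (relUnitOf F E u : UnitQuot F E) = (u : UnitQuot F E) ^ Module.finrank F E := by
  rw [relUnitOf, QuotientGroup.mk_mul_of_mem _ (inv_mem (MonoidHom.mem_range.2 ⟨_, rfl⟩))]
  rfl

lemma regMap_mem_relTorus {u : (𝓞 E)ˣ} (hu : u ∈ relUnits F E) : regMap E u ∈ relTorus F E := by
  rw [relTorus, MonoidHom.mem_ker, torusNorm_regMap]
  rw [show unitNorm F E u = 1 from hu, map_one]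

lemma unitProj_mk_of_mem {u : (𝓞 E)ˣ} (hu : u ∈ relUnits F E) :
    (unitProj F E u : Torus E) = regMap E u :=
  congrArg Subtype.val (torusProj_coe F E ⟨_, regMap_mem_relTorus F E hu⟩)

lemma unitProj_mem_relUnitLattice {u : (𝓞 E)ˣ} (hu : u ∈ relUnits F E) :
    unitProj F E u ∈ relUnitLattice F E := by
  rw [relUnitLattice, Subgroup.mem_subgroupOf, unitProj_mk_of_mem F E hu]
  exact ⟨u, hu, rfl⟩

lemma relUnitLattice_le_range : relUnitLattice F E ≤ (unitProj F E).range := by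
  intro t ht
  obtain ⟨u, hu, hut⟩ := Subgroup.mem_subgroupOf.1 ht
  exact ⟨u, Subtype.ext ((unitProj_mk_of_mem F E hu).trans hut)⟩

instance : Group.FG (𝓞 E)ˣ := Group.fg_iff_monoid_fg.2 inferInstance

instance : Group.FG (UnitQuot F E) := QuotientGroup.fg _

instance : Countable (UnitQuot F E) := QuotientGroup.mk_surjective.countable

lemma finite_quotient_comap :
    Finite (UnitQuot F E ⧸ (relUnitLattice F E).comap (unitProj F E)) := by
  have h : ∀ q : UnitQuot F E,
      q ^ Module.finrank F E ∈ (relUnitLattice F E).comap (unitProj F E) := fun q => by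
    obtain ⟨u, rfl⟩ := QuotientGroup.mk_surjective q
    rw [← mk_relUnitOf]
    exact unitProj_mem_relUnitLattice F E (relUnitOf_mem F E u)
  exact finite_quotient_of_pow_mem (Q := UnitQuot F E) _ Module.finrank_pos.ne' h

/-- If a class is killed, its `n`-th power is the class of a relative unit whose absolute values are
all `1`, that is, of a root of unity. The kernel is thus a torsion subgroup of a finitely generated
abelian group. -/
lemma finite_ker_unitProj : Finite (unitProj F E).ker := by
  refine finite_subgroup_of_isOfFinOrder (Q := UnitQuot F E) (unitProj F E).ker fun q hq => ?_
  obtain ⟨u, rfl⟩ := QuotientGroup.mk_surjective q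
  have h1 : regMap E (relUnitOf F E u) = 1 := by
    rw [← unitProj_mk_of_mem F E (relUnitOf_mem F E u), mk_relUnitOf, map_pow,
      MonoidHom.mem_ker.1 hq, one_pow]
    rfl
  have h2 : relUnitOf F E u ∈ Units.torsion E := by
    rw [← ker_regMap]
    exact h1
  have h3 : IsOfFinOrder (relUnitOf F E u) := (CommGroup.mem_torsion _).1 h2
  have h4 := (QuotientGroup.mk' (unitIncl F E).range).isOfFinOrder h3
  rw [QuotientGroup.mk'_apply, mk_relUnitOf, isOfFinOrder_pow] at h4
  exact h4.resolve_right Module.finrank_pos.ne'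

/-- The kernel of the regulator map consists of the roots of unity; this is how `w_E` and `w_F`
enter the constant. -/
lemma tsum_units (k : Type*) [Field k] [NumberField k] (g : relTorus ℚ k → ℝ≥0∞) :
    ∑' v : (𝓞 k)ˣ, g (relRegMap k v) =
      (Units.torsionOrder k : ℝ≥0∞) * ∑' u : unitLattice k, g u := by
  let f : (𝓞 k)ˣ →* unitLattice k := (relRegMap k).codRestrict _ fun u => by
    rw [← range_relRegMap]; exact ⟨u, rfl⟩
  have hf : Function.Surjective f := by
    rintro ⟨t, ht⟩
    rw [← range_relRegMap] at ht
    obtain ⟨u, rfl⟩ := ht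
    exact ⟨u, rfl⟩
  have hk : f.ker = Units.torsion k := by
    rw [← ker_relRegMap]
    ext u
    rw [MonoidHom.mem_ker, MonoidHom.mem_ker, Subtype.ext_iff]
    rfl
  have h := tsum_comp_hom f hf (fun u => g u)
  rw [hk, ENat.card_eq_coe_natCard] at h
  exact h

/-- The index that compares the relative regulator with the regulators of `E` and `F`. -/
theorem exists_unit_index {D : Set (relTorus F E)} (hD : IsStrictDomain (relUnitLattice F E) D)
    {DF : Set (relTorus ℚ F)} (hDF : IsStrictDomain (unitLattice F) DF)
    {DE : Set (relTorus ℚ E)} (hDE : IsStrictDomain (unitLattice E) DE) :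
    ∃ C : ℝ≥0∞, C ≠ ⊤ ∧
      (∀ x, ∑' q, D.indicator (1 : relTorus F E → ℝ≥0∞) (unitProj F E q * x) = C) ∧
      C * Units.torsionOrder F * relHaar ℚ E DE =
        Units.torsionOrder E * ((Module.finrank F E : ℝ≥0∞) ^ (Fintype.card (InfinitePlace F) - 1) *
          (relHaar F E D * relHaar ℚ F DF)) := by
  obtain ⟨C, hC, hC'⟩ := hD.tsum_indicator_hom (unitProj F E) (relUnitLattice_le_range F E)
  refine ⟨C, hC (finite_quotient_comap F E) (finite_ker_unitProj F E), hC', ?_⟩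
  -- The indicator of `D × DF` in `T_{E/F} × T_{F/ℚ}`. Its integral is the product of the two
  -- volumes, up to the power of `n`. It is also the volume of `DE` times the constant `C w_F /
  -- w_E`, the sum of `φ` over an orbit of `U_E`.
  let φ : relTorus ℚ E → ℝ≥0∞ := fun x => D.indicator 1 ((relTorusDecomp F E).symm x).1 *
    DF.indicator 1 ((relTorusDecomp F E).symm x).2
  have hφ : Measurable φ :=
    ((measurable_one.indicator hD.measurableSet).comp
      (measurable_fst.comp (continuous_relTorusDecomp_symm F E).measurable)).mul
    ((measurable_one.indicator hDF.measurableSet).comp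
      (measurable_snd.comp (continuous_relTorusDecomp_symm F E).measurable))
  have h1 : ∫⁻ x, φ x ∂(relHaar ℚ E) =
      (Module.finrank F E : ℝ≥0∞) ^ (Fintype.card (InfinitePlace F) - 1) *
          (relHaar F E D * relHaar ℚ F DF) := by
    rw [lintegral_relHaar_rat F E hφ]
    simp only [φ, MulEquiv.symm_apply_apply]
    have h2 : ∀ t, ∫⁻ y, D.indicator (1 : relTorus F E → ℝ≥0∞) t * DF.indicator (1 : relTorus ℚ F → ℝ≥0∞) y ∂(relHaar ℚ F) =
        D.indicator (1 : relTorus F E → ℝ≥0∞) t * relHaar ℚ F DF := fun t => by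
      rw [lintegral_const_mul _ (measurable_one.indicator hDF.measurableSet),
        lintegral_indicator_one hDF.measurableSet]
    simp only [h2]
    rw [lintegral_mul_const _ (measurable_one.indicator hD.measurableSet),
      lintegral_indicator_one hD.measurableSet]
  -- Units of `F` move only the second coordinate and hit `DF` exactly `w_F` times; classes modulo
  -- `𝓞_F^×` move the first coordinate through `unitProj` and hit `D` exactly `C` times. The effect
  -- of the representative on the second coordinate is a mere shift of base point.
  have h2 : ∀ x, ∑' u : (𝓞 E)ˣ, φ (relRegMap E u * x) = C * Units.torsionOrder F := by
    intro x
    rw [tsum_eq_tsum_quotient_tsum (unitIncl F E).range]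
    have h3 : ∀ c : UnitQuot F E, ∑' h : (unitIncl F E).range, φ (relRegMap E (c.out * h) * x) =
        D.indicator 1 (unitProj F E c * ((relTorusDecomp F E).symm x).1) *
          Units.torsionOrder F := by
      intro c
      let y : relTorus ℚ F := ((relTorusDecomp F E).symm (relRegMap E c.out * x)).2
      have h4 := tsum_units F (fun t => DF.indicator (1 : relTorus ℚ F → ℝ≥0∞) (t * y))
      rw [hDF.tsum_indicator, mul_one] at h4
      rw [← h4, ← ENNReal.tsum_mul_left,
        ← (MonoidHom.ofInjective (unitIncl_injective F E)).toEquiv.tsum_eq]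
      refine tsum_congr fun v => ?_
      have h5 : relRegMap E (unitIncl F E v) = relTorusDecomp F E (1, relRegMap F v) := by
        ext1
        rw [coe_relRegMap, regMap_unitIncl, coe_relTorusDecomp]
        simp
      have h6 : (relTorusDecomp F E).symm (relRegMap E (c.out * unitIncl F E v) * x) =
          (1, relRegMap F v) * (relTorusDecomp F E).symm (relRegMap E c.out * x) := by
        rw [map_mul (relRegMap E), h5, mul_comm (relRegMap E c.out), mul_assoc, map_mul,
          MulEquiv.symm_apply_apply]
      have h7 : ((relTorusDecomp F E).symm (relRegMap E c.out * x)).1 =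
          unitProj F E c * ((relTorusDecomp F E).symm x).1 := by
        rw [map_mul, Prod.fst_mul, relTorusDecomp_symm_fst]
        conv_rhs => rw [← QuotientGroup.out_eq' c]
        rfl
      change φ (relRegMap E (c.out * unitIncl F E v) * x) = _
      simp only [φ]
      rw [h6, Prod.fst_mul, Prod.snd_mul, one_mul, h7]
    simp only [h3, ENNReal.tsum_mul_right, hC']
  have hw0 : (Units.torsionOrder E : ℝ≥0∞) ≠ 0 := by exact_mod_cast Units.torsionOrder_ne_zero E
  have hw1 : (Units.torsionOrder E : ℝ≥0∞) ≠ ⊤ := ENNReal.natCast_ne_top _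
  have h3 : ∀ x, ∑' u : unitLattice E, φ ((u : relTorus ℚ E) * x) =
      (Units.torsionOrder E : ℝ≥0∞)⁻¹ * (C * Units.torsionOrder F) := by
    intro x
    rw [← h2 x, tsum_units E (fun t => φ (t * x)), ← mul_assoc, ENNReal.inv_mul_cancel hw0 hw1,
      one_mul]
  rw [← h1, hDE.lintegral_eq_mul hφ h3, ← mul_assoc, ← mul_assoc, ENNReal.mul_inv_cancel hw0 hw1,
    one_mul]

end UnitQuotient

/-! ### Quasi-characters and Gaussian integrals on the tori. -/

section Mellin

/-- The quasi-character `x ↦ x ^ s` of the positive reals. -/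
def posCpow (s : ℂ) : {x : ℝ // 0 < x} →* ℂ where
  toFun x := ((x : ℝ) : ℂ) ^ s
  map_one' := by simp
  map_mul' x y := by
    rw [Positive.val_mul, Complex.ofReal_mul, Complex.mul_cpow_ofReal_nonneg x.2.le y.2.le]

lemma posCpow_apply (s : ℂ) (x : {x : ℝ // 0 < x}) : posCpow s x = ((x : ℝ) : ℂ) ^ s := rfl

lemma posCpow_eq_exp (s : ℂ) (x : {x : ℝ // 0 < x}) :
    posCpow s x = Complex.exp (Real.log x * s) := by
  rw [posCpow_apply, Complex.cpow_def_of_ne_zero (Complex.ofReal_ne_zero.2 x.2.ne'),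
    Complex.ofReal_log x.2.le]

lemma posCpow_ne_zero (s : ℂ) (x : {x : ℝ // 0 < x}) : posCpow s x ≠ 0 := by
  rw [posCpow_eq_exp]
  exact Complex.exp_ne_zero _

lemma posCpow_inv (s : ℂ) (x : {x : ℝ // 0 < x}) : posCpow s x⁻¹ = (posCpow s x)⁻¹ := by
  refine eq_inv_of_mul_eq_one_left ?_
  rw [← map_mul, inv_mul_cancel, map_one]

lemma posCpow_pow (s : ℂ) (x : {x : ℝ // 0 < x}) (m : ℕ) :
    posCpow s (x ^ m) = posCpow (m * s) x := by
  rw [posCpow_eq_exp, posCpow_eq_exp, Positive.val_pow, Real.log_pow]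
  push_cast
  ring_nf

lemma norm_posCpow (s : ℂ) (x : {x : ℝ // 0 < x}) : ‖posCpow s x‖ = (x : ℝ) ^ s.re :=
  Complex.norm_cpow_eq_rpow_re_of_pos x.2 s

lemma continuous_posCpow (s : ℂ) : Continuous (posCpow s) := by
  have : (posCpow s : {x : ℝ // 0 < x} → ℂ) =
      fun x : {x : ℝ // 0 < x} => Complex.exp (Real.log x * s) := by
    funext x
    exact posCpow_eq_exp s x
  rw [this]
  have h : Continuous fun x : {x : ℝ // 0 < x} => Real.log x :=
    continuous_subtype_val.log fun x => x.2.ne'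
  fun_prop

lemma posHaar_toReal_smul (g : ℝ → ℂ) : (fun x : {x : ℝ // 0 < x} =>
    (ENNReal.ofReal (x : ℝ)⁻¹).toReal • g x) =
    fun x : {x : ℝ // 0 < x} => (fun y : ℝ => y⁻¹ • g y) x := by
  funext x
  rw [ENNReal.toReal_ofReal (inv_nonneg.2 x.2.le)]

lemma integrable_posHaar {g : ℝ → ℂ} (h : IntegrableOn (fun x => x⁻¹ • g x) (Set.Ioi 0)) :
    Integrable (fun x : {x : ℝ // 0 < x} => g x) posHaar := by
  rw [posHaar, integrable_withDensity_iff_integrable_smul' (by fun_prop) (by simp),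
    posHaar_toReal_smul]
  exact (measurableEmbedding_posVal.integrable_map_iff (g := fun y : ℝ => y⁻¹ • g y)).1 (by
    rw [measurableEmbedding_posVal.map_comap, Subtype.range_coe_subtype]
    exact h)

lemma integral_posHaar (g : ℝ → ℂ) : ∫ x : {x : ℝ // 0 < x}, g x ∂posHaar =
    ∫ x in Set.Ioi 0, x⁻¹ • g x := by
  rw [posHaar, integral_withDensity_eq_integral_toReal_smul (by fun_prop) (by simp),
    posHaar_toReal_smul]
  exact integral_subtype_comap (s := Set.Ioi (0 : ℝ)) measurableSet_Ioi fun y => y⁻¹ • g y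

/-- With `y = x²` the integral becomes `Γ(c/2) / 2`, and `Γ` does not vanish on the right half
plane. The nonvanishing is what later allows division by these integrals. -/
lemma gaussian_mellin {c : ℂ} (hc : 0 < c.re) :
    Integrable (fun x : {x : ℝ // 0 < x} => (Real.exp (-(x : ℝ) ^ 2) : ℂ) * posCpow c x) posHaar ∧
    ∫ x : {x : ℝ // 0 < x}, (Real.exp (-(x : ℝ) ^ 2) : ℂ) * posCpow c x ∂posHaar ≠ 0 := by
  let g : ℝ → ℂ := fun x => (Real.exp (-x ^ 2) : ℂ) * (x : ℂ) ^ c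
  let G : ℝ → ℂ := fun y => (Real.exp (-y) : ℂ) * (y : ℂ) ^ (c / 2 - 1)
  have hc2 : 0 < (c / 2).re := by
    rw [show c / 2 = ((1 / 2 : ℝ) : ℂ) * c by push_cast; ring, Complex.re_ofReal_mul]
    positivity
  have hgG : Set.EqOn (fun x => x⁻¹ • g x)
      (fun x => (1 / 2 : ℝ) • ((|2| * x ^ ((2 : ℝ) - 1)) • G (x ^ (2 : ℝ)))) (Set.Ioi 0) := by
    intro x hx
    have hx0 : (x : ℂ) ≠ 0 := Complex.ofReal_ne_zero.2 (ne_of_gt hx)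
    have h1 : ((x ^ (2 : ℝ) : ℝ) : ℂ) ^ (c / 2 - 1) = (x : ℂ) ^ c * ((x : ℂ) ^ 2)⁻¹ := by
      have h2 := posCpow_pow (c / 2 - 1) ⟨x, hx⟩ 2
      simp only [posCpow_apply, Positive.val_pow] at h2
      rw [Real.rpow_two, h2, show ((2 : ℕ) : ℂ) * (c / 2 - 1) = c - 2 by push_cast; ring,
        Complex.cpow_sub _ _ hx0, div_eq_mul_inv, Complex.cpow_two]
    simp only [g, G, Complex.real_smul]
    rw [h1, Real.rpow_two, show (2 : ℝ) - 1 = 1 by norm_num, Real.rpow_one, abs_two]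
    push_cast
    field_simp
  have hm := measurableSet_Ioi (a := (0 : ℝ))
  constructor
  · refine integrable_posHaar (g := g) ?_
    rw [integrableOn_congr_fun hgG hm]
    exact ((integrableOn_Ioi_comp_rpow_iff G two_ne_zero).2
      (Complex.GammaIntegral_convergent hc2)).smul (1 / 2 : ℝ)
  · change ∫ x : {x : ℝ // 0 < x}, g x ∂posHaar ≠ 0
    rw [integral_posHaar, setIntegral_congr_fun hm hgG, integral_smul,
      integral_comp_rpow_Ioi G two_ne_zero]
    refine smul_ne_zero (by norm_num) ?_
    change Complex.GammaIntegral (c / 2) ≠ 0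
    rw [← Complex.Gamma_eq_integral hc2]
    exact Complex.Gamma_ne_zero_of_re_pos hc2

variable {k : Type*} [Field k] [NumberField k]

/-- The character `t ↦ ∏ t_σ ^ n_σ` of `T_k`. -/
def torusVol (k : Type*) [Field k] [NumberField k] : Torus k →* {x : ℝ // 0 < x} where
  toFun t := ∏ σ, t σ ^ σ.mult
  map_one' := by simp
  map_mul' t u := by simp [mul_pow, Finset.prod_mul_distrib]

lemma torusVol_apply (t : Torus k) : torusVol k t = ∏ σ, t σ ^ σ.mult := rfl

lemma continuous_torusVol : Continuous (torusVol k) :=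
  continuous_finsetProd _ fun σ _ => (continuous_apply σ).pow _

/-- The function on `T_k` whose integral is the gamma factor of `k`. -/
def gaussFun (s : ℂ) (t : Torus k) : ℂ :=
  (Real.exp (-∑ σ, (t σ : ℝ) ^ 2) : ℂ) * posCpow s (torusVol k t)

lemma gaussFun_eq_prod (s : ℂ) (t : Torus k) : gaussFun s t =
    ∏ σ, ((Real.exp (-(t σ : ℝ) ^ 2) : ℂ) * posCpow (σ.mult * s) (t σ)) := by
  rw [gaussFun, torusVol_apply, map_prod, ← Finset.sum_neg_distrib, Real.exp_sum,
    Finset.prod_mul_distrib, Complex.ofReal_prod]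
  simp only [posCpow_pow]

lemma re_mult_mul_pos {s : ℂ} (hs : 0 < s.re) (σ : InfinitePlace k) :
    0 < ((σ.mult : ℂ) * s).re := by
  rw [← Complex.ofReal_natCast, Complex.re_ofReal_mul]
  exact mul_pos (by exact_mod_cast mult_pos) hs

instance (σ : InfinitePlace k) : ((σ.mult : ℝ≥0∞) • posHaar).IsHaarMeasure :=
  Measure.IsHaarMeasure.smul _ (by exact_mod_cast mult_pos.ne') (ENNReal.natCast_ne_top _)

lemma integrable_gaussFun {s : ℂ} (hs : 0 < s.re) :
    Integrable (gaussFun (k := k) s) (torusHaar k) := by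
  have h : (gaussFun (k := k) s) = fun t => ∏ σ,
      (fun x : {x : ℝ // 0 < x} => (Real.exp (-(x : ℝ) ^ 2) : ℂ) * posCpow (σ.mult * s) x) (t σ) :=
    funext fun t => gaussFun_eq_prod s t
  rw [h, torusHaar]
  exact Integrable.fintype_prod fun σ =>
    (gaussian_mellin (re_mult_mul_pos hs σ)).1.smul_measure (ENNReal.natCast_ne_top _)

lemma integral_gaussFun_ne_zero {s : ℂ} (hs : 0 < s.re) :
    ∫ t, gaussFun s t ∂(torusHaar k) ≠ 0 := by
  simp only [gaussFun_eq_prod]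
  rw [torusHaar, integral_fintype_prod_eq_prod (fun (σ : InfinitePlace k) (x : {x : ℝ // 0 < x}) =>
    (Real.exp (-(x : ℝ) ^ 2) : ℂ) * posCpow (σ.mult * s) x)]
  refine Finset.prod_ne_zero_iff.2 fun σ _ => ?_
  rw [integral_smul_measure]
  exact smul_ne_zero (by simp) (gaussian_mellin (re_mult_mul_pos hs σ)).2

end Mellin

/-! ### The relative gamma factor as a quotient of Gaussian integrals. -/

section RelativeGamma

variable (F E : Type*) [Field F] [NumberField F] [Field E] [NumberField E] [Algebra F E]

lemma liesOver_iff {σ : InfinitePlace F} {τ : InfinitePlace E} :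
    τ.LiesOver σ ↔ τ.comap (algebraMap F E) = σ :=
  ⟨fun _ => LiesOver.comap_eq τ σ, fun h => by subst h; exact ⟨rfl⟩⟩

lemma exists_comap_eq (σ : InfinitePlace F) : ∃ τ : InfinitePlace E,
    τ.comap (algebraMap F E) = σ := by
  by_contra! h
  have h1 := sum_inertiaDeg F E σ
  rw [Finset.sum_eq_zero] at h1
  · exact Module.finrank_pos.ne h1
  · intro τ _
    by_contra h0
    exact h τ (comap_eq_of_inertiaDeg_ne_zero F E h0)

open Classical in
/-- The Euclidean length `(∑_{τ ∣ σ} t_τ ^ 2) ^ (1/2)` of the fibres of `t ∈ T_E`. -/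
def fiberLen (t : Torus E) : Torus F := fun σ =>
  ⟨Real.sqrt (∑ τ : InfinitePlace E with τ.comap (algebraMap F E) = σ, (t τ : ℝ) ^ 2), by
    refine Real.sqrt_pos.2 (Finset.sum_pos (fun τ _ => pow_pos (t τ).2 2) ?_)
    obtain ⟨τ, hτ⟩ := exists_comap_eq F E σ
    exact ⟨τ, Finset.mem_filter.2 ⟨Finset.mem_univ _, hτ⟩⟩⟩

open Classical in
lemma fiberLen_sq (t : Torus E) (σ : InfinitePlace F) : (fiberLen F E t σ : ℝ) ^ 2 =
    ∑ τ : InfinitePlace E with τ.comap (algebraMap F E) = σ, (t τ : ℝ) ^ 2 :=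
  Real.sq_sqrt (Finset.sum_nonneg fun _ _ => sq_nonneg _)

lemma sum_fiberLen_sq (t : Torus E) :
    ∑ σ, (fiberLen F E t σ : ℝ) ^ 2 = ∑ τ, (t τ : ℝ) ^ 2 := by
  classical
  simp only [fiberLen_sq]
  exact Finset.sum_fiberwise _ _ _

lemma fiberLen_mul_fiberIncl (t : Torus E) (y : Torus F) :
    fiberLen F E (t * fiberIncl F E y) = fiberLen F E t * y := by
  classical
  funext σ
  ext
  refine (pow_left_inj₀ (fiberLen F E _ σ).2.le (mul_pos (fiberLen F E t σ).2 (y σ).2).le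
    two_ne_zero).1 ?_
  rw [mul_pow, fiberLen_sq, fiberLen_sq, Finset.sum_mul]
  refine Finset.sum_congr rfl fun τ hτ => ?_
  have h := (Finset.mem_filter.1 hτ).2
  subst h
  exact mul_pow _ _ _

lemma continuous_fiberLen : Continuous (fiberLen F E) := by
  refine continuous_pi fun σ => Continuous.subtype_mk ?_ _
  refine Real.continuous_sqrt.comp (continuous_finsetSum _ fun τ _ => ?_)
  exact (continuous_subtype_val.comp (continuous_apply τ)).pow 2

/-- The function `∏_σ (∑_{τ ∣ σ} t_τ ^ 2) ^ (-n n_σ / 2)` on `T_E`. -/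
def relKernel (t : Torus E) : {x : ℝ // 0 < x} :=
  (torusVol F (fiberLen F E t) ^ Module.finrank F E)⁻¹

lemma continuous_relKernel : Continuous (relKernel F E) :=
  ((continuous_torusVol.comp (continuous_fiberLen F E)).pow _).inv

lemma relKernel_mul_fiberIncl (t : Torus E) (y : Torus F) :
    relKernel F E (t * fiberIncl F E y) =
      relKernel F E t * (torusVol F y ^ Module.finrank F E)⁻¹ := by
  rw [relKernel, fiberLen_mul_fiberIncl, map_mul, mul_pow, mul_inv]
  rfl

lemma torusVol_torusNorm (t : Torus E) : torusVol F (torusNorm F E t) = torusVol E t :=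
  prod_torusNorm_pow_mult F E t

lemma torusVol_coe (t : relTorus F E) : torusVol E t = 1 := by
  rw [← torusVol_torusNorm F E, torusNorm_coe, map_one]

lemma torusVol_fiberIncl (y : Torus F) :
    torusVol E (fiberIncl F E y) = torusVol F y ^ Module.finrank F E := by
  rw [← torusVol_torusNorm F E, torusNorm_fiberIncl, map_pow]

/-- The Gaussian depends on its argument only through the fibre lengths, and these are homogeneous
under `T_F`. Replacing the variable `y` by `fiberLen t * y` in the volume character costs exactly
`κ(t)^s`, since `t` has volume `1`. -/
lemma gaussFun_decomp (s : ℂ) (t : relTorus F E) (y : Torus F) :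
    gaussFun s ((t : Torus E) * fiberIncl F E y) =
      posCpow s (relKernel F E t) *
        gaussFun (Module.finrank F E * s) (fiberLen F E t * y) := by
  rw [gaussFun, gaussFun, map_mul, torusVol_coe, one_mul, torusVol_fiberIncl,
    ← sum_fiberLen_sq F E, fiberLen_mul_fiberIncl, ← posCpow_pow, map_mul (torusVol F), mul_pow,
    map_mul (posCpow s), relKernel, posCpow_inv]
  have := posCpow_ne_zero s (torusVol F (fiberLen F E t) ^ Module.finrank F E)
  field_simp

open Classical in
lemma relGamma_eq (s : ℂ) :
    relGamma F E s = ∫ t : relTorus F E, posCpow s (relKernel F E t) ∂(relHaar F E) := by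
  rw [relGamma]
  refine integral_congr_ae (Filter.Eventually.of_forall fun t => ?_)
  simp only
  rw [relKernel, posCpow_inv, posCpow_pow, torusVol_apply, map_prod, ← Finset.prod_inv_distrib]
  refine Finset.prod_congr rfl fun σ _ => ?_
  rw [one_div, posCpow_pow]
  congr 1
  have h : (∑ τ : InfinitePlace E with τ.LiesOver σ, ((t : Torus E) τ : ℝ) ^ 2) =
      ((fiberLen F E t σ ^ 2 : {x : ℝ // 0 < x}) : ℝ) := by
    rw [Positive.val_pow, fiberLen_sq]
    simp only [liesOver_iff]
  rw [h, ← posCpow_apply, posCpow_pow]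
  congr 1
  push_cast
  ring_nf

lemma finrank_mul_re_pos {s : ℂ} (hs : 0 < s.re) : 0 < ((Module.finrank F E : ℂ) * s).re := by
  rw [← Complex.ofReal_natCast, Complex.re_ofReal_mul]
  exact mul_pos (by exact_mod_cast Module.finrank_pos) hs

lemma integrable_decomp {f : Torus E → ℂ} (hf : Integrable f (torusHaar E)) :
    Integrable (fun p : relTorus F E × Torus F => f (p.1 * fiberIncl F E p.2))
      ((relHaar F E).prod (torusHaar F)) := by
  have hn : (Module.finrank F E : ℝ≥0∞) ^ Fintype.card (InfinitePlace F) ≠ 0 :=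
    pow_ne_zero _ (by exact_mod_cast Module.finrank_pos.ne')
  rw [torusHaar_eq_map F E, integrable_smul_measure hn
    (ENNReal.pow_ne_top (ENNReal.natCast_ne_top _))] at hf
  exact hf.comp_measurable (continuous_torusDecomp F E).measurable

lemma integral_torusHaar {f : Torus E → ℂ} (hf : Integrable f (torusHaar E)) :
    ∫ t, f t ∂(torusHaar E) = (Module.finrank F E : ℂ) ^ Fintype.card (InfinitePlace F) *
      ∫ t, ∫ y, f (t * fiberIncl F E y) ∂(torusHaar F) ∂(relHaar F E) := by
  have h := integrable_decomp F E hf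
  have hn : (Module.finrank F E : ℝ≥0∞) ^ Fintype.card (InfinitePlace F) ≠ 0 :=
    pow_ne_zero _ (by exact_mod_cast Module.finrank_pos.ne')
  have hf2 := hf
  rw [torusHaar_eq_map F E, integrable_smul_measure hn
    (ENNReal.pow_ne_top (ENNReal.natCast_ne_top _))] at hf2
  conv_lhs => rw [torusHaar_eq_map F E]
  rw [integral_smul_measure, integral_map (continuous_torusDecomp F E).measurable.aemeasurable hf2.1,
    Complex.real_smul]
  simp only [torusDecomp_apply]
  rw [integral_prod _ h]
  simp

/-- The relative gamma integral converges, and it is the quotient of two absolute ones. -/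
theorem relGamma_convergent {s : ℂ} (hs : 0 < s.re) :
    Integrable (fun t : relTorus F E => posCpow s (relKernel F E t)) (relHaar F E) ∧
    ∫ t, gaussFun s t ∂(torusHaar E) =
      (Module.finrank F E : ℂ) ^ Fintype.card (InfinitePlace F) * (relGamma F E s *
        ∫ y, gaussFun (Module.finrank F E * s) y ∂(torusHaar F)) := by
  have hf := integrable_gaussFun (k := E) hs
  have h0 := integral_gaussFun_ne_zero (k := F) (finrank_mul_re_pos F E hs)
  have h1 := integrable_decomp F E hf
  -- The inner integral over `T_F` absorbs the fibre lengths of `t` by invariance, so the two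
  -- variables separate.
  have h2 : ∀ t : relTorus F E, ∫ y, gaussFun s ((t : Torus E) * fiberIncl F E y) ∂(torusHaar F) =
      posCpow s (relKernel F E t) *
        ∫ y, gaussFun (Module.finrank F E * s) y ∂(torusHaar F) := by
    intro t
    simp only [gaussFun_decomp]
    rw [integral_const_mul, integral_mul_left_eq_self (μ := torusHaar F)
      (fun y => gaussFun (Module.finrank F E * s) y)]
  constructor
  · have h3 := h1.integral_prod_left
    simp only [h2] at h3
    -- Fubini gives integrability of `κ^s` times the Gaussian integral of `F`; that integral is
    -- nonzero and can be divided out.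
    have h4 := h3.mul_const (∫ y, gaussFun (Module.finrank F E * s) y ∂(torusHaar F))⁻¹
    simpa only [mul_inv_cancel_right₀ h0] using h4
  · rw [integral_torusHaar F E hf]
    simp only [h2]
    rw [integral_mul_const, relGamma_eq]

/-- The multiplicativity of the gamma factors in the tower `E / F / ℚ`. -/
theorem relGamma_tower {s : ℂ} (hs : 0 < s.re) :
    relGamma ℚ F (Module.finrank F E * s) ≠ 0 ∧
    relGamma ℚ E s = (Module.finrank F E : ℂ) ^ (Fintype.card (InfinitePlace F) - 1) *
      (relGamma F E s * relGamma ℚ F (Module.finrank F E * s)) := by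
  have h1 := (relGamma_convergent F E hs).2
  have h2 := (relGamma_convergent ℚ E hs).2
  have hs' := finrank_mul_re_pos F E hs
  have h3 := (relGamma_convergent ℚ F hs').2
  have h0 := integral_gaussFun_ne_zero (k := F) hs'
  rw [card_infinitePlace_rat, pow_one] at h2 h3
  have hE : (Module.finrank ℚ E : ℂ) = Module.finrank ℚ F * Module.finrank F E := by
    rw [← Nat.cast_mul, Module.finrank_mul_finrank ℚ F E]
  rw [hE, mul_assoc _ _ s] at h2
  set I := ∫ y, gaussFun (Module.finrank ℚ F * (Module.finrank F E * s)) y ∂(torusHaar ℚ)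
  have hI : I ≠ 0 := fun h => h0 (by rw [h3, h, mul_zero, mul_zero])
  have hd : (Module.finrank ℚ F : ℂ) ≠ 0 := by exact_mod_cast Module.finrank_pos.ne'
  have hn : (Module.finrank F E : ℂ) ≠ 0 := by exact_mod_cast Module.finrank_pos.ne'
  refine ⟨fun h => h0 (by rw [h3, h, zero_mul, mul_zero]), ?_⟩
  obtain ⟨r, hr⟩ : ∃ r, Fintype.card (InfinitePlace F) = r + 1 :=
    Nat.exists_eq_succ_of_ne_zero Fintype.card_ne_zero
  rw [h2, h3, hr] at h1
  rw [hr, Nat.add_sub_cancel]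
  -- The three cases `E/F`, `E/ℚ` and `F/ℚ` of `relGamma_convergent` share the integral `I` over
  -- `T_ℚ`, with the same exponent because degrees multiply. Cancelling `[E:ℚ] I` leaves the power
  -- `r` of `n`.
  refine mul_left_cancel₀ (mul_ne_zero (mul_ne_zero hd hn) hI) ?_
  linear_combination h1

end RelativeGamma

/-! ### Convergence of the partial zeta function. -/

section ZetaConvergence

variable (E : Type*) [Field E] [NumberField E]

open Ideal Filter Asymptotics in
-- The number of ideals of norm at most `m` grows linearly in `m`, so the Dirichlet series with
-- these coefficients converges absolutely to the right of `1`.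
lemma summable_card_absNorm {x : ℝ} (hx : 1 < x) :
    Summable fun m : ℕ =>
      (Nat.card {I : Ideal (𝓞 E) // absNorm I = m} : ℝ) * (if m = 0 then 0 else 1 / (m : ℝ) ^ x) := by
  have hO : (fun m : ℕ => ∑ k ∈ Finset.Icc 1 m,
      (Nat.card {I : Ideal (𝓞 E) // absNorm I = k} : ℝ)) =O[atTop] fun m => (m : ℝ) ^ (1 : ℝ) := by
    have h := (Ideal.tendsto_norm_le_div_atTop₀ E).comp tendsto_natCast_atTop_atTop
    refine IsBigO.congr' ?_ EventuallyEq.rfl EventuallyEq.rfl (f₁ := fun m : ℕ => ∑ k ∈ Finset.Icc 1 m,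
      (Nat.card {I : Ideal (𝓞 E) // absNorm I = k} : ℝ))
    refine isBigO_of_div_tendsto_nhds ?_ _ (h.congr fun n => ?_)
    · filter_upwards [eventually_ne_atTop 0] with m hm h0
      simp [hm] at h0
    · simp only [Function.comp_apply, Nat.cast_le, ← Nat.cast_sum, Pi.div_apply, Real.rpow_one]
      congr
      -- The added `1` counts the zero ideal, the only one of norm `0`: it is excluded from the
      -- asymptotic count but included in the fibre count over `0, …, n`.
      rw [← add_left_inj 1, ← card_norm_le_eq_card_norm_le_add_one,
        show Finset.Icc 1 n = Finset.Ioc 0 n from Finset.Icc_succ_left_eq_Ioc _ _,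
        show 1 = Nat.card {I : Ideal (𝓞 E) // absNorm I = 0} by simp [Ideal.absNorm_eq_zero_iff],
        Finset.sum_Ioc_add_eq_sum_Icc (n.zero_le),
        ← Finset.card_preimage_eq_sum_card_image_eq (fun k _ ↦ finite_setOfPred_absNorm_eq k)]
      simp [Set.coe_eq_subtype]
  have h := LSeriesSummable_of_sum_norm_bigO_and_nonneg (s := (x : ℂ)) hO
    (fun _ => Nat.cast_nonneg _) zero_le_one (by simpa using hx)
  refine (h.norm).congr fun m => ?_
  rw [LSeries.norm_term_eq]
  split_ifs <;> simp [div_eq_mul_inv]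

lemma summable_absNorm_rpow {x : ℝ} (hx : 1 < x) :
    Summable fun 𝔟 : (Ideal (𝓞 E))⁰ => 1 / (Ideal.absNorm (𝔟 : Ideal (𝓞 E)) : ℝ) ^ x := by
  have h : Summable fun 𝔟 : Ideal (𝓞 E) =>
      if Ideal.absNorm 𝔟 = 0 then 0 else 1 / (Ideal.absNorm 𝔟 : ℝ) ^ x := by
    rw [← (Equiv.sigmaFiberEquiv (Ideal.absNorm : Ideal (𝓞 E) → ℕ)).summable_iff]
    refine (summable_sigma_of_nonneg ?_).2 ⟨fun m => ?_, ?_⟩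
    · rintro ⟨m, I⟩
      dsimp
      split_ifs <;> positivity
    · have : Finite {I : Ideal (𝓞 E) // Ideal.absNorm I = m} :=
        (Ideal.finite_setOfPred_absNorm_eq m).to_subtype
      exact Summable.of_finite
    · refine (summable_card_absNorm E hx).congr fun m => ?_
      rw [tsum_congr (g := fun _ => if m = 0 then 0 else 1 / (m : ℝ) ^ x), tsum_const]
      · simp
      · rintro ⟨I, rfl⟩
        rfl
  refine (h.comp_injective Subtype.val_injective).congr fun 𝔟 => ?_
  exact if_neg fun h => nonZeroDivisors.ne_zero 𝔟.2 (Ideal.absNorm_eq_zero_iff.1 h)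

lemma summable_partialZeta (C : ClassGroup (𝓞 E)) {s : ℂ} (hs : 1 < s.re) :
    Summable fun 𝔟 : IdealsInClass E C =>
        1 / (Ideal.absNorm (𝔟.1 : Ideal (𝓞 E)) : ℂ) ^ s := by
  refine Summable.of_norm (((summable_absNorm_rpow E hs).comp_injective
    Subtype.val_injective).congr fun 𝔟 => ?_)
  have : 0 < Ideal.absNorm (𝔟.1 : Ideal (𝓞 E)) := Nat.pos_of_ne_zero fun h =>
    nonZeroDivisors.ne_zero 𝔟.1.2 (Ideal.absNorm_eq_zero_iff.1 h)
  rw [norm_div, norm_one, Complex.norm_natCast_cpow_of_pos this]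
  rfl

end ZetaConvergence


/-! ### Generators of the principal ideals `𝔟 𝔄`. -/

section IdealGenerators

variable {E : Type*} [Field E] [NumberField E]

lemma mk_eq_mk_inv_iff (𝔄 : (FractionalIdeal (𝓞 E)⁰ E)ˣ) (𝔟 : (Ideal (𝓞 E))⁰) :
    ClassGroup.mk0 𝔟 = ClassGroup.mk E 𝔄⁻¹ ↔ ∃ α : E,
      ((𝔟 : Ideal (𝓞 E)) : FractionalIdeal (𝓞 E)⁰ E) * 𝔄 =
        FractionalIdeal.spanSingleton (𝓞 E)⁰ α := by
  rw [← ClassGroup.mk_mk0 E, map_inv, eq_inv_iff_mul_eq_one, ← map_mul, ClassGroup.mk_eq_one_iff,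
    FractionalIdeal.isPrincipal_iff, Units.val_mul, FractionalIdeal.coe_mk0]

lemma exists_generator (𝔄 : (FractionalIdeal (𝓞 E)⁰ E)ˣ) :
    ∃ α : IdealsInClass E (ClassGroup.mk E 𝔄⁻¹) → E, ∀ 𝔟, α 𝔟 ≠ 0 ∧
      ((𝔟.1 : Ideal (𝓞 E)) : FractionalIdeal (𝓞 E)⁰ E) * 𝔄 =
        FractionalIdeal.spanSingleton (𝓞 E)⁰ (α 𝔟) := by
  choose α hα using fun 𝔟 : IdealsInClass E (ClassGroup.mk E 𝔄⁻¹) =>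
    (mk_eq_mk_inv_iff 𝔄 𝔟.1).1 𝔟.2
  refine ⟨α, fun 𝔟 => ⟨fun h => ?_, hα 𝔟⟩⟩
  have h1 := hα 𝔟
  rw [h, FractionalIdeal.spanSingleton_zero, mul_eq_zero] at h1
  rcases h1 with h1 | h1
  · exact nonZeroDivisors.ne_zero 𝔟.1.2 (FractionalIdeal.coeIdeal_eq_zero.1 h1)
  · exact 𝔄.ne_zero h1

lemma absNorm_mul_absNorm {𝔄 : (FractionalIdeal (𝓞 E)⁰ E)ˣ} {𝔟 : Ideal (𝓞 E)} {α : E}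
    (h : (𝔟 : FractionalIdeal (𝓞 E)⁰ E) * 𝔄 = FractionalIdeal.spanSingleton (𝓞 E)⁰ α) :
    (Ideal.absNorm 𝔟 : ℚ) * FractionalIdeal.absNorm (𝔄 : FractionalIdeal (𝓞 E)⁰ E) =
      |Algebra.norm ℚ α| := by
  rw [← FractionalIdeal.absNorm_span_singleton (𝓞 E) α, ← h, map_mul,
    FractionalIdeal.coeIdeal_absNorm]

lemma exists_unit_smul_of_span_eq {α β : E} (hα : α ≠ 0)
    (h : FractionalIdeal.spanSingleton (𝓞 E)⁰ α = FractionalIdeal.spanSingleton (𝓞 E)⁰ β) :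
    ∃ u : (𝓞 E)ˣ, β = (u : E) * α := by
  obtain ⟨a, ha⟩ := (FractionalIdeal.mem_spanSingleton (𝓞 E)⁰).1
    (h ▸ FractionalIdeal.mem_spanSingleton_self (𝓞 E)⁰ β :
      β ∈ FractionalIdeal.spanSingleton (𝓞 E)⁰ α)
  obtain ⟨b, hb⟩ := (FractionalIdeal.mem_spanSingleton (𝓞 E)⁰).1
    (h ▸ FractionalIdeal.mem_spanSingleton_self (𝓞 E)⁰ α :
      α ∈ FractionalIdeal.spanSingleton (𝓞 E)⁰ β)
  have hab : a * b = 1 := by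
    apply RingOfIntegers.coe_injective
    have h2 : ((b : E) * a) * α = 1 * α := by
      rw [Algebra.smul_def] at ha hb
      change (a : E) * α = β at ha
      change (b : E) * β = α at hb
      rw [one_mul, mul_assoc, ha, hb]
    have h3 := mul_right_cancel₀ hα h2
    rw [map_mul, mul_comm, map_one]
    exact h3
  refine ⟨Units.mkOfMulEqOne a b hab, ?_⟩
  rw [← ha, Algebra.smul_def]
  rfl

lemma spanSingleton_unit_mul (u : (𝓞 E)ˣ) (α : E) :
    FractionalIdeal.spanSingleton (𝓞 E)⁰ ((u : E) * α) =
      FractionalIdeal.spanSingleton (𝓞 E)⁰ α := by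
  apply le_antisymm <;> rw [FractionalIdeal.spanSingleton_le_iff_mem,
    FractionalIdeal.mem_spanSingleton]
  · exact ⟨(u : 𝓞 E), Algebra.smul_def _ _⟩
  · refine ⟨((u⁻¹ : (𝓞 E)ˣ) : 𝓞 E), ?_⟩
    rw [Algebra.smul_def, ← mul_assoc]
    have : (algebraMap (𝓞 E) E ((u⁻¹ : (𝓞 E)ˣ) : 𝓞 E)) * ((u : 𝓞 E) : E) = 1 := by
      rw [← map_mul, Units.inv_mul, map_one]
    rw [this, one_mul]

end IdealGenerators

/-! ### Nonzero vectors of the lattice modulo units, indexed by ideals and unit classes. -/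

section Orbits

variable {F E : Type*} [Field F] [NumberField F] [Field E] [NumberField E] [Algebra F E] {n : ℕ}

lemma mem_idealLattice {w : Module.Basis (Fin n) F E} {𝔄 : FractionalIdeal (𝓞 E)⁰ E}
    {x : Fin n → F} : x ∈ idealLattice w 𝔄 ↔ w.equivFun.symm x ∈ 𝔄 := Iff.rfl

/-- As `x ≠ 0`, the multiples `c x` determine `c`. The condition `F x ∩ L = 𝔞 x` then says that `𝔞`
is the coefficient ideal of `x`, so `𝔞` is determined by `x`. -/
lemma mem_primitiveVectors {L : Submodule (𝓞 F) (Fin n → F)} {𝔞 : FractionalIdeal (𝓞 F)⁰ F}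
    {x : Fin n → F} : x ∈ primitiveVectors L 𝔞 ↔
      x ∈ L ∧ x ≠ 0 ∧ ∀ c : F, c • x ∈ L ↔ c ∈ 𝔞 := by
  refine and_congr_right fun _ => and_congr_right fun h0 => ?_
  have hinj := smul_left_injective F h0
  rw [Set.ext_iff]
  constructor
  · intro h c
    have := h (c • x)
    constructor
    · intro hc
      obtain ⟨c', hc', h'⟩ := this.1 ⟨⟨c, rfl⟩, hc⟩
      rwa [hinj h']
    · exact fun hc => (this.2 ⟨c, hc, rfl⟩).2
  · intro h y
    constructor
    · rintro ⟨⟨c, rfl⟩, hy⟩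
      exact ⟨c, (h c).1 hy, rfl⟩
    · rintro ⟨c, hc, rfl⟩
      exact ⟨⟨c, rfl⟩, (h c).2 hc⟩

/-- The coefficient ideal `{c ∈ F ∣ c α ∈ 𝔄}` of a nonzero element `α ∈ E`. -/
def coeffIdeal (F : Type*) [Field F] [NumberField F] [Algebra F E]
    (𝔄 : FractionalIdeal (𝓞 E)⁰ E) {α : E} (hα : α ≠ 0) : FractionalIdeal (𝓞 F)⁰ F :=
  ⟨((𝔄 : Submodule (𝓞 E) E).restrictScalars (𝓞 F)).comap
      ((LinearMap.toSpanSingleton F E α).restrictScalars (𝓞 F)), by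
    -- Multiplication by `α` embeds the coefficients in `𝔄`, which is a Noetherian `𝓞_F`-module
    -- because `𝓞_E` is finite over `𝓞_F`.
    refine FractionalIdeal.isFractional_of_fg ?_
    have : IsNoetherian (𝓞 E) (𝔄 : Submodule (𝓞 E) E) := FractionalIdeal.isNoetherian 𝔄
    have h2 : Module.Finite (𝓞 F) (𝔄 : Submodule (𝓞 E) E) :=
      Module.Finite.trans (𝓞 E) (𝔄 : Submodule (𝓞 E) E)
    have h3 : IsNoetherian (𝓞 F) ((𝔄 : Submodule (𝓞 E) E).restrictScalars (𝓞 F)) :=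
      isNoetherian_of_isNoetherianRing_of_finite (𝓞 F) (𝔄 : Submodule (𝓞 E) E)
    rw [← Module.Finite.iff_fg]
    let f : ((𝔄 : Submodule (𝓞 E) E).restrictScalars (𝓞 F)).comap
      ((LinearMap.toSpanSingleton F E α).restrictScalars (𝓞 F)) →ₗ[𝓞 F]
        ((𝔄 : Submodule (𝓞 E) E).restrictScalars (𝓞 F)) :=
      ((LinearMap.toSpanSingleton F E α).restrictScalars (𝓞 F)).restrict fun _ h => h
    have hf : Function.Injective f := fun a b h => by
      refine Subtype.ext (smul_left_injective F hα ?_)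
      exact congrArg Subtype.val h
    have := isNoetherian_of_injective f hf
    infer_instance⟩

lemma mem_coeffIdeal {𝔄 : FractionalIdeal (𝓞 E)⁰ E} {α : E} (hα : α ≠ 0) {c : F} :
    c ∈ coeffIdeal F 𝔄 hα ↔ c • α ∈ 𝔄 := Iff.rfl

lemma exists_primitiveVectors (w : Module.Basis (Fin n) F E) {𝔄 : FractionalIdeal (𝓞 E)⁰ E}
    {x : Fin n → F} (hx : x ∈ idealLattice w 𝔄) (h0 : x ≠ 0) :
    ∃ 𝔞 : AntiIntegral F, x ∈ primitiveVectors (idealLattice w 𝔄)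
      (𝔞.1 : FractionalIdeal (𝓞 F)⁰ F) := by
  have hα : w.equivFun.symm x ≠ 0 := fun h => h0 (w.equivFun.symm.injective (h.trans (map_zero _).symm))
  have h1 : (1 : F) ∈ coeffIdeal F 𝔄 hα := by
    rw [mem_coeffIdeal, one_smul]
    exact hx
  have h2 : coeffIdeal F 𝔄 hα ≠ 0 := fun h => by
    rw [h, FractionalIdeal.mem_zero_iff] at h1
    exact one_ne_zero h1
  refine ⟨⟨Units.mk0 _ h2, h1⟩, mem_primitiveVectors.2 ⟨hx, h0, fun c => ?_⟩⟩
  rw [mem_idealLattice, map_smul]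
  rfl

/-- Coefficient ideals do not change under units of `F`, so the orbit sets for different `𝔞` are
disjoint. Together with `range_primitiveOrbits` this turns the sum over `𝔞` and orbits into one over
the nonzero orbits of `L`. -/
lemma primitiveOrbits_injective (L : Submodule (𝓞 F) (Fin n → F)) :
    Function.Injective (fun p : Σ 𝔞 : AntiIntegral F,
      primitiveOrbits L (𝔞.1 : FractionalIdeal (𝓞 F)⁰ F) => (p.2 : UnitOrbits F n)) := by
  rintro ⟨𝔞, o, x, hx, rfl⟩ ⟨𝔟, o', y, hy, rfl⟩ h
  have h : (Quotient.mk'' x : UnitOrbits F n) = Quotient.mk'' y := h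
  obtain ⟨u, rfl⟩ := MulAction.orbitRel_apply.1 (Quotient.eq''.1 h)
  have hu : ∀ (v : (𝓞 F)ˣ) z, z ∈ L → v • z ∈ L := fun v z hz =>
    L.smul_mem (v : 𝓞 F) hz
  have key : 𝔞 = 𝔟 := by
    apply Subtype.ext
    apply Units.ext
    ext c
    rw [← (mem_primitiveVectors.1 hx).2.2 c, ← (mem_primitiveVectors.1 hy).2.2 c]
    constructor
    · intro h
      have := hu u⁻¹ _ h
      rwa [smul_comm, inv_smul_smul] at this
    · intro h
      rw [smul_comm]
      exact hu u _ h
  subst key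
  congr 1
  exact Subtype.ext h

lemma range_primitiveOrbits (w : Module.Basis (Fin n) F E) (𝔄 : FractionalIdeal (𝓞 E)⁰ E) :
    Set.range (fun p : Σ 𝔞 : AntiIntegral F, primitiveOrbits (idealLattice w 𝔄)
      (𝔞.1 : FractionalIdeal (𝓞 F)⁰ F) => (p.2 : UnitOrbits F n)) =
      Quotient.mk'' '' {x | x ∈ idealLattice w 𝔄 ∧ x ≠ 0} := by
  ext o
  constructor
  · rintro ⟨⟨𝔞, _, x, hx, rfl⟩, rfl⟩
    exact ⟨x, ⟨hx.1, hx.2.1⟩, rfl⟩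
  · rintro ⟨x, ⟨hx, h0⟩, rfl⟩
    obtain ⟨𝔞, h𝔞⟩ := exists_primitiveVectors w hx h0
    exact ⟨⟨𝔞, _, x, h𝔞, rfl⟩, rfl⟩

lemma equivFun_unitIncl_mul (w : Module.Basis (Fin n) F E) (v : (𝓞 F)ˣ) (β : E) :
    w.equivFun (((unitIncl F E v : (𝓞 E)ˣ) : E) * β) = v • w.equivFun β := by
  have : ((unitIncl F E v : (𝓞 E)ˣ) : E) * β = ((v : 𝓞 F) : F) • β := by
    rw [Algebra.smul_def]
    rfl
  rw [this, map_smul]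
  rfl

lemma mk_equivFun_eq_iff (w : Module.Basis (Fin n) F E) {α β : E} :
    (Quotient.mk'' (w.equivFun α) : UnitOrbits F n) = Quotient.mk'' (w.equivFun β) ↔
      ∃ v : (𝓞 F)ˣ, ((unitIncl F E v : (𝓞 E)ˣ) : E) * β = α := by
  rw [Quotient.eq'', MulAction.orbitRel_apply]
  refine exists_congr fun v => ?_
  rw [← w.equivFun.injective.eq_iff, equivFun_unitIncl_mul]

/-- The sum over the primitive vectors up to units of `F`, rearranged as a sum over the ideals in
the class of `𝔄⁻¹` and over `𝓞_E^× / 𝓞_F^×`. -/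
theorem exists_orbit_equiv (w : Module.Basis (Fin n) F E) (𝔄 : (FractionalIdeal (𝓞 E)⁰ E)ˣ)
    {α : IdealsInClass E (ClassGroup.mk E 𝔄⁻¹) → E} (hα : ∀ 𝔟, α 𝔟 ≠ 0 ∧
      ((𝔟.1 : Ideal (𝓞 E)) : FractionalIdeal (𝓞 E)⁰ E) * 𝔄 =
        FractionalIdeal.spanSingleton (𝓞 E)⁰ (α 𝔟)) :
    ∃ e : (Σ _ : IdealsInClass E (ClassGroup.mk E 𝔄⁻¹), UnitQuot F E) ≃
      (Σ 𝔞 : AntiIntegral F, primitiveOrbits (idealLattice w (𝔄 : FractionalIdeal (𝓞 E)⁰ E))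
          (𝔞.1 : FractionalIdeal (𝓞 F)⁰ F)),
      ∀ p, ((e p).2 : UnitOrbits F n) =
        Quotient.mk'' (w.equivFun (((Quotient.out p.2 : (𝓞 E)ˣ) : E) * α p.1)) := by
  let g : (Σ _ : IdealsInClass E (ClassGroup.mk E 𝔄⁻¹), UnitQuot F E) → UnitOrbits F n := fun p =>
    Quotient.mk'' (w.equivFun (((Quotient.out p.2 : (𝓞 E)ˣ) : E) * α p.1))
  have hg : Function.Injective g := by
    rintro ⟨𝔟, q⟩ ⟨𝔟', q'⟩ h
    obtain ⟨v, hv⟩ := (mk_equivFun_eq_iff w).1 h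
    -- Equal orbits give associate elements of `E`, hence the same principal ideal `𝔟 𝔄`; then `𝔄`
    -- is cancelled.
    have h1 : 𝔟 = 𝔟' := by
      apply Subtype.ext
      apply Subtype.ext
      apply FractionalIdeal.coeIdeal_injective (K := E)
      apply (Units.mul_left_inj 𝔄).1
      rw [(hα 𝔟).2, (hα 𝔟').2, ← spanSingleton_unit_mul (Quotient.out q), ← hv,
        spanSingleton_unit_mul, spanSingleton_unit_mul]
    subst h1
    congr 1
    rw [← mul_assoc] at hv
    have h2 := mul_right_cancel₀ (hα 𝔟).1 hv
    have h3 : unitIncl F E v * Quotient.out q' = Quotient.out q := by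
      apply Units.ext
      apply RingOfIntegers.coe_injective
      rw [Units.val_mul, map_mul]
      exact h2
    rw [← QuotientGroup.out_eq' q, ← QuotientGroup.out_eq' q', eq_comm, QuotientGroup.eq]
    exact ⟨v, by rw [← h3, mul_comm (unitIncl F E v), inv_mul_cancel_left]⟩
  have hr : Set.range g =
      Quotient.mk'' '' {x | x ∈ idealLattice w (𝔄 : FractionalIdeal (𝓞 E)⁰ E) ∧ x ≠ 0} := by
    ext o
    constructor
    · rintro ⟨⟨𝔟, q⟩, rfl⟩
      refine ⟨_, ⟨?_, ?_⟩, rfl⟩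
      · rw [mem_idealLattice, LinearEquiv.symm_apply_apply,
          ← FractionalIdeal.spanSingleton_le_iff_mem, spanSingleton_unit_mul, ← (hα 𝔟).2]
        exact mul_le_of_le_one_left' FractionalIdeal.coeIdeal_le_one
      · rw [Ne, LinearEquiv.map_eq_zero_iff, mul_eq_zero, not_or]
        exact ⟨by simp, (hα 𝔟).1⟩
    · rintro ⟨x, ⟨hx, h0⟩, rfl⟩
      obtain ⟨β, rfl⟩ := w.equivFun.surjective x
      rw [mem_idealLattice, LinearEquiv.symm_apply_apply] at hx
      have hβ : β ≠ 0 := fun h => h0 (by rw [h, map_zero])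
      -- The ideal `β 𝔄⁻¹` is integral precisely because `β ∈ 𝔄`; `β` and the chosen generator for
      -- this ideal differ by a unit of `E`.
      obtain ⟨I, hI⟩ := FractionalIdeal.le_one_iff_exists_coeIdeal.1
        (show FractionalIdeal.spanSingleton (𝓞 E)⁰ β * ((𝔄⁻¹ : (FractionalIdeal (𝓞 E)⁰ E)ˣ) :
          FractionalIdeal (𝓞 E)⁰ E) ≤ 1 by
          rw [← Units.mul_inv 𝔄]
          exact mul_le_mul_left (FractionalIdeal.spanSingleton_le_iff_mem.2 hx) _)
      have hI' : (I : FractionalIdeal (𝓞 E)⁰ E) * 𝔄 =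
          FractionalIdeal.spanSingleton (𝓞 E)⁰ β := by
        rw [hI, mul_assoc, Units.inv_mul, mul_one]
      have hI0 : I ≠ 0 := fun h => by
        rw [h] at hI'
        have h5 : FractionalIdeal.spanSingleton (𝓞 E)⁰ β = 0 := by rw [← hI']; simp
        exact hβ (FractionalIdeal.spanSingleton_eq_zero_iff.1 h5)
      let 𝔟 : IdealsInClass E (ClassGroup.mk E 𝔄⁻¹) :=
        ⟨⟨I, mem_nonZeroDivisors_of_ne_zero hI0⟩, (mk_eq_mk_inv_iff 𝔄 _).2 ⟨β, hI'⟩⟩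
      obtain ⟨u, hu⟩ := exists_unit_smul_of_span_eq (hα 𝔟).1 ((hα 𝔟).2.symm.trans hI')
      refine ⟨⟨𝔟, (u : UnitQuot F E)⟩, (mk_equivFun_eq_iff w).2 ?_⟩
      obtain ⟨⟨_, v, rfl⟩, hv⟩ := QuotientGroup.mk_out_eq_mul (unitIncl F E).range u
      refine ⟨v, ?_⟩
      have : ((Quotient.out (u : UnitQuot F E) : (𝓞 E)ˣ) : E) = u * (unitIncl F E v : (𝓞 E)ˣ) := by
        rw [hv, Units.val_mul, map_mul]
      rw [hu]
      change _ = ((Quotient.out (u : UnitQuot F E) : (𝓞 E)ˣ) : E) * α 𝔟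
      rw [this]
      ring
  refine ⟨(Equiv.ofInjective g hg).trans ((Equiv.setCongr
    (hr.trans (range_primitiveOrbits w (𝔄 : FractionalIdeal (𝓞 E)⁰ E)).symm)).trans
    (Equiv.ofInjective _ (primitiveOrbits_injective _)).symm), fun p => ?_⟩
  exact Equiv.apply_ofInjective_symm (primitiveOrbits_injective
    (idealLattice w (𝔄 : FractionalIdeal (𝓞 E)⁰ E))) _

lemma countable_idealsInClass (𝔄 : (FractionalIdeal (𝓞 E)⁰ E)ˣ) :
    Countable (IdealsInClass E (ClassGroup.mk E 𝔄⁻¹)) := by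
  obtain ⟨α, hα⟩ := exists_generator 𝔄
  refine Function.Injective.countable (f := α) fun 𝔟 𝔟' h => ?_
  apply Subtype.ext
  apply Subtype.ext
  apply FractionalIdeal.coeIdeal_injective (K := E)
  apply (Units.mul_left_inj 𝔄).1
  rw [(hα 𝔟).2, (hα 𝔟').2, h]

end Orbits


/-! ### The terms of the Eisenstein series at theEgner points of the torus. -/

section HeegnerTerm

variable {F E : Type*} [Field F] [NumberField F] [Field E] [NumberField E] [Algebra F E] {n : ℕ}

variable (E) in
/-- The absolute values `(|τ(α)|)_τ ∈ T_E` of `α ∈ E^×`. -/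
def absTorus : Eˣ →* Torus E where
  toFun α := fun τ => ⟨τ (α : E), pos_iff.mpr α.ne_zero⟩
  map_one' := by
    funext τ; ext; simp
  map_mul' α β := by
    funext τ; ext; simp

lemma torusVol_absTorus (α : Eˣ) : (torusVol E (absTorus E α) : ℝ) = |Algebra.norm ℚ (α : E)| := by
  rw [← prod_eq_abs_norm, torusVol_apply]
  change posVal _ = _
  rw [map_prod]
  rfl

lemma sum_norm_coordC_sq (D : LocalChoice F E n) (σ : InfinitePlace F) (τ : InfinitePlace E)
    (h0 : σ.inertiaDeg τ ≠ 0) (z : E) :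
    ∑ j, ‖coordC σ (σ.inertiaDeg τ) (D.emb τ z) j‖ ^ 2 = τ z ^ 2 := by
  have hz : τ z = ‖D.emb τ z‖ := by
    conv_lhs => rw [← D.mk_emb τ]
    rfl
  rw [hz]
  rcases local_cases D σ τ with h | ⟨h, h1, h2⟩ | ⟨h, h1, h2⟩ | ⟨h, h1, h2⟩
  · exact absurd h h0
  · rw [h, Fin.sum_univ_two, ← Complex.normSq_eq_norm_sq (D.emb τ z), Complex.normSq_apply]
    simp [coordC, localCoord, ext_ofComplex_of_real h1]
    ring
  · rw [h, Fin.sum_univ_one]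
    have : D.emb τ z = ((D.emb τ z).re : ℂ) := by
      apply Complex.ext <;> simp [h2]
    rw [coordC, localCoord, if_neg (by simp), ext_ofComplex_of_real h1, ← this]
  · rw [h, Fin.sum_univ_one, coordC, localCoord, if_neg (by simp), ext_ofComplex_of_not_real h1]

lemma norm_ofComplex_ofReal (σ : InfinitePlace F) (c : {x : ℝ // 0 < x}) :
    ‖ofComplex σ ((c : ℝ) : ℂ)‖ = c := by
  rw [← norm_extensionEmbedding, ext_ofComplex_ofReal, Complex.norm_real, Real.norm_eq_abs,
    abs_of_pos c.2]

lemma ext_rowMul_basisGL (w : Module.Basis (Fin n) F E) (D : LocalChoice F E n) (α : E)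
    (σ : InfinitePlace F) (τ : InfinitePlace E) (j : Fin (σ.inertiaDeg τ)) :
    Completion.extensionEmbedding σ (rowMul (w.equivFun α) (basisGL w D) σ (D.ord σ ⟨τ, j⟩)) =
      coordC σ _ (D.emb τ α) j := by
  rw [rowMul, Matrix.vecMul, dotProduct, map_sum]
  conv_rhs => rw [← w.sum_equivFun α, coordC_sum]
  refine Finset.sum_congr rfl fun i _ => ?_
  rw [map_mul, Algebra.smul_def, coordC_algebraMap_mul]
  congr 1
  · exact Completion.extensionEmbedding_coe σ (WithAbs.toAbs _ _)
  · change Completion.extensionEmbedding σ (basisMatrix w D σ i (D.ord σ ⟨τ, j⟩)) = _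
    rw [basisMatrix, Matrix.submatrix_apply, Equiv.symm_apply_apply]
    rfl

/-- The entries of `x W I(t)` at `σ` are the local coordinates of `α`, those at `τ` being scaled by
`t_τ`. By `sum_norm_coordC_sq` the coordinates at each `τ ∣ σ` have squared length `(|τ(α)| t_τ)²`.
-/
lemma vecNorm_heegner (w : Module.Basis (Fin n) F E) (D : LocalChoice F E n) (α : Eˣ)
    (t : Torus E) (σ : InfinitePlace F) :
    vecNorm (rowMul (w.equivFun (α : E)) (basisGL w D * torusGL D t) σ) =
      fiberLen F E (absTorus E α * t) σ := by
  classical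
  change Real.sqrt _ = Real.sqrt _
  congr 1
  have h1 : rowMul (w.equivFun (α : E)) (basisGL w D * torusGL D t) σ =
      rowMul (w.equivFun (α : E)) (basisGL w D) σ ᵥ* (torusGL D t σ : Matrix _ _ σ.Completion) := by
    rw [rowMul, rowMul, Matrix.vecMul_vecMul]
    rfl
  rw [h1, ← (D.ord σ).sum_comp, Fintype.sum_sigma, Finset.sum_filter]
  refine Finset.sum_congr rfl fun τ _ => ?_
  have h2 : ∀ j : Fin (σ.inertiaDeg τ), ‖(rowMul (w.equivFun (α : E)) (basisGL w D) σ ᵥ*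
      (torusGL D t σ : Matrix _ _ σ.Completion)) (D.ord σ ⟨τ, j⟩)‖ ^ 2 =
      ‖coordC σ _ (D.emb τ α) j‖ ^ 2 * (t τ : ℝ) ^ 2 := by
    intro j
    change ‖(_ ᵥ* Matrix.diagonal _) _‖ ^ 2 = _
    rw [Matrix.vecMul_diagonal, norm_mul, mul_pow, Equiv.symm_apply_apply, norm_ofComplex_ofReal,
      ← ext_rowMul_basisGL, norm_extensionEmbedding]
  simp only [h2]
  rw [← Finset.sum_mul]
  split_ifs with h
  · have h3 : σ.inertiaDeg τ ≠ 0 := by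
      subst h
      exact inertiaDeg_comap_ne_zero τ
    rw [sum_norm_coordC_sq D σ τ h3, ← mul_pow]
    rfl
  · have h3 : σ.inertiaDeg τ = 0 := by
      by_contra h3
      exact h (comap_eq_of_inertiaDeg_ne_zero F E h3)
    have : IsEmpty (Fin (σ.inertiaDeg τ)) := by rw [h3]; infer_instance
    rw [Finset.univ_eq_empty, Finset.sum_empty, zero_mul]

/-- The entry `t_τ` occurs `[E_τ : F_σ]` times on the diagonal, so the determinant is the
`σ`-component of the norm of `t`. -/
lemma norm_det_torusGL (D : LocalChoice F E n) (t : relTorus F E) (σ : InfinitePlace F) :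
    ‖(torusGL D (t : Torus E) σ : Matrix (Fin n) (Fin n) σ.Completion).det‖ = 1 := by
  change ‖(Matrix.diagonal _).det‖ = 1
  rw [Matrix.det_diagonal, norm_prod]
  simp only [norm_ofComplex_ofReal]
  rw [← (D.ord σ).prod_comp, Fintype.prod_sigma]
  have h : torusNorm F E (t : Torus E) σ = 1 := by
    rw [torusNorm_coe]; rfl
  rw [torusNorm_apply] at h
  have h1 := congrArg posVal h
  rw [map_prod, map_one] at h1
  rw [← h1]
  refine Finset.prod_congr rfl fun τ _ => ?_
  simp only [Equiv.symm_apply_apply]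
  rw [Finset.prod_const, Finset.card_univ, Fintype.card_fin, map_pow]
  rfl

/-- The positive square root `∏_σ |det W_σ|^{n_σ}` of `|Δ_w|`. -/
def sqrtDelta (w : Module.Basis (Fin n) F E) (D : LocalChoice F E n) : {x : ℝ // 0 < x} :=
  ⟨∏ σ : InfinitePlace F, ‖(basisMatrix w D σ).det‖ ^ σ.mult,
    Finset.prod_pos fun σ _ => pow_pos (norm_pos_iff.2 (basisMatrix_det_ne_zero w D σ)) _⟩

lemma absDelta_eq (w : Module.Basis (Fin n) F E) (D : LocalChoice F E n) :
    absDelta w D = (sqrtDelta w D : ℝ) ^ 2 := by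
  change _ = (∏ σ : InfinitePlace F, ‖(basisMatrix w D σ).det‖ ^ σ.mult) ^ 2
  rw [absDelta, ← Finset.prod_pow]
  refine Finset.prod_congr rfl fun σ _ => ?_
  rw [norm_pow, ← pow_mul, ← pow_mul, mul_comm]

lemma absDelta_cpow (w : Module.Basis (Fin n) F E) (D : LocalChoice F E n) (s : ℂ) :
    (absDelta w D : ℂ) ^ (s / 2) = posCpow s (sqrtDelta w D) := by
  have h := posCpow_pow (s / 2) (sqrtDelta w D) 2
  rw [show ((2 : ℕ) : ℂ) * (s / 2) = s by push_cast; ring] at h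
  rw [← h, posCpow_apply, absDelta_eq]
  rfl

/-- The terms of the Eisenstein series at the Heegner object. -/
lemma detOrbit_heegner (w : Module.Basis (Fin n) F E) (D : LocalChoice F E n) (α : Eˣ)
    (t : relTorus F E) :
    detOrbit (Quotient.mk'' (w.equivFun (α : E))) (heegner w D t) =
      (sqrtDelta w D * relKernel F E (absTorus E α * t) : {x : ℝ // 0 < x}) := by
  have hn : Module.finrank F E = n := by
    rw [Module.finrank_eq_card_basis w, Fintype.card_fin]
  change detTerm (w.equivFun (α : E)) (basisGL w D * torusGL D (t : Torus E)) =
    (∏ σ : InfinitePlace F, ‖(basisMatrix w D σ).det‖ ^ σ.mult) *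
      (posVal (torusVol F (fiberLen F E (absTorus E α * t)) ^ Module.finrank F E))⁻¹
  rw [map_pow, torusVol_apply, map_prod, ← Finset.prod_pow, ← Finset.prod_inv_distrib,
    ← Finset.prod_mul_distrib, detTerm]
  refine Finset.prod_congr rfl fun σ _ => ?_
  rw [vecNorm_heegner, Pi.mul_apply, Units.val_mul, Matrix.det_mul, norm_mul, norm_det_torusGL,
    mul_one, div_eq_mul_inv, map_pow, ← pow_mul, hn, mul_comm σ.mult n]
  rfl

/-- By homogeneity, the component of `u` along `T_F` contributes only its volume, raised to the
degree; that power is the volume of `u` itself. -/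
lemma relKernel_eq (u : Torus E) :
    relKernel F E u = relKernel F E (torusProj F E u : Torus E) * (torusVol E u)⁻¹ := by
  have hu : u = (torusProj F E u : Torus E) *
      fiberIncl F E (torusRoot (Module.finrank F E) (torusNorm F E u)) := by
    rw [coe_torusProj, inv_mul_cancel_right]
  conv_lhs => rw [hu, relKernel_mul_fiberIncl]
  rw [← map_pow, pow_torusRoot Module.finrank_pos.ne', torusVol_torusNorm]

/-- Units and elements of `T_{E/F}` have volume `1`, so only `α` contributes to the scalar, by `|N
α|⁻¹`. The rest depends on the unit through its class alone, since the projection kills `𝓞_F^×`. -/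
lemma detOrbit_heegner_unit_mul (w : Module.Basis (Fin n) F E) (D : LocalChoice F E n) (α : Eˣ)
    (q : UnitQuot F E) (t : relTorus F E) :
    detOrbit (Quotient.mk'' (w.equivFun (((Quotient.out q : (𝓞 E)ˣ) : E) * α))) (heegner w D t) =
      (sqrtDelta w D * (torusVol E (absTorus E α))⁻¹ *
        relKernel F E (unitProj F E q * (torusProj F E (absTorus E α) * t) : relTorus F E) :
          {x : ℝ // 0 < x}) := by
  let u : (𝓞 E)ˣ := Quotient.out q
  have h := detOrbit_heegner w D (Units.map (algebraMap (𝓞 E) E).toMonoidHom u * α) t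
  refine h.trans ?_
  have h1 : absTorus E (Units.map (algebraMap (𝓞 E) E).toMonoidHom u) = regMap E u := rfl
  have h2 : torusVol E (regMap E u) = 1 := torusVol_coe ℚ E (relRegMap E u)
  have h3 : unitProj F E q = torusProjHom F E (regMap E u) := by
    conv_lhs => rw [← QuotientGroup.out_eq' q]
    rfl
  have h4 : torusProjHom F E (regMap E u * absTorus E α * t) =
      unitProj F E q * (torusProj F E (absTorus E α) * t) := by
    rw [map_mul, map_mul, h3, torusProjHom_apply F E (t : Torus E), torusProj_coe, mul_assoc]
    rfl
  rw [relKernel_eq, ← torusProjHom_apply, map_mul (absTorus E), h1, h4, map_mul, map_mul, h2,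
    torusVol_coe, one_mul, mul_one, mul_assoc, mul_comm (torusVol E _)⁻¹]

end HeegnerTerm


/-! ### Measurability and integrability of series of functions. -/

section SeriesOfFunctions

lemma measurable_tsum_of_summable {X ι : Type*} [MeasurableSpace X] [Countable ι] {f : ι → X → ℂ}
    (hf : ∀ i, Measurable (f i)) (hs : ∀ x, Summable fun i => f i x) :
    Measurable fun x => ∑' i, f i x := by
  refine measurable_of_tendsto_metrizable' Filter.atTop
    (fun S : Finset ι => Finset.measurable_sum S fun i _ => hf i) (tendsto_pi_nhds.2 fun x => ?_)
  simpa [HasSum] using (hs x).hasSum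

lemma integrable_tsum_of_summable {X ι : Type*} [MeasurableSpace X] [Countable ι] {μ : Measure X}
    {f : ι → X → ℂ} (hf : ∀ i, Measurable (f i)) (hs : ∀ x, Summable fun i => f i x)
    (h : ∑' i, ∫⁻ x, ‖f i x‖ₑ ∂μ ≠ ⊤) : Integrable (fun x => ∑' i, f i x) μ := by
  refine ⟨(measurable_tsum_of_summable hf hs).aestronglyMeasurable, ?_⟩
  refine lt_of_le_of_lt (lintegral_mono fun x => enorm_tsum_le_tsum_enorm) ?_
  rw [lintegral_tsum fun i => (hf i).enorm.aemeasurable]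
  exact h.lt_top

lemma summable_integral_of_lintegral {X ι : Type*} [MeasurableSpace X] {μ : Measure X}
    {f : ι → X → ℂ} (h : ∑' i, ∫⁻ x, ‖f i x‖ₑ ∂μ ≠ ⊤) : Summable fun i => ∫ x, f i x ∂μ := by
  refine Summable.of_enorm ?_
  exact ne_top_of_le_ne_top h (ENNReal.tsum_le_tsum fun i => enorm_integral_le_lintegral_enorm _)

lemma tsum_enorm_ne_top {ι : Type*} {f : ι → ℂ} (h : Summable f) : ∑' i, ‖f i‖ₑ ≠ ⊤ :=
  by
  have h1 := (summable_norm_iff.2 h)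
  exact ENNReal.tsum_coe_ne_top_iff_summable.2 (NNReal.summable_coe.1 h1)

end SeriesOfFunctions

/-! ### Comparison of the kernel at two points. -/

section Comparison

variable {F E : Type*} [Field F] [NumberField F] [Field E] [NumberField E] [Algebra F E]

lemma relKernel_antitone {a b : Torus E} (h : a ≤ b) : relKernel F E b ≤ relKernel F E a := by
  classical
  have h1 : fiberLen F E a ≤ fiberLen F E b := fun σ =>
    Real.sqrt_le_sqrt (Finset.sum_le_sum fun τ _ => pow_le_pow_left₀ (a τ).2.le (h τ) 2)
  refine inv_le_inv' (pow_le_pow_left' ?_ _)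
  rw [torusVol_apply, torusVol_apply]
  exact Finset.prod_le_prod' fun σ _ => pow_le_pow_left' (h1 σ) _

/-- The values of the kernel on two translates are comparable. -/
lemma exists_norm_posCpow_relKernel_le {s : ℂ} (hs : 0 ≤ s.re) (t t₀ : relTorus F E) :
    ∃ K : ℝ, ∀ x : relTorus F E, ‖posCpow s (relKernel F E (x * t : relTorus F E))‖ ≤
      K * ‖posCpow s (relKernel F E (x * t₀ : relTorus F E))‖ := by
  -- `m` is a positive lower bound of the finitely many ratios `t_τ / t₀_τ`. The kernel decreases in
  -- each coordinate and is homogeneous, so a bound uniform in `x` follows.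
  obtain ⟨m, hm⟩ : ∃ m : {x : ℝ // 0 < x},
      (t₀ : Torus E) * fiberIncl F E (fun _ => m) ≤ (t : Torus E) := by
    obtain ⟨m, hm⟩ := (Set.finite_range ((t : Torus E) * (t₀ : Torus E)⁻¹)).bddBelow
    refine ⟨m, fun τ => ?_⟩
    have h := hm ⟨τ, rfl⟩
    have h2 := mul_le_mul_right h ((t₀ : Torus E) τ)
    refine le_of_le_of_eq h2 ?_
    simp
  refine ⟨‖posCpow s ((torusVol F (fun _ => m) ^ Module.finrank F E)⁻¹)‖, fun x => ?_⟩
  have h1 : relKernel F E (x * t : relTorus F E) ≤ (torusVol F (fun _ => m) ^ Module.finrank F E)⁻¹ *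
      relKernel F E (x * t₀ : relTorus F E) := by
    rw [mul_comm _ (relKernel F E _), ← relKernel_mul_fiberIncl]
    apply relKernel_antitone
    rw [Subgroup.coe_mul, Subgroup.coe_mul, mul_assoc]
    exact mul_le_mul_right hm _
  rw [← norm_mul, ← map_mul, norm_posCpow, norm_posCpow]
  exact Real.rpow_le_rpow (relKernel F E _).2.le h1 hs

end Comparison

/-! ### The constant `c_{E/F}(s)`. -/

section Constant

variable (F E : Type*) [Field F] [NumberField F] [Field E] [NumberField E] [Algebra F E]

lemma regulator_eq {k : Type*} [Field k] [NumberField k] {D : Set (relTorus ℚ k)}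
    (hD : IsStrictDomain (unitLattice k) D) : regulator k = (relHaar ℚ k D).toReal :=
  quotientMeasure_real_univ hD

/-- An infinite volume would have real value `0`, so finiteness is needed as well as positivity. The
former comes from the compact set that meets every orbit, the latter from the translates of the
domain covering the group. -/
lemma regulator_ne_zero {k : Type*} [Field k] [NumberField k] : regulator k ≠ 0 := by
  obtain ⟨D, hD⟩ := exists_isStrictDomain_unitLattice k
  obtain ⟨K, hK, hK'⟩ := exists_isCompact_unitLattice (k := k)
  rw [regulator_eq hD]
  refine ENNReal.toReal_ne_zero.2 ⟨hD.measure_ne_zero (NeZero.ne _), ?_⟩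
  exact ne_top_of_le_ne_top hK.measure_ne_top (hD.measure_le hK.measurableSet hK')

/-- The number of times that `𝓞_E^× / 𝓞_F^×` covers a fundamental domain of `U_{E/F}`, and its
relation with the constant `c_{E/F}`. -/
theorem exists_cFactor_eq {s : ℂ} (hs : 0 < s.re) {D : Set (relTorus F E)}
    (hD : IsStrictDomain (relUnitLattice F E) D) : ∃ C : ℝ≥0∞, C ≠ ⊤ ∧
      (∀ x, ∑' q, D.indicator (1 : relTorus F E → ℝ≥0∞) (unitProj F E q * x) = C) ∧
      (C.toReal : ℂ) * relGamma F E s = cFactor F E s := by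
  obtain ⟨DF, hDF⟩ := exists_isStrictDomain_unitLattice F
  obtain ⟨DE, hDE⟩ := exists_isStrictDomain_unitLattice E
  obtain ⟨C, hC, hC', h⟩ := exists_unit_index F E hD hDF hDE
  refine ⟨C, hC, hC', ?_⟩
  -- `ENNReal.toReal` is multiplicative without finiteness conditions, so no separate bound on
  -- `R_{E/F}` is required.
  have h1 := congrArg (fun x => ((ENNReal.toReal x : ℝ) : ℂ)) h
  simp only [ENNReal.toReal_mul, ENNReal.toReal_natCast, ENNReal.toReal_pow, ← regulator_eq hDE,
    ← regulator_eq hDF] at h1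
  have h2 : relRegulator F E = (relHaar F E D).toReal := quotientMeasure_real_univ hD
  rw [← h2] at h1
  push_cast at h1
  obtain ⟨h3, h4⟩ := relGamma_tower F E hs
  rw [cFactor, h4]
  have hE : (regulator E : ℂ) ≠ 0 := Complex.ofReal_ne_zero.2 regulator_ne_zero
  have hF : (regulator F : ℂ) ≠ 0 := Complex.ofReal_ne_zero.2 regulator_ne_zero
  have hw : (Units.torsionOrder F : ℂ) ≠ 0 := by exact_mod_cast (Units.torsionOrder_ne_zero F)
  field_simp
  -- The factor `n^(r-1)` from the gamma factors is the one in the index relation `h1`, and both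
  -- disappear.
  linear_combination (relGamma F E s) * h1

end Constant

/-! ### The Eisenstein series as a single sum. -/

section Eisenstein

variable {F : Type*} [Field F] [NumberField F] {n : ℕ}

lemma tsum_eq_sum_tsum_fiber {X Y : Type*} [Fintype Y] (f : X → Y) {g : X → ℂ} (hg : Summable g) :
    ∑' x, g x = ∑ y, ∑' x : {x // f x = y}, g x := by
  rw [← (Equiv.sigmaFiberEquiv f).tsum_eq]
  refine (Summable.tsum_sigma (f := g ∘ Equiv.sigmaFiberEquiv f)
    ((Equiv.summable_iff _).2 hg)).trans ?_
  rw [tsum_fintype]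
  rfl

/-- Absolute convergence permits the regrouping by ideals and then by the finitely many classes; the
iterated sums alone would not exclude default values of `tsum`. -/
lemma eisenstein_eq_tsum (L : Submodule (𝓞 F) (Fin n → F)) (s : ℂ) (z : UpperHalf F n)
    (h : Summable fun p : Σ 𝔞 : AntiIntegral F,
      primitiveOrbits L (𝔞.1 : FractionalIdeal (𝓞 F)⁰ F) =>
        (detOrbit (p.2 : UnitOrbits F n) z : ℂ) ^ s) :
    eisenstein L s z = ∑' p : Σ 𝔞 : AntiIntegral F,
      primitiveOrbits L (𝔞.1 : FractionalIdeal (𝓞 F)⁰ F),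
        (detOrbit (p.2 : UnitOrbits F n) z : ℂ) ^ s := by
  rw [h.tsum_sigma]
  have h1 : Summable fun 𝔞 : AntiIntegral F =>
    eisensteinIdeal L (𝔞.1 : FractionalIdeal (𝓞 F)⁰ F) s z := h.sigma
  change _ = ∑' 𝔞 : AntiIntegral F, eisensteinIdeal L (𝔞.1 : FractionalIdeal (𝓞 F)⁰ F) s z
  rw [tsum_eq_sum_tsum_fiber (fun 𝔞 : AntiIntegral F => ClassGroup.mk F 𝔞.1) h1]
  rfl

end Eisenstein


/-! ### Unfolding of the Eisenstein series on the torus. -/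

section TorusIntegral

variable {F E : Type*} [Field F] [NumberField F] [Field E] [NumberField E] [Algebra F E] {n : ℕ}

variable {ι : Type*} {c : ι → {x : ℝ // 0 < x}} {p : ι → relTorus F E}

/-- The term of index `(i, q)` of an Eisenstein series along `T_{E/F}`. -/
def torusTerm (s : ℂ) (c : ι → {x : ℝ // 0 < x}) (p : ι → relTorus F E)
    (x : Σ _ : ι, UnitQuot F E) (t : relTorus F E) : ℂ :=
  posCpow s (c x.1 * relKernel F E (unitProj F E x.2 * (p x.1 * t) : relTorus F E))

lemma torusTerm_eq (s : ℂ) (x : Σ _ : ι, UnitQuot F E) (t : relTorus F E) :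
    torusTerm s c p x t = posCpow s (c x.1) *
      posCpow s (relKernel F E (p x.1 * (unitProj F E x.2 * t) : relTorus F E)) := by
  rw [torusTerm, map_mul, mul_left_comm]

lemma continuous_posCpow_relKernel (s : ℂ) :
    Continuous fun t : relTorus F E => posCpow s (relKernel F E t) :=
  (continuous_posCpow s).comp ((continuous_relKernel F E).comp continuous_subtype_val)

lemma continuous_torusTerm (s : ℂ) (x : Σ _ : ι, UnitQuot F E) :
    Continuous (torusTerm (F := F) (E := E) s c p x) := by
  have h := (continuous_posCpow_relKernel (F := F) (E := E) s).comp
    ((continuous_const_mul (p x.1)).comp (continuous_const_mul (unitProj F E x.2)))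
  simp only [funext (torusTerm_eq (c := c) (p := p) s x)]
  exact continuous_const.mul h

variable {D : Set (relTorus F E)} {C : ℝ≥0∞}

/-- Unfolding absolute values evaluates the total as `∑ |c_i^s|` times `C` times the integral of
`|κ^s|`; the shifts `p i` vanish by invariance. Each factor is finite. -/
lemma lintegral_torusTerm_ne_top {s : ℂ} (hs : 0 < s.re) (hc : Summable fun i => posCpow s (c i))
    (hD : MeasurableSet D)
    (hC : ∀ x, ∑' q, D.indicator (1 : relTorus F E → ℝ≥0∞) (unitProj F E q * x) = C)
    (hC1 : C ≠ ⊤) :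
    ∑' x, ∫⁻ t in D, ‖torusTerm s c p x t‖ₑ ∂(relHaar F E) ≠ ⊤ := by
  have hm : Measurable fun t : relTorus F E => ‖posCpow s (relKernel F E t)‖ₑ :=
    (continuous_posCpow_relKernel s).measurable.enorm
  have h1 : ∀ i, ∑' q, ∫⁻ t in D, ‖torusTerm s c p ⟨i, q⟩ t‖ₑ ∂(relHaar F E) =
      ‖posCpow s (c i)‖ₑ *
        (C * ∫⁻ t : relTorus F E, ‖posCpow s (relKernel F E t)‖ₑ ∂(relHaar F E)) := by
    intro i
    have h2 := tsum_setLIntegral_translate (ν := relHaar F E) hD hC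
      (hm.comp (measurable_const_mul (p i)))
    have h3 := lintegral_mul_left_eq_self (μ := relHaar F E)
      (fun t : relTorus F E => ‖posCpow s (relKernel F E t)‖ₑ) (p i)
    rw [← h3]
    refine Eq.trans ?_ (congrArg _ h2)
    rw [← ENNReal.tsum_mul_left]
    refine tsum_congr fun q => ?_
    rw [← lintegral_const_mul]
    · simp only [torusTerm_eq, enorm_mul, Function.comp]
    · exact hm.comp ((measurable_const_mul (p i)).comp (measurable_const_mul _))
  rw [ENNReal.tsum_sigma']
  simp only [h1]
  rw [ENNReal.tsum_mul_right]
  exact ENNReal.mul_ne_top (tsum_enorm_ne_top hc)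
    (ENNReal.mul_ne_top hC1 (relGamma_convergent F E hs).1.2.ne)

/-- A finite integral only gives convergence at almost every point of `D`. As `D` is not null, one
such point `t₀` exists, and comparing the kernel at `t` and `t₀` carries convergence to every `t`.
-/
lemma summable_torusTerm [Countable ι] {s : ℂ} (hs : 0 < s.re)
    (hc : Summable fun i => posCpow s (c i)) (hD : IsStrictDomain (relUnitLattice F E) D)
    (hC : ∀ x, ∑' q, D.indicator (1 : relTorus F E → ℝ≥0∞) (unitProj F E q * x) = C)
    (hC1 : C ≠ ⊤) (t : relTorus F E) : Summable fun x => torusTerm s c p x t := by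
  have h := lintegral_torusTerm_ne_top (p := p) hs hc hD.measurableSet hC hC1
  have hm : ∀ x, Measurable fun t => ‖torusTerm (F := F) (E := E) s c p x t‖ₑ := fun x =>
    (continuous_torusTerm s x).measurable.enorm
  rw [← lintegral_tsum fun x => (hm x).aemeasurable] at h
  have h1 := ae_lt_top (Measurable.tsum hm) h
  have h2 : (relHaar F E).restrict D ≠ 0 := by
    rw [Ne, Measure.restrict_eq_zero]
    exact hD.measure_ne_zero (NeZero.ne _)
  have : (ae ((relHaar F E).restrict D)).NeBot := ae_neBot.2 h2
  obtain ⟨t₀, ht₀⟩ := h1.exists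
  obtain ⟨K, hK⟩ := exists_norm_posCpow_relKernel_le (F := F) (E := E) hs.le t t₀
  have h3 : Summable fun x => torusTerm s c p x t₀ :=
    Summable.of_enorm (f := fun x => torusTerm s c p x t₀) ht₀.ne
  refine Summable.of_norm_bounded ((summable_norm_iff.2 h3).mul_left K) fun x => ?_
  rw [torusTerm_eq, torusTerm_eq, norm_mul, norm_mul, mul_left_comm K]
  refine mul_le_mul_of_nonneg_left ?_ (norm_nonneg (posCpow s (c x.1)))
  rw [← mul_assoc, ← mul_assoc]
  exact hK _

/-- Unfolding of the integral of an Eisenstein series over a fundamental domain of `U_{E/F}`. -/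
theorem integral_tsum_torusTerm [Countable ι] {s : ℂ} (hs : 0 < s.re)
    (hc : Summable fun i => posCpow s (c i)) (hD : IsStrictDomain (relUnitLattice F E) D)
    (hC : ∀ x, ∑' q, D.indicator (1 : relTorus F E → ℝ≥0∞) (unitProj F E q * x) = C)
    (hC1 : C ≠ ⊤) :
    IntegrableOn (fun t => ∑' x, torusTerm s c p x t) D (relHaar F E) ∧
    ∫ t in D, ∑' x, torusTerm s c p x t ∂(relHaar F E) =
      (∑' i, posCpow s (c i)) * (C.toReal * relGamma F E s) := by
  have hm : ∀ x, Measurable (torusTerm (F := F) (E := E) s c p x) := fun x =>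
    (continuous_torusTerm s x).measurable
  have h := lintegral_torusTerm_ne_top (p := p) hs hc hD.measurableSet hC hC1
  refine ⟨integrable_tsum_of_summable hm (summable_torusTerm hs hc hD hC hC1) h, ?_⟩
  rw [integral_tsum (fun x => (hm x).aestronglyMeasurable) h,
    (summable_integral_of_lintegral h).tsum_sigma, ← tsum_mul_right]
  refine tsum_congr fun i => ?_
  -- The unfolding is applied to `κ^s` translated by `p i`; invariance makes the result the same for
  -- all `i`.
  have h2 := hasSum_setIntegral_translate (ν := relHaar F E) hD.measurableSet hC hC1
    ((relGamma_convergent F E hs).1.comp_mul_left (p i))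
    ((continuous_posCpow_relKernel s).measurable.comp (measurable_const_mul (p i)))
  rw [integral_mul_left_eq_self (μ := relHaar F E)
    (fun t : relTorus F E => posCpow s (relKernel F E t)), ← relGamma_eq, Complex.real_smul] at h2
  rw [← h2.tsum_eq, ← tsum_mul_left]
  refine tsum_congr fun q => ?_
  rw [← integral_const_mul]
  simp only [torusTerm_eq]

end TorusIntegral

/-! ### The scalar factor in terms of ideal norms. -/

section Terms

variable {F E : Type*} [Field F] [NumberField F] [Field E] [NumberField E] [Algebra F E] {n : ℕ}

lemma posCpow_sqrtDelta_mul (w : Module.Basis (Fin n) F E) (D : LocalChoice F E n)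
    {𝔄 : (FractionalIdeal (𝓞 E)⁰ E)ˣ} {𝔟 : Ideal (𝓞 E)} {α : Eˣ}
    (h : (𝔟 : FractionalIdeal (𝓞 E)⁰ E) * 𝔄 = FractionalIdeal.spanSingleton (𝓞 E)⁰ (α : E))
    (s : ℂ) : posCpow s (sqrtDelta w D * (torusVol E (absTorus E α))⁻¹) =
      (absDelta w D : ℂ) ^ (s / 2) *
        (((FractionalIdeal.absNorm (𝔄 : FractionalIdeal (𝓞 E)⁰ E) : ℚ) : ℝ) : ℂ) ^ (-s) *
        (1 / (Ideal.absNorm 𝔟 : ℂ) ^ s) := by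
  have h1 : (torusVol E (absTorus E α) : ℝ) = (Ideal.absNorm 𝔟 : ℝ) *
      ((FractionalIdeal.absNorm (𝔄 : FractionalIdeal (𝓞 E)⁰ E) : ℚ) : ℝ) := by
    rw [torusVol_absTorus, ← absNorm_mul_absNorm h]
    push_cast
    rfl
  have h2 : (0 : ℝ) ≤ ((FractionalIdeal.absNorm (𝔄 : FractionalIdeal (𝓞 E)⁰ E) : ℚ) : ℝ) := by
    exact_mod_cast FractionalIdeal.absNorm_nonneg _
  rw [map_mul, posCpow_inv, absDelta_cpow, posCpow_apply s (torusVol E _), h1, Complex.ofReal_mul,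
    Complex.mul_cpow_ofReal_nonneg (Nat.cast_nonneg _) h2, Complex.cpow_neg, mul_inv,
    Complex.ofReal_natCast]
  ring

end Terms

end

end HeckeIntegral

/-! ### The integral formula. -/

theorem mainTheorem2 {F E : Type*} [Field F] [NumberField F] [Field E] [NumberField E]
    [Algebra F E] {n : ℕ} (w : Module.Basis (Fin n) F E) (D : LocalChoice F E n)
    (𝔄 : (FractionalIdeal (𝓞 E)⁰ E)ˣ) (s : ℂ) (hs : 1 < s.re) :
    (∀ t : relTorus F E, Summable fun p :
        Σ 𝔞 : AntiIntegral F, primitiveOrbits (idealLattice w (𝔄 : FractionalIdeal (𝓞 E)⁰ E))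
          (𝔞.1 : FractionalIdeal (𝓞 F)⁰ F) =>
        (detOrbit (p.2 : UnitOrbits F n) (heegner w D t) : ℂ) ^ s) ∧
    (Summable fun 𝔟 : IdealsInClass E (ClassGroup.mk E 𝔄⁻¹) =>
        1 / (Ideal.absNorm (𝔟.1 : Ideal (𝓞 E)) : ℂ) ^ s) ∧
    Integrable (fun t : relTorus F E ⧸ relUnitLattice F E =>
        eisensteinQuotient (idealLattice w (𝔄 : FractionalIdeal (𝓞 E)⁰ E)) s
          (heegnerQuotient w D 𝔄 t))
      (quotientMeasure (relHaar F E) (relUnitLattice F E)) ∧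
    ∫ t : relTorus F E ⧸ relUnitLattice F E,
        eisensteinQuotient (idealLattice w (𝔄 : FractionalIdeal (𝓞 E)⁰ E)) s
          (heegnerQuotient w D 𝔄 t)
      ∂(quotientMeasure (relHaar F E) (relUnitLattice F E)) =
    (absDelta w D : ℂ) ^ (s / 2) * cFactor F E s *
      (((FractionalIdeal.absNorm (𝔄 : FractionalIdeal (𝓞 E)⁰ E) : ℚ) : ℝ) : ℂ) ^ (-s) *
      partialZeta E (ClassGroup.mk E 𝔄⁻¹) s := by
  have hs0 : 0 < s.re := zero_lt_one.trans hs
  obtain ⟨U, hU⟩ := exists_isStrictDomain_relUnitLattice F E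
  obtain ⟨C, hC1, hC, hCF⟩ := exists_cFactor_eq F E hs0 hU
  obtain ⟨α, hα⟩ := exists_generator 𝔄
  obtain ⟨e, he⟩ := exists_orbit_equiv w 𝔄 hα
  have := countable_idealsInClass 𝔄
  let a : IdealsInClass E (ClassGroup.mk E 𝔄⁻¹) → Eˣ := fun 𝔟 => Units.mk0 (α 𝔟) (hα 𝔟).1
  -- The generator of `𝔟 𝔄` enters in two ways: its norm, in the scalar `c`, yields the zeta
  -- function, and its projection `p` to `T_{E/F}` is a translation that the integral does not see.
  let c : IdealsInClass E (ClassGroup.mk E 𝔄⁻¹) → {x : ℝ // 0 < x} := fun 𝔟 =>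
    sqrtDelta w D * (torusVol E (absTorus E (a 𝔟)))⁻¹
  let p : IdealsInClass E (ClassGroup.mk E 𝔄⁻¹) → relTorus F E := fun 𝔟 =>
    torusProj F E (absTorus E (a 𝔟))
  have hterm : ∀ t x, ((detOrbit ((e x).2 : UnitOrbits F n) (heegner w D t) : ℝ) : ℂ) ^ s =
      torusTerm s c p x t := fun t x => by
    rw [he]
    exact congrArg (fun r : ℝ => (r : ℂ) ^ s) (detOrbit_heegner_unit_mul w D (a x.1) x.2 t)
  have hcs : ∀ 𝔟, posCpow s (c 𝔟) = (absDelta w D : ℂ) ^ (s / 2) *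
      (((FractionalIdeal.absNorm (𝔄 : FractionalIdeal (𝓞 E)⁰ E) : ℚ) : ℝ) : ℂ) ^ (-s) *
      (1 / (Ideal.absNorm (𝔟.1 : Ideal (𝓞 E)) : ℂ) ^ s) := fun 𝔟 =>
    posCpow_sqrtDelta_mul w D (α := a 𝔟) (hα 𝔟).2 s
  have hzeta := summable_partialZeta E (ClassGroup.mk E 𝔄⁻¹) hs
  have hc : Summable fun 𝔟 => posCpow s (c 𝔟) := by
    simp only [hcs]
    exact hzeta.mul_left _
  have hsum : ∀ t : relTorus F E, Summable fun x => torusTerm s c p x t :=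
    summable_torusTerm hs0 hc hU hC hC1
  have hseries : ∀ t : relTorus F E, Summable fun p :
        Σ 𝔞 : AntiIntegral F, primitiveOrbits (idealLattice w (𝔄 : FractionalIdeal (𝓞 E)⁰ E))
          (𝔞.1 : FractionalIdeal (𝓞 F)⁰ F) =>
        (detOrbit (p.2 : UnitOrbits F n) (heegner w D t) : ℂ) ^ s := fun t => by
    rw [← e.summable_iff]
    exact (hsum t).congr fun x => (hterm t x).symm
  let Φ : relTorus F E ⧸ relUnitLattice F E → ℂ := fun t =>
    eisensteinQuotient (idealLattice w (𝔄 : FractionalIdeal (𝓞 E)⁰ E)) s (heegnerQuotient w D 𝔄 t)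
  have hΦ : ∀ t : relTorus F E, Φ t = ∑' x, torusTerm s c p x t := fun t => by
    refine (eisenstein_eq_tsum _ s (heegner w D t) (hseries t)).trans ?_
    rw [← e.tsum_eq]
    exact tsum_congr (hterm t)
  -- Measurability on the quotient is tested on `T_{E/F}`, where the function is a convergent
  -- countable series of continuous functions.
  have hΦm : Measurable Φ := by
    refine QuotientGroup.measurable_from_quotient.2 ?_
    simp only [Function.comp_def, hΦ]
    exact measurable_tsum_of_summable (fun x => (continuous_torusTerm s x).measurable) hsum
  have hmk : Measurable (QuotientGroup.mk : relTorus F E → relTorus F E ⧸ relUnitLattice F E) :=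
    QuotientGroup.measurable_coe
  obtain ⟨hint, hval⟩ := integral_tsum_torusTerm (p := p) hs0 hc hU hC hC1
  refine ⟨hseries, hzeta, ?_, ?_⟩
  · rw [quotientMeasure_eq hU]
    refine (integrable_map_measure hΦm.aestronglyMeasurable hmk.aemeasurable).2 ?_
    simp only [Function.comp_def, hΦ]
    exact hint
  · rw [quotientMeasure_eq hU]
    refine (integral_map hmk.aemeasurable hΦm.aestronglyMeasurable).trans ?_
    simp only [hΦ]
    rw [hval, hCF, partialZeta]
    simp only [hcs]
    rw [tsum_mul_left]
    ring
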